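/- **Meijer G-function.** Let $m,n,p,q$ be non-negative integers with $m\le q$, $n\le p$, and let $\mathbf a=(a_1,\dots,a_p)\in\mathbb C^p$, $\mathbf b=(b_1,\dots,b_q)\in\mathbb C^q$ be such that $a_j-b_i$ is not a positive integer for any $i\le m$, $j\le n$. Put $$\mathcal G(s)=\frac{\prod_{j=1}^m\Gamma(b_j+s)\prod_{j=1}^n\Gamma(1-a_j-s)}{\prod_{j=m+1}^q\Gamma(1-b_j-s)\prod_{j=n+1}^p\Gamma(a_j+s)},\qquad \nu=\sum_{j=1}^p\operatorname{Re}a_j-\sum_{j=1}^q\operatorname{Re}b_j,$$ $\underline b=\min_{j\le m}\operatorname{Re}b_j$ ($+\infty$ if $m=0$), $\overline a=\max_{j\le n}\operatorname{Re}a_j$ ($-\infty$ if $n=0$). Consider the mutually exclusive conditions - A: $p+q<2m+2n$; - B: $p+q=2m+2n$ and $p=q$; - C: $p+q=2m+2n$ and $p<q$; - D: $p+q=2m+2n$ and $p>q$. Let $\underline\lambda=-\underline b$ under A, B, C and $\underline\lambda=\max\bigl(-\underline b,\tfrac12-\tfrac{\nu-1}{p-q}\bigr)$ under D; let $\overline\lambda=1-\overline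 a$ under A, B, D and $\overline\lambda=\min\bigl(1-\overline a,\tfrac12+\tfrac{\nu-1}{q-p}\bigr)$ under C. For $r>0$ the Meijer G-function is $$G^{mn}_{pq}\Bigl(\begin{matrix}\mathbf a\\ \mathbf b\end{matrix}\Big|\,r\Bigr)=\frac1{2\pi i}\int_L\mathcal G(s)\,r^{-s}\,ds,$$ where $L$ is a vertical line $c+i\mathbb R$, traversed upwards and deformed in a bounded region so that all poles of $\Gamma(b_j+s)$, $j\le m$, lie to its left and all poles of $\Gamma(1-a_j-s)$, $j\le n$, lie to its right; under C and D, $c$ is also required to satisfy $\nu+(p-q)(c-\tfrac12)>1$. The integral is absolutely convergent under A, C and D, and under B if $\nu>1$; under B with $0<\nu\le1$ and $r\ne1$ it is understood as $\lim_{T\to\infty}$ of the integral over the part of $L$ with $|\operatorname{Im}s|<T$. **Riesz potential.** For $0<\alpha<d$, $$(-\Delta)^{-\alpha/2}f(x)=\frac{\Gamma(\frac{d-\alpha}2)}{2^\alpha\pi^{d/2}\Gamma(\frac\alpha2)}\int_{\mathbb R^d}\frac{f(x-y)}{|y|^{d-\alpha}}\,dy .$$ **Theorem.** Let $V$ be a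 solid harmonic polynomial of degree $l\ge0$ on $\mathbb R^d$ (a homogeneous polynomial of degree $l$ with complex coefficients and $\Delta V=0$), let $\delta=d+2l$ and $0<\alpha<d$, and let $m,n,p,q,\mathbf a,\mathbf b$ be as above. Assume either 1. Condition A, together with $2(1-\overline a)>\alpha+l$ and $-2\underline b<d+l$; or 2. one of Conditions B, C, D, together with $2\overline\lambda>\alpha+l$ and $2\underline\lambda<d+l$, and, under Condition B, also $\nu>0$. Let $$f(x)=V(x)\,G^{mn}_{pq}\Bigl(\begin{matrix}\mathbf a\\ \mathbf b\end{matrix}\Big|\,|x|^2\Bigr).$$ Then for every $x\ne0$ (under Condition B: for every $x\neq 0$ such that $|x|\ne1$ or $\nu+\alpha>1$) the integral defining $(-\Delta)^{-\alpha/2}f(x)$ converges absolutely, the parameters on the right-hand side below satisfy the standing assumptions on the parameters of a Meijer G-function, and $$(-\Delta)^{-\alpha/2}f(x)=2^{-\alpha}\,V(x)\,G^{m+1,n+1}_{p+2,q+2}\Bigl(\begin{matrix}1-\frac{\delta-\alpha}2,\ \mathbf a+\frac\alpha2,\ \frac\alpha2\\[2pt] 0,\ \mathbf b+\frac\alpha2,\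 1-\frac\delta2\end{matrix}\Big|\,|x|^2\Bigr).$$ -/

import Mathlib

open MeasureTheory Filter Topology

noncomputable section

/-! Parameters of a Meijer G-function: `a = (a₁, …, a_p)` and `b = (b₁, …, b_q)` are indexed by
`Fin p` and `Fin q`; the usual index range `1 ≤ j ≤ n` is `(j : ℕ) < n` here. -/

/-- The tacit assumptions on the parameters: `m ≤ q`, `n ≤ p`, and `a_j - b_i` is never a positive
integer (`i ≤ m`, `j ≤ n`), i.e. no pole of a `Γ(b_i + s)` is a pole of a `Γ(1 - a_j - s)`. -/
structure MeijerParams (m n : ℕ) {p q : ℕ} (a : Fin p → ℂ) (b : Fin q → ℂ) : Prop where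
  m_le : m ≤ q
  n_le : n ≤ p
  no_common_pole : ∀ i : Fin q, (i : ℕ) < m → ∀ j : Fin p, (j : ℕ) < n →
    ∀ k : ℕ, a j - b i ≠ (k : ℂ) + 1

/-- The quotient of gamma functions that is the Mellin transform of the Meijer G-function. -/
def meijerMellin (m n : ℕ) {p q : ℕ} (a : Fin p → ℂ) (b : Fin q → ℂ) (s : ℂ) : ℂ :=
  ((∏ j ∈ Finset.univ.filter (fun j : Fin q => (j : ℕ) < m), Complex.Gamma (b j + s)) *
      ∏ j ∈ Finset.univ.filter (fun j : Fin p => (j : ℕ) < n), Complex.Gamma (1 - a j - s)) /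
    ((∏ j ∈ Finset.univ.filter (fun j : Fin q => m ≤ (j : ℕ)), Complex.Gamma (1 - b j - s)) *
      ∏ j ∈ Finset.univ.filter (fun j : Fin p => n ≤ (j : ℕ)), Complex.Gamma (a j + s))

/-- `ν = ∑ Re a_j - ∑ Re b_j`. -/
def meijerNu {p q : ℕ} (a : Fin p → ℂ) (b : Fin q → ℂ) : ℝ :=
  ∑ j, (a j).re - ∑ j, (b j).re

/-- `min {Re b_j : j ≤ m}`, equal to `+∞` if `m = 0`. -/
def bLower (m : ℕ) {q : ℕ} (b : Fin q → ℂ) : EReal :=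
  ⨅ j : {j : Fin q // (j : ℕ) < m}, ((b j).re : EReal)

/-- `max {Re a_j : j ≤ n}`, equal to `-∞` if `n = 0`. -/
def aUpper (n : ℕ) {p : ℕ} (a : Fin p → ℂ) : EReal :=
  ⨆ j : {j : Fin p // (j : ℕ) < n}, ((a j).re : EReal)

abbrev ConditionA (m n p q : ℕ) : Prop := p + q < 2 * m + 2 * n
abbrev ConditionB (m n p q : ℕ) : Prop := p + q = 2 * m + 2 * n ∧ p = q
abbrev ConditionC (m n p q : ℕ) : Prop := p + q = 2 * m + 2 * n ∧ p < q
abbrev ConditionD (m n p q : ℕ) : Prop := p + q = 2 * m + 2 * n ∧ q < p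

/-- The lower index `λ̲`. -/
def lambdaLower (m n : ℕ) {p q : ℕ} (a : Fin p → ℂ) (b : Fin q → ℂ) : EReal :=
  if ConditionD m n p q then
    max (-bLower m b) ((1 / 2 - (meijerNu a b - 1) / ((p : ℝ) - q) : ℝ) : EReal)
  else -bLower m b

/-- The upper index `λ̄`. -/
def lambdaUpper (m n : ℕ) {p q : ℕ} (a : Fin p → ℂ) (b : Fin q → ℂ) : EReal :=
  if ConditionC m n p q then
    min (1 - aUpper n a) ((1 / 2 + (meijerNu a b - 1) / ((q : ℝ) - p) : ℝ) : EReal)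
  else 1 - aUpper n a

/-- The poles of the factors `Γ(b_j + s)`, `j ≤ m`. -/
def lowerPoles (m : ℕ) {q : ℕ} (b : Fin q → ℂ) : Set ℂ :=
  {z | ∃ j : Fin q, (j : ℕ) < m ∧ ∃ k : ℕ, z = -b j - k}

/-- The poles of the factors `Γ(1 - a_j - s)`, `j ≤ n`. -/
def upperPoles (n : ℕ) {p : ℕ} (a : Fin p → ℂ) : Set ℂ :=
  {z | ∃ j : Fin p, (j : ℕ) < n ∧ ∃ k : ℕ, z = 1 - a j + k}

/-- The residue of `f` at `z`: the value of `(2πi)⁻¹ ∮ f` over all sufficiently small circles. -/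
def residueAt (f : ℂ → ℂ) (z : ℂ) : ℂ :=
  limUnder (𝓝[>] (0 : ℝ)) fun ρ => (2 * Real.pi * Complex.I)⁻¹ * ∮ w in C(z, ρ), f w

/-- The abscissae `c` allowed for the vertical line `c + iℝ`: the line avoids all poles and, under
Conditions C and D, the integrand is absolutely integrable along it. -/
def IsAbscissa (m n : ℕ) {p q : ℕ} (a : Fin p → ℂ) (b : Fin q → ℂ) (c : ℝ) : Prop :=
  (∀ z ∈ lowerPoles m b, z.re ≠ c) ∧ (∀ z ∈ upperPoles n a, z.re ≠ c) ∧
    (ConditionC m n p q ∨ ConditionD m n p q →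
      1 < meijerNu a b + ((p : ℝ) - q) * (c - 1 / 2))

/-- `(2πi)⁻¹ ∫_L 𝒢(s) r⁻ˢ ds`, where `L` is the line `c + iℝ` deformed so that all poles of the
`Γ(b_j + s)` lie to its left and all poles of the `Γ(1 - a_j - s)` to its right. Up to homology, the
deformation adds a small positively oriented circle around each pole of the first kind to the right
of the line, and a small negatively oriented one around each pole of the second kind to the left
of it. Along the line the integral is `lim_{T → ∞} ∫_{-T}^{T}`. -/
def meijerContourIntegral (m n : ℕ) {p q : ℕ} (a : Fin p → ℂ) (b : Fin q → ℂ) (r : ℝ) (c : ℝ) : ℂ :=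
  let F : ℂ → ℂ := fun s => meijerMellin m n a b s * (r : ℂ) ^ (-s)
  limUnder atTop (fun T : ℝ => (2 * Real.pi : ℂ)⁻¹ * ∫ t in (-T)..T, F (c + t * Complex.I))
    + ∑ᶠ z ∈ {z ∈ lowerPoles m b | c < z.re}, residueAt F z
    - ∑ᶠ z ∈ {z ∈ upperPoles n a | z.re < c}, residueAt F z

/-- The Meijer G-function `G^{mn}_{pq}(a; b | r)`, `r > 0`. Allowed abscissae always exist, and the
value does not depend on which one is taken. If the poles of the `Γ(b_j + s)` and those of the
`Γ(1 - a_j - s)` are separated by a vertical line (Condition S), taking this line (if allowed) leaves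
no circles, and `meijerG` is the inverse Mellin transform of `meijerMellin`. Under Condition B the integral
converges absolutely if `ν > 1`, and conditionally if `ν > 0` and `r ≠ 1`; that condition is not
meant to be used with `ν ≤ 0`, where the limit defining the integral need not exist. -/
def meijerG (m n : ℕ) {p q : ℕ} (a : Fin p → ℂ) (b : Fin q → ℂ) (r : ℝ) : ℂ :=
  meijerContourIntegral m n a b r (Classical.epsilon (IsAbscissa m n a b))

/-- `V` is a solid harmonic polynomial of degree `l` in `d` variables. -/
def IsSolidHarmonic {d : ℕ} (l : ℕ) (V : MvPolynomial (Fin d) ℂ) : Prop :=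
  V.IsHomogeneous l ∧ ∑ i, MvPolynomial.pderiv i (MvPolynomial.pderiv i V) = 0

/-- The value of a polynomial at a point of `ℝᵈ`. -/
def evalAt {d : ℕ} (V : MvPolynomial (Fin d) ℂ) (x : EuclideanSpace ℝ (Fin d)) : ℂ :=
  MvPolynomial.eval (fun i => (x i : ℂ)) V

/-- `γ_d(α) = 2^α π^{d/2} Γ(α/2) / Γ((d - α)/2)`. -/
def rieszGamma (d : ℕ) (α : ℝ) : ℝ :=
  2 ^ α * Real.pi ^ ((d : ℝ) / 2) * Real.Gamma (α / 2) / Real.Gamma (((d : ℝ) - α) / 2)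

/-- The integrand of the Riesz potential at `x`, as a function of `y`. -/
def rieszIntegrand {d : ℕ} (α : ℝ) (f : EuclideanSpace ℝ (Fin d) → ℂ)
    (x y : EuclideanSpace ℝ (Fin d)) : ℂ :=
  f (x - y) / ((‖y‖ ^ ((d : ℝ) - α) : ℝ) : ℂ)

/-- The Riesz potential `(-Δ)^{-α/2} f (x)`. -/
def rieszPotential {d : ℕ} (α : ℝ) (f : EuclideanSpace ℝ (Fin d) → ℂ)
    (x : EuclideanSpace ℝ (Fin d)) : ℂ :=
  ((1 / rieszGamma d α : ℝ) : ℂ) * ∫ y, rieszIntegrand α f x y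

/-- `(x₀, v₁ + c, …, v_k + c, x₁)`. -/
def shiftExtend {k : ℕ} (x₀ : ℂ) (v : Fin k → ℂ) (c x₁ : ℂ) : Fin (k + 2) → ℂ :=
  Fin.cons (α := fun _ => ℂ) x₀ (Fin.snoc (α := fun _ => ℂ) (fun j => v j + c) x₁)

end

/-! The Riesz potential maps `V(z) ‖z‖^(-2s)` to a multiple of `V(x) ‖x‖^(α-2s)`: in the strip `α +
l < 2 Re s < d + l` the integral converges absolutely and the factor is `2^(-α)` times `rieszRatio`,
a quotient of four gamma functions (`RieszPair.cpow`). A Meijer G-function of `‖z‖²` is a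
superposition of the powers `‖z‖^(-2s)` with density `meijerMellin`, so the potential multiplies the
density by `rieszRatio`. After the translation `s ↦ s - α/2` the four new gamma factors are exactly
those of the four additional parameters (`meijerMellin_riesz`).

The power formula itself comes from writing `Γ(s) Γ(β) ‖z‖^(-2s) ‖x-z‖^(-2β)`, `β = (d-α)/2`, as a
double integral of Gaussians in `z`. The mean value property of solid harmonics evaluates the
`z`-integral, and a Gamma and a Beta integral remain (`integral_evalAt_mul_cpow_mul_rpow`).

For the contour, the hypotheses provide an admissible line `Re s = c` inside the strip. A pole on
the wrong side of that line also lies in the strip, so its residue is a superposition of admissible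
powers over a small circle. The poles created by `rieszRatio` lie outside the strip, on the correct
sides. Hence line goes to line and residues go to residues. That `meijerG` may be computed along
this particular line (`meijerG_eq_of_tendsto`) follows from bounds for the gamma function in
vertical strips and the residue theorem between two lines.

Fubini is applied to truncated line integrals, and the truncation is removed by dominated
convergence (`RieszPair.of_tendsto`). Under A, C and D absolute integrability supplies the majorant.
Under B the integral may converge only conditionally; there the Mellin transform satisfies `𝒢(s+1) =
(1 + O(1/|Im s|)) 𝒢(s)`, while `r^(-s)` is multiplied by `1/r`. Summation by parts along the shift
bounds all truncations by a multiple of `r^(-c) ((1+r)/|1-r|)^θ`, where `θ = 1 - e` with `0 < e < 1`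
and `e ≤ ν`. This weight is integrable against the Riesz kernel (`integrable_sphere_weight`): `θ <
1` suffices off the unit sphere, and `θ < α` is needed in addition if `‖x‖ = 1`, whence the
condition `ν + α > 1`. -/

noncomputable section

/-! ### Gamma function on vertical lines -/

/-- On the line `Re s = 1/2` the point `1 - s` is the conjugate of `s`, so the reflection formula
evaluates `|Γ(s)|²` as `π / cosh(πt)`. -/
theorem norm_Gamma_half_add_le (t : ℝ) :
    ‖Complex.Gamma (1 / 2 + t * Complex.I)‖ ≤ 3 * Real.exp (-(Real.pi / 2) * |t|) := by
  have h1 : Complex.Gamma (1 / 2 + t * Complex.I) * Complex.Gamma (1 - (1 / 2 + t * Complex.I))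
      = Real.pi / Complex.cosh (Real.pi * t) := by
    rw [Complex.Gamma_mul_Gamma_one_sub]
    congr 1
    rw [show (Real.pi : ℂ) * (1 / 2 + t * Complex.I)
      = (Real.pi * t : ℂ) * Complex.I + Real.pi / 2 by ring, Complex.sin_add_pi_div_two,
      Complex.cos_mul_I]
  have h2 : Complex.Gamma (1 - (1 / 2 + t * Complex.I))
      = (starRingEnd ℂ) (Complex.Gamma (1 / 2 + t * Complex.I)) := by
    rw [← Complex.Gamma_conj]
    congr 1
    simp [Complex.ext_iff]
    norm_num
  rw [h2, Complex.mul_conj, Complex.normSq_eq_norm_sq] at h1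
  have h3 : ‖Complex.Gamma (1 / 2 + t * Complex.I)‖ ^ 2 = Real.pi / Real.cosh (Real.pi * t) := by
    exact_mod_cast h1
  have h4 : Real.exp (Real.pi * |t|) / 2 ≤ Real.cosh (Real.pi * t) := by
    rw [← Real.cosh_abs, abs_mul, abs_of_pos Real.pi_pos, Real.cosh_eq]
    have := Real.exp_pos (-(Real.pi * |t|))
    linarith
  refine le_of_sq_le_sq ?_ (by positivity)
  rw [h3, mul_pow, ← Real.exp_nat_mul, div_le_iff₀ (Real.cosh_pos _)]
  have h5 : Real.exp ((2 : ℕ) * (-(Real.pi / 2) * |t|)) * Real.exp (Real.pi * |t|) = 1 := by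
    rw [← Real.exp_add, Real.exp_eq_one_iff]; push_cast; ring
  have := Real.pi_lt_four
  nlinarith [mul_le_mul_of_nonneg_left h4 (Real.exp_pos ((2 : ℕ) * (-(Real.pi / 2) * |t|))).le]

/-- Three lines theorem for `Γ(s + it) exp(s²)`, evaluated at the real point `σ`. The bounds on the
two edges differ by the factor `|t|`, which interpolates to `|t|^(σ-1/2)`. The factor `exp(s²)`
absorbs the variation of the edge bounds with `Im s`. -/
theorem norm_Gamma_le_of_mem_Icc_half {σ t : ℝ} (hσ : 1 / 2 ≤ σ) (hσ' : σ ≤ 3 / 2) (ht : 1 ≤ |t|) :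
    ‖Complex.Gamma (σ + t * Complex.I)‖
      ≤ 6 * Real.exp 5 * |t| ^ (σ - 1 / 2) * Real.exp (-(Real.pi / 2) * |t|) := by
  set f : ℂ → ℂ := fun s => Complex.Gamma (s + t * Complex.I) * Complex.exp (s ^ 2) with hf
  have hexp : ∀ s : ℂ, ‖Complex.exp (s ^ 2)‖ = Real.exp (s.re ^ 2 - s.im ^ 2) := by
    intro s
    rw [Complex.norm_exp, sq, Complex.mul_re]; ring_nf
  -- The constant comes from the edge `3/2`: the recurrence contributes `2|t| e^|y|` to the bound `3
  -- e^(2|y|)`. The number 5 exceeds the maxima `5/4` and `9/2` of `2y + 1/4 - y²` and `3y + 9/4 -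
  -- y²`.
  set M : ℝ := 6 * Real.exp 5 * Real.exp (-(Real.pi / 2) * |t|) with hM
  have hMpos : 0 < M := by positivity
  have hpi := Real.pi_lt_four
  have hhalf : ∀ s : ℂ, s.re = 1 / 2 → ‖Complex.Gamma (s + t * Complex.I)‖
      ≤ 3 * Real.exp (-(Real.pi / 2) * |t|) * Real.exp (2 * |s.im|) := by
    intro s hs
    have : s + t * Complex.I = 1 / 2 + ((s.im + t : ℝ) : ℂ) * Complex.I := by
      apply Complex.ext <;> simp [hs]
    rw [this]
    refine (norm_Gamma_half_add_le _).trans ?_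
    rw [mul_assoc, ← Real.exp_add]
    gcongr
    have h1 : |t| ≤ |s.im + t| + |s.im| := by
      have := abs_sub_abs_le_abs_sub t (-s.im)
      rw [abs_neg, sub_neg_eq_add, add_comm t] at this
      linarith
    nlinarith [abs_nonneg s.im, Real.pi_pos]
  have hdiff : DiffContOnCl ℂ f (Complex.HadamardThreeLines.verticalStrip (1 / 2) (3 / 2)) := by
    refine DifferentiableOn.diffContOnCl ?_
    intro s hs
    have hs' : 1 / 2 ≤ s.re := by
      have : closure (Complex.HadamardThreeLines.verticalStrip (1 / 2) (3 / 2))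
        ⊆ Complex.re ⁻¹' Set.Ici (1 / 2) := by
        refine closure_minimal ?_ (isClosed_Ici.preimage Complex.continuous_re)
        intro z hz
        exact hz.1.le
      exact this hs
    refine DifferentiableAt.differentiableWithinAt ?_
    refine DifferentiableAt.mul ?_ (by fun_prop)
    refine DifferentiableAt.comp s (Complex.differentiableAt_Gamma _ ?_) (by fun_prop)
    intro m hm
    have := congrArg Complex.re hm
    simp at this
    have : (0 : ℝ) ≤ m := Nat.cast_nonneg m
    linarith
  have hbdd : BddAbove ((norm ∘ f) '' Complex.HadamardThreeLines.verticalClosedStrip (1 / 2) (3 / 2)) := by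
    obtain ⟨K, hK⟩ := (isCompact_Icc (a := (1 / 2 : ℝ)) (b := 3 / 2)).bddAbove_image
      (f := Real.Gamma) (fun x hx => by
        refine (Real.differentiableAt_Gamma ?_).continuousAt.continuousWithinAt
        intro m hm
        have : (0 : ℝ) ≤ m := Nat.cast_nonneg m
        have := hx.1
        linarith)
    refine ⟨K * Real.exp (9 / 4), ?_⟩
    rintro _ ⟨s, hs, rfl⟩
    have h1 : (1 / 2 : ℝ) ≤ s.re := hs.1
    have h2 : s.re ≤ 3 / 2 := hs.2
    have h3 : ‖Complex.Gamma (s + t * Complex.I)‖ ≤ Real.Gamma s.re := by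
      have h0 : 0 < (s + t * Complex.I).re := by simp; linarith
      rw [Complex.Gamma_eq_integral h0, Real.Gamma_eq_integral (by linarith)]
      unfold Complex.GammaIntegral
      refine (norm_integral_le_integral_norm _).trans (le_of_eq ?_)
      refine setIntegral_congr_fun measurableSet_Ioi ?_
      intro x hx
      simp only [norm_mul, Complex.norm_real]
      rw [Complex.norm_cpow_eq_rpow_re_of_pos hx, Real.norm_of_nonneg (Real.exp_pos _).le]
      simp
    have h4 : Real.Gamma s.re ≤ K := hK ⟨_, ⟨h1, h2⟩, rfl⟩
    simp only [Function.comp, hf, norm_mul, hexp]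
    refine mul_le_mul (h3.trans h4) (Real.exp_le_exp.2 ?_) (Real.exp_pos _).le
      ((norm_nonneg _).trans (h3.trans h4))
    nlinarith [sq_nonneg s.im]
  have ha : ∀ s ∈ Complex.re ⁻¹' {1 / 2}, ‖f s‖ ≤ M := by
    intro s hs
    have hs' : s.re = 1 / 2 := hs
    rw [hf]; simp only [norm_mul, hexp]
    refine (mul_le_mul_of_nonneg_right (hhalf s hs') (Real.exp_pos _).le).trans ?_
    rw [mul_assoc, ← Real.exp_add, hM]
    have : Real.exp (2 * |s.im| + (s.re ^ 2 - s.im ^ 2)) ≤ Real.exp 5 := by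
      apply Real.exp_le_exp.2
      rw [hs']
      nlinarith [sq_nonneg (|s.im| - 1), sq_abs s.im]
    have h5 := Real.exp_pos (-(Real.pi / 2) * |t|)
    have h6 := Real.exp_pos 5
    calc _ ≤ 3 * Real.exp (-(Real.pi / 2) * |t|) * Real.exp 5 := by gcongr
      _ ≤ _ := by nlinarith [mul_pos h5 h6]
  have hb : ∀ s ∈ Complex.re ⁻¹' {3 / 2}, ‖f s‖ ≤ M * |t| := by
    intro s hs
    have hs' : s.re = 3 / 2 := hs
    have hg : Complex.Gamma (s + t * Complex.I)
        = (s - 1 + t * Complex.I) * Complex.Gamma (s - 1 + t * Complex.I) := by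
      rw [← Complex.Gamma_add_one]
      · congr 1; ring
      · intro h
        have := congrArg Complex.re h
        simp [hs'] at this
        norm_num at this
    have h1 := hhalf (s - 1) (by simp [hs']; norm_num)
    have h2 : ‖s - 1 + t * Complex.I‖ ≤ 2 * |t| * Real.exp |s.im| := by
      have h3 := Complex.norm_le_abs_re_add_abs_im (s - 1 + t * Complex.I)
      have h4 : |(s - 1 + t * Complex.I).re| = 1 / 2 := by simp [hs']; norm_num
      have h5 : |(s - 1 + t * Complex.I).im| ≤ |s.im| + |t| := by
        simp; exact abs_add_le _ _
      have h6 := Real.add_one_le_exp |s.im|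
      nlinarith [abs_nonneg s.im, abs_nonneg t]
    rw [hf]; simp only [norm_mul, hexp]
    rw [hg, norm_mul]
    simp only [Complex.sub_im, Complex.one_im, sub_zero] at h1
    have h7 : Real.exp (2 * |s.im|) * Real.exp |s.im| * Real.exp (s.re ^ 2 - s.im ^ 2) ≤ Real.exp 5 := by
      rw [← Real.exp_add, ← Real.exp_add]
      apply Real.exp_le_exp.2
      rw [hs']
      nlinarith [sq_nonneg (|s.im| - 3 / 2), sq_abs s.im]
    calc _ ≤ (2 * |t| * Real.exp |s.im|) * (3 * Real.exp (-(Real.pi / 2) * |t|) * Real.exp (2 * |s.im|))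
          * Real.exp (s.re ^ 2 - s.im ^ 2) := by gcongr
      _ = (6 * Real.exp (-(Real.pi / 2) * |t|) * |t|) *
        (Real.exp (2 * |s.im|) * Real.exp |s.im| * Real.exp (s.re ^ 2 - s.im ^ 2)) := by ring
      _ ≤ (6 * Real.exp (-(Real.pi / 2) * |t|) * |t|) * Real.exp 5 := by gcongr
      _ = M * |t| := by rw [hM]; ring
  have key := Complex.HadamardThreeLines.norm_le_interp_of_mem_verticalClosedStrip'
    (f := f) (z := (σ : ℂ)) (l := 1 / 2) (u := 3 / 2) (by norm_num)
    (by simp only [Complex.HadamardThreeLines.verticalClosedStrip, Set.mem_preimage,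
          Complex.ofReal_re]; exact ⟨hσ, hσ'⟩) hdiff hbdd ha hb
  have h1 : ‖Complex.Gamma (σ + t * Complex.I)‖ ≤ ‖f σ‖ := by
    rw [hf]; simp only [norm_mul, hexp]
    refine le_mul_of_one_le_right (norm_nonneg _) (Real.one_le_exp ?_)
    simp; positivity
  refine (h1.trans key).trans (le_of_eq ?_)
  have h2 : ((3 / 2 : ℝ) - 1 / 2) = 1 := by norm_num
  rw [h2, div_one, Complex.ofReal_re, Real.mul_rpow hMpos.le (abs_nonneg _), ← mul_assoc,
    ← Real.rpow_add hMpos]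
  rw [show 1 - (σ - 1 / 2) + (σ - 1 / 2) = 1 by ring, Real.rpow_one, hM]
  ring

/-- The functional equation widens the strip by one unit on either side. Going left divides by `s`,
of modulus at least `|Im s|`; going right multiplies by `s - 1`, of modulus at most `(n + 3)|Im s|`.
-/
theorem exists_norm_Gamma_le (n : ℕ) : ∃ C : ℝ, 0 ≤ C ∧ ∀ s : ℂ, 1 / 2 - n ≤ s.re →
    s.re ≤ 3 / 2 + n → 1 ≤ |s.im| →
    ‖Complex.Gamma s‖ ≤ C * |s.im| ^ (s.re - 1 / 2) * Real.exp (-(Real.pi / 2) * |s.im|) := by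
  induction n with
  | zero =>
    refine ⟨6 * Real.exp 5, by positivity, fun s h1 h2 h3 => ?_⟩
    have := norm_Gamma_le_of_mem_Icc_half (σ := s.re) (t := s.im) (by simpa using h1)
      (by simpa using h2) h3
    rwa [Complex.re_add_im] at this
  | succ n ih =>
    obtain ⟨C, hC, h⟩ := ih
    refine ⟨C * (n + 3), by positivity, fun s h1 h2 h3 => ?_⟩
    push_cast at h1 h2
    have ht0 : 0 < |s.im| := by linarith
    have hs0 : s ≠ 0 := by
      rintro rfl; simp at h3; linarith
    have hs1 : s - 1 ≠ 0 := by
      intro h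
      have := congrArg Complex.im h
      simp at this
      rw [this] at ht0; simp at ht0
    by_cases hlow : s.re < 1 / 2 - n
    · have h4 := h (s + 1) (by simp; linarith) (by simp; linarith) (by simpa using h3)
      rw [Complex.Gamma_add_one s hs0, norm_mul] at h4
      simp only [Complex.add_re, Complex.add_im, Complex.one_re, Complex.one_im, add_zero] at h4
      have h5 : |s.im| ≤ ‖s‖ := Complex.abs_im_le_norm s
      have h6 : |s.im| * ‖Complex.Gamma s‖ ≤
        |s.im| * (C * |s.im| ^ (s.re - 1 / 2) * Real.exp (-(Real.pi / 2) * |s.im|)) := by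
        refine (mul_le_mul_of_nonneg_right h5 (norm_nonneg _)).trans (h4.trans (le_of_eq ?_))
        rw [show s.re + 1 - 1 / 2 = 1 + (s.re - 1 / 2) by ring, Real.rpow_add ht0, Real.rpow_one]
        ring
      refine (le_of_mul_le_mul_left h6 ht0).trans ?_
      have : C ≤ C * (n + 3) := le_mul_of_one_le_right hC (by linarith [Nat.cast_nonneg (α := ℝ) n])
      gcongr
    · by_cases hhigh : 3 / 2 + n < s.re
      · have h4 := h (s - 1) (by simp; linarith [Nat.cast_nonneg (α := ℝ) n]) (by simp; linarith) (by simpa using h3)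
        have hg : Complex.Gamma s = (s - 1) * Complex.Gamma (s - 1) := by
          rw [← Complex.Gamma_add_one _ hs1, sub_add_cancel]
        rw [hg, norm_mul]
        simp only [Complex.sub_re, Complex.sub_im, Complex.one_re, Complex.one_im, sub_zero] at h4
        have h5 : ‖s - 1‖ ≤ (n + 3) * |s.im| := by
          have h6 := Complex.norm_le_abs_re_add_abs_im (s - 1)
          have h7 : |(s - 1).re| ≤ n + 2 := by
            rw [abs_le]; simp; constructor <;> linarith [Nat.cast_nonneg (α := ℝ) n]
          have h8 : (s - 1).im = s.im := by simp
          rw [h8] at h6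
          nlinarith [Nat.cast_nonneg (α := ℝ) n]
        calc _ ≤ ((n + 3) * |s.im|) * (C * |s.im| ^ (s.re - 1 - 1 / 2) * Real.exp (-(Real.pi / 2) * |s.im|)) := by
              gcongr
          _ = _ := by
            rw [show s.re - 1 / 2 = 1 + (s.re - 1 - 1 / 2) by ring, Real.rpow_add ht0, Real.rpow_one]
            ring
      · refine (h s (by linarith) (by linarith) h3).trans ?_
        have : C ≤ C * (n + 3) := le_mul_of_one_le_right hC (by linarith [Nat.cast_nonneg (α := ℝ) n])
        gcongr

/-- Reflection gives `1/Γ(s) = Γ(1-s) sin(πs)/π`. The growth `e^(π|Im s|)` of the sine turns the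
decay of `Γ(1-s)` into the growth rate `π/2`. -/
theorem exists_norm_Gamma_inv_le (n : ℕ) : ∃ C : ℝ, 0 ≤ C ∧ ∀ s : ℂ, 1 / 2 - n ≤ s.re →
    s.re ≤ 1 / 2 + n → 1 ≤ |s.im| →
    ‖(Complex.Gamma s)⁻¹‖ ≤ C * |s.im| ^ (1 / 2 - s.re) * Real.exp ((Real.pi / 2) * |s.im|) := by
  obtain ⟨C, hC, h⟩ := exists_norm_Gamma_le n
  refine ⟨C, hC, fun s h1 h2 h3 => ?_⟩
  have h4 := h (1 - s) (by simp; linarith) (by simp; linarith) (by simpa using h3)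
  have h5 := Complex.Gamma_mul_Gamma_one_sub s
  have ht0 : 0 < |s.im| := by linarith
  have hG : Complex.Gamma s ≠ 0 := by
    apply Complex.Gamma_ne_zero
    intro m hm
    rw [hm] at ht0; simp at ht0
  have h6 : (Complex.Gamma s)⁻¹ = Complex.Gamma (1 - s) * Complex.sin (Real.pi * s) / Real.pi := by
    have hpi : (Real.pi : ℂ) ≠ 0 := by exact_mod_cast Real.pi_ne_zero
    have hG' : Complex.Gamma (1 - s) ≠ 0 := by
      apply Complex.Gamma_ne_zero
      intro m hm
      have := congrArg Complex.im hm
      simp at this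
      rw [this] at ht0; simp at ht0
    have hsin : Complex.sin (Real.pi * s) ≠ 0 := by
      intro h0
      rw [h0, div_zero] at h5
      exact mul_ne_zero hG hG' h5
    rw [eq_div_iff hpi, inv_mul_eq_iff_eq_mul₀ hG, ← mul_assoc, h5, div_mul_cancel₀ _ hsin]
  have h7 : ‖Complex.sin (Real.pi * s)‖ ≤ Real.exp (Real.pi * |s.im|) := by
    rw [Complex.sin]
    have e1 : ∀ z : ℂ, ‖Complex.exp z‖ ≤ Real.exp |z.re| := by
      intro z; rw [Complex.norm_exp]; exact Real.exp_le_exp.2 (le_abs_self _)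
    have e2 := e1 (-(Real.pi * s) * Complex.I)
    have e3 := e1 ((Real.pi * s) * Complex.I)
    have r1 : |(-(Real.pi * s) * Complex.I).re| = Real.pi * |s.im| := by
      simp [abs_mul, abs_of_pos Real.pi_pos]
    have r2 : |((Real.pi * s) * Complex.I).re| = Real.pi * |s.im| := by
      simp [abs_mul, abs_of_pos Real.pi_pos]
    rw [r1] at e2; rw [r2] at e3
    rw [norm_div, norm_mul, Complex.norm_I, mul_one, Complex.norm_two, div_le_iff₀ (by norm_num)]
    exact (norm_sub_le _ _).trans (by linarith)
  rw [h6, norm_div, norm_mul, Complex.norm_real, Real.norm_of_nonneg Real.pi_pos.le,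
    div_le_iff₀ Real.pi_pos]
  simp only [Complex.sub_re, Complex.sub_im, Complex.one_re, Complex.one_im, zero_sub, abs_neg] at h4
  calc _ ≤ (C * |s.im| ^ (1 - s.re - 1 / 2) * Real.exp (-(Real.pi / 2) * |s.im|)) * Real.exp (Real.pi * |s.im|) := by gcongr
    _ = C * |s.im| ^ (1 / 2 - s.re) * Real.exp ((Real.pi / 2) * |s.im|) := by
      rw [mul_assoc, ← Real.exp_add]; ring_nf
    _ ≤ _ := by
      refine le_mul_of_one_le_right (by positivity) ?_
      linarith [Real.pi_gt_three]

/-- `f` is of order `|Im s| ^ (e (Re s)) * exp (-k π |Im s| / 2)` on the strip `c₁ ≤ Re s ≤ c₂`,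
away from the real axis. -/
def VerticalBound (c₁ c₂ : ℝ) (e : ℝ → ℝ) (k : ℝ) (f : ℂ → ℂ) : Prop :=
  ∃ C T : ℝ, 0 ≤ C ∧ 1 ≤ T ∧ ∀ s : ℂ, c₁ ≤ s.re → s.re ≤ c₂ → T ≤ |s.im| →
    ‖f s‖ ≤ C * |s.im| ^ e s.re * Real.exp (-k * (Real.pi / 2) * |s.im|)

namespace VerticalBound

variable {c₁ c₂ k k' : ℝ} {e e' : ℝ → ℝ} {f g : ℂ → ℂ}

theorem congr (h : VerticalBound c₁ c₂ e k f) (he : ∀ σ, e σ = e' σ) (hk : k = k')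
    (hf : ∀ s, f s = g s) : VerticalBound c₁ c₂ e' k' g := by
  obtain rfl : e = e' := funext he
  obtain rfl : f = g := funext hf
  subst hk
  exact h

theorem mul (hf : VerticalBound c₁ c₂ e k f) (hg : VerticalBound c₁ c₂ e' k' g) :
    VerticalBound c₁ c₂ (fun σ => e σ + e' σ) (k + k') (fun s => f s * g s) := by
  obtain ⟨C, T, hC, hT, h⟩ := hf
  obtain ⟨C', T', hC', hT', h'⟩ := hg
  refine ⟨C * C', max T T', by positivity, le_max_of_le_left hT, fun s h1 h2 h3 => ?_⟩
  have a1 := h s h1 h2 ((le_max_left _ _).trans h3)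
  have a2 := h' s h1 h2 ((le_max_right _ _).trans h3)
  have ht0 : 0 < |s.im| := by linarith [le_max_left T T']
  rw [norm_mul, Real.rpow_add ht0]
  calc _ ≤ _ := mul_le_mul a1 a2 (norm_nonneg _) (by positivity)
    _ = C * C' * (|s.im| ^ e s.re * |s.im| ^ e' s.re) * (Real.exp (-k * (Real.pi / 2) * |s.im|) *
        Real.exp (-k' * (Real.pi / 2) * |s.im|)) := by ring
    _ = _ := by rw [← Real.exp_add]; ring_nf

theorem one : VerticalBound c₁ c₂ (fun _ => 0) 0 (fun _ => 1) :=
  ⟨1, 1, zero_le_one, le_rfl, fun s _ _ _ => by simp⟩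

theorem prod {ι : Type*} (S : Finset ι) {e : ι → ℝ → ℝ} {k : ι → ℝ} {f : ι → ℂ → ℂ}
    (h : ∀ i ∈ S, VerticalBound c₁ c₂ (e i) (k i) (f i)) :
    VerticalBound c₁ c₂ (fun σ => ∑ i ∈ S, e i σ) (∑ i ∈ S, k i) (fun s => ∏ i ∈ S, f i s) := by
  classical
  induction S using Finset.induction_on with
  | empty => simpa using one
  | insert i S hi ih =>
    refine ((h i (Finset.mem_insert_self _ _)).mul
      (ih fun j hj => h j (Finset.mem_insert_of_mem hj))).congr ?_ ?_ ?_ <;>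
    simp [hi]

/-- Once `|Im s| ≥ 2|Im b| + T`, the ordinates of `s` and `b + s` agree up to a factor 2 and differ
by at most `|Im b|`. The first fact controls the power, uniformly because the exponent is bounded by
`E`; the second controls the exponential. -/
theorem shift (b : ℂ) {E : ℝ} (hE : ∀ σ ∈ Set.Icc (c₁ + b.re) (c₂ + b.re), |e σ| ≤ E)
    (hf : VerticalBound (c₁ + b.re) (c₂ + b.re) e k f) :
    VerticalBound c₁ c₂ (fun σ => e (b.re + σ)) k (fun s => f (b + s)) := by
  obtain ⟨C, T, hC, hT, h⟩ := hf
  refine ⟨C * 2 ^ E * Real.exp (|k| * (Real.pi / 2) * |b.im|), 2 * |b.im| + T, by positivity,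
    by linarith [abs_nonneg b.im], fun s h1 h2 h3 => ?_⟩
  have h4 := h (b + s) (by simp; linarith) (by simp; linarith) (by
    simp only [Complex.add_im]
    have := abs_sub_abs_le_abs_sub s.im (-b.im)
    rw [abs_neg, sub_neg_eq_add, add_comm s.im] at this
    linarith [abs_nonneg b.im])
  have hu : |b.im + s.im| ≤ 2 * |s.im| := by
    have := abs_add_le b.im s.im
    linarith [abs_nonneg b.im]
  have hd : |(|b.im + s.im| - |s.im|)| ≤ |b.im| := by
    have := abs_abs_sub_abs_le_abs_sub (b.im + s.im) s.im
    simpa using this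
  have hl : |s.im| ≤ 2 * |b.im + s.im| := by
    have := (abs_le.1 hd).1
    linarith
  have ht0 : 0 < |s.im| := by linarith [abs_nonneg b.im]
  have ht1 : 0 < |b.im + s.im| := by linarith
  refine h4.trans ?_
  simp only [Complex.add_re, Complex.add_im]
  have hEb := hE (b.re + s.re) ⟨by linarith, by linarith⟩
  have p1 : |b.im + s.im| ^ e (b.re + s.re) ≤ 2 ^ E * |s.im| ^ e (b.re + s.re) := by
    have q : (|b.im + s.im| / |s.im|) ^ e (b.re + s.re) ≤ 2 ^ E := by
      rcases le_total 0 (e (b.re + s.re)) with h0 | h0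
      · calc _ ≤ (2 : ℝ) ^ e (b.re + s.re) := by
              apply Real.rpow_le_rpow (by positivity) _ h0
              rwa [div_le_iff₀ ht0]
          _ ≤ 2 ^ E := Real.rpow_le_rpow_of_exponent_le (by norm_num) ((le_abs_self _).trans hEb)
      · have : (|b.im + s.im| / |s.im|) ^ e (b.re + s.re) = (|s.im| / |b.im + s.im|) ^ (-e (b.re + s.re)) := by
          rw [Real.rpow_neg (by positivity), ← Real.inv_rpow (by positivity), inv_div]
        rw [this]
        calc _ ≤ (2 : ℝ) ^ (-e (b.re + s.re)) := by
              apply Real.rpow_le_rpow (by positivity) _ (by linarith)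
              rwa [div_le_iff₀ ht1]
          _ ≤ 2 ^ E := Real.rpow_le_rpow_of_exponent_le (by norm_num) ((neg_le_abs _).trans hEb)
    rw [Real.div_rpow ht1.le ht0.le, div_le_iff₀ (by positivity)] at q
    exact q
  have p2 : Real.exp (-k * (Real.pi / 2) * |b.im + s.im|)
      ≤ Real.exp (|k| * (Real.pi / 2) * |b.im|) * Real.exp (-k * (Real.pi / 2) * |s.im|) := by
    rw [← Real.exp_add]
    apply Real.exp_le_exp.2
    have q1 : -k * (|b.im + s.im| - |s.im|) ≤ |k| * |b.im| := by
      calc _ ≤ |-k * (|b.im + s.im| - |s.im|)| := le_abs_self _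
        _ = |k| * |(|b.im + s.im| - |s.im|)| := by rw [abs_mul, abs_neg]
        _ ≤ _ := by gcongr
    nlinarith [Real.pi_pos]
  calc _ ≤ C * (2 ^ E * |s.im| ^ e (b.re + s.re)) * (Real.exp (|k| * (Real.pi / 2) * |b.im|) * Real.exp (-k * (Real.pi / 2) * |s.im|)) := by gcongr
    _ = _ := by ring

theorem comp_neg (hf : VerticalBound (-c₂) (-c₁) e k f) :
    VerticalBound c₁ c₂ (fun σ => e (-σ)) k (fun s => f (-s)) := by
  obtain ⟨C, T, hC, hT, h⟩ := hf
  refine ⟨C, T, hC, hT, fun s h1 h2 h3 => ?_⟩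
  have := h (-s) (by simpa using h2) (by simpa using h1) (by simpa using h3)
  simpa using this

theorem gamma (c₁ c₂ : ℝ) : VerticalBound c₁ c₂ (fun σ => σ - 1 / 2) 1 Complex.Gamma := by
  obtain ⟨n, hn⟩ := exists_nat_ge (|c₁| + |c₂| + 1)
  obtain ⟨C, hC, h⟩ := exists_norm_Gamma_le n
  refine ⟨C, 1, hC, le_rfl, fun s h1 h2 h3 => ?_⟩
  have := h s (by linarith [neg_abs_le c₁, abs_nonneg c₂]) (by linarith [le_abs_self c₂, abs_nonneg c₁]) h3
  rwa [neg_one_mul]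

theorem gamma_inv (c₁ c₂ : ℝ) :
    VerticalBound c₁ c₂ (fun σ => 1 / 2 - σ) (-1) (fun s => (Complex.Gamma s)⁻¹) := by
  obtain ⟨n, hn⟩ := exists_nat_ge (|c₁| + |c₂| + 1)
  obtain ⟨C, hC, h⟩ := exists_norm_Gamma_inv_le n
  refine ⟨C, 1, hC, le_rfl, fun s h1 h2 h3 => ?_⟩
  have := h s (by linarith [neg_abs_le c₁, abs_nonneg c₂]) (by linarith [le_abs_self c₂, abs_nonneg c₁]) h3
  rwa [neg_neg, one_mul]

theorem exists_abs_sub_half_le (c₁ c₂ : ℝ) : ∃ E : ℝ, ∀ σ ∈ Set.Icc c₁ c₂, |σ - 1 / 2| ≤ E :=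
  ⟨|c₁| + |c₂| + 1 / 2, fun σ hσ => abs_le.2
    ⟨by linarith [neg_abs_le c₁, abs_nonneg c₂, hσ.1], by linarith [le_abs_self c₂, abs_nonneg c₁, hσ.2]⟩⟩

theorem gamma_add (c₁ c₂ : ℝ) (b : ℂ) :
    VerticalBound c₁ c₂ (fun σ => b.re + σ - 1 / 2) 1 (fun s => Complex.Gamma (b + s)) := by
  obtain ⟨E, hE⟩ := exists_abs_sub_half_le (c₁ + b.re) (c₂ + b.re)
  exact shift b hE (gamma _ _)

theorem gamma_add_inv (c₁ c₂ : ℝ) (b : ℂ) :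
    VerticalBound c₁ c₂ (fun σ => 1 / 2 - (b.re + σ)) (-1)
      (fun s => (Complex.Gamma (b + s))⁻¹) := by
  obtain ⟨E, hE⟩ := exists_abs_sub_half_le (c₁ + b.re) (c₂ + b.re)
  exact shift b (fun σ hσ => by rw [abs_sub_comm]; exact hE σ hσ) (gamma_inv _ _)

theorem gamma_one_sub (c₁ c₂ : ℝ) (a : ℂ) :
    VerticalBound c₁ c₂ (fun σ => 1 / 2 - a.re - σ) 1 (fun s => Complex.Gamma (1 - a - s)) :=
  (gamma_add (-c₂) (-c₁) (1 - a)).comp_neg.congr (fun σ => by simp; ring) rfl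
    (fun s => by rw [sub_eq_add_neg (1 - a)])

theorem gamma_one_sub_inv (c₁ c₂ : ℝ) (a : ℂ) :
    VerticalBound c₁ c₂ (fun σ => a.re + σ - 1 / 2) (-1)
      (fun s => (Complex.Gamma (1 - a - s))⁻¹) :=
  (gamma_add_inv (-c₂) (-c₁) (1 - a)).comp_neg.congr (fun σ => by simp; ring) rfl
    (fun s => by rw [sub_eq_add_neg (1 - a)])

end VerticalBound

/-! ### Growth of the Mellin transform in vertical strips. -/

theorem Fin.card_filter_val_lt' {q m : ℕ} (h : m ≤ q) :
    (Finset.univ.filter (fun j : Fin q => (j : ℕ) < m)).card = m := by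
  simp [Fin.card_filter_val_lt, h]

theorem Fin.card_filter_le_val {q m : ℕ} :
    (Finset.univ.filter (fun j : Fin q => m ≤ (j : ℕ))).card = q - m := by
  have := Finset.card_filter_add_card_filter_not (s := (Finset.univ : Finset (Fin q)))
    (fun j : Fin q => (j : ℕ) < m)
  simp only [not_lt, Finset.card_univ, Fintype.card_fin, Fin.card_filter_val_lt] at this
  omega

theorem Fin.sum_filter_lt_add_sum_filter_le {q : ℕ} (m : ℕ) (f : Fin q → ℝ) :
    ∑ j ∈ Finset.univ.filter (fun j : Fin q => (j : ℕ) < m), f j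
      + ∑ j ∈ Finset.univ.filter (fun j : Fin q => m ≤ (j : ℕ)), f j = ∑ j, f j := by
  simpa only [not_lt] using Finset.sum_filter_add_sum_filter_not Finset.univ
    (fun j : Fin q => (j : ℕ) < m) f

/-- `Γ(b+s)` and `1/Γ(1-b-s)` have the same power exponent, and so do `Γ(1-a-s)` and `1/Γ(a+s)`; the
total exponent therefore does not see `m` and `n`. They enter only through the exponential rate,
each numerator factor counting `+1` and each denominator factor `-1`. Condition A is thus
exponential decay, and B, C, D are the case of a pure power. -/
theorem verticalBound_meijerMellin {m n p q : ℕ} {a : Fin p → ℂ} {b : Fin q → ℂ}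
    (hm : m ≤ q) (hn : n ≤ p) (c₁ c₂ : ℝ) :
    VerticalBound c₁ c₂ (fun σ => -(meijerNu a b + ((p : ℝ) - q) * (σ - 1 / 2)))
      (2 * m + 2 * n - p - q) (meijerMellin m n a b) := by
  have h := ((VerticalBound.prod (Finset.univ.filter (fun j : Fin q => (j : ℕ) < m))
      (fun j _ => VerticalBound.gamma_add c₁ c₂ (b j))).mul
    (VerticalBound.prod (Finset.univ.filter (fun j : Fin p => (j : ℕ) < n))
      (fun j _ => VerticalBound.gamma_one_sub c₁ c₂ (a j)))).mul
    ((VerticalBound.prod (Finset.univ.filter (fun j : Fin q => m ≤ (j : ℕ)))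
      (fun j _ => VerticalBound.gamma_one_sub_inv c₁ c₂ (b j))).mul
    (VerticalBound.prod (Finset.univ.filter (fun j : Fin p => n ≤ (j : ℕ)))
      (fun j _ => VerticalBound.gamma_add_inv c₁ c₂ (a j))))
  refine h.congr (fun σ => ?_) ?_ (fun s => ?_)
  · have h1 := Fin.sum_filter_lt_add_sum_filter_le m (fun j => (b j).re + σ - 1 / 2)
    have h2 := Fin.sum_filter_lt_add_sum_filter_le n (fun j => 1 / 2 - (a j).re - σ)
    have h3 : ∀ j, 1 / 2 - ((a j).re + σ) = 1 / 2 - (a j).re - σ := fun j => by ring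
    simp only [h3]
    have h4 : ∑ j, ((b j).re + σ - 1 / 2) = ∑ j, (b j).re + q * (σ - 1 / 2) := by
      simp only [add_sub_assoc, Finset.sum_add_distrib]; simp; ring
    have h5 : ∑ j, (1 / 2 - (a j).re - σ) = -∑ j, (a j).re - p * (σ - 1 / 2) := by
      have : ∀ j, 1 / 2 - (a j).re - σ = -(a j).re + (-(σ - 1 / 2)) := fun j => by ring
      simp only [this, Finset.sum_add_distrib]; simp; ring
    rw [h4] at h1; rw [h5] at h2
    unfold meijerNu
    linarith
  · simp only [Finset.sum_const, nsmul_eq_mul, Fin.card_filter_val_lt' hm,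
      Fin.card_filter_val_lt' hn, Fin.card_filter_le_val, Nat.cast_sub hm, Nat.cast_sub hn]
    ring
  · simp only [meijerMellin, div_eq_mul_inv, mul_inv, Finset.prod_inv_distrib]

/-! ### Shift by one under Condition B -/

/-- `u = 1 + O(1 / |Im s|)` on the strip `c₁ ≤ Re s ≤ c₂`. -/
def VerticalNearOne (c₁ c₂ : ℝ) (u : ℂ → ℂ) : Prop :=
  ∃ C T : ℝ, 0 ≤ C ∧ 1 ≤ T ∧ ∀ s : ℂ, c₁ ≤ s.re → s.re ≤ c₂ → T ≤ |s.im| →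
    ‖u s - 1‖ ≤ C / |s.im|

namespace VerticalNearOne

variable {c₁ c₂ : ℝ} {u v : ℂ → ℂ}

theorem mul (hu : VerticalNearOne c₁ c₂ u) (hv : VerticalNearOne c₁ c₂ v) :
    VerticalNearOne c₁ c₂ (fun s => u s * v s) := by
  obtain ⟨C, T, hC, hT, h⟩ := hu
  obtain ⟨C', T', hC', hT', h'⟩ := hv
  refine ⟨C * C' + C + C', max T T', by positivity, le_max_of_le_left hT, fun s h1 h2 h3 => ?_⟩
  have a1 := h s h1 h2 ((le_max_left _ _).trans h3)
  have a2 := h' s h1 h2 ((le_max_right _ _).trans h3)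
  have ht1 : 1 ≤ |s.im| := by linarith [le_max_left T T']
  have hC1 : C' / |s.im| ≤ C' := div_le_self hC' ht1
  rw [show u s * v s - 1 = (u s - 1) * (v s - 1) + (u s - 1) + (v s - 1) by ring]
  calc _ ≤ ‖u s - 1‖ * ‖v s - 1‖ + ‖u s - 1‖ + ‖v s - 1‖ := by
        rw [← norm_mul]; exact (norm_add_le _ _).trans (by gcongr; exact norm_add_le _ _)
    _ ≤ C / |s.im| * C' + C / |s.im| + C' / |s.im| := by
        gcongr
        exact a2.trans hC1
    _ = _ := by ring

theorem prod {ι : Type*} (S : Finset ι) {u : ι → ℂ → ℂ} (h : ∀ i ∈ S, VerticalNearOne c₁ c₂ (u i)) :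
    VerticalNearOne c₁ c₂ (fun s => ∏ i ∈ S, u i s) := by
  classical
  induction S using Finset.induction_on with
  | empty => exact ⟨0, 1, le_rfl, le_rfl, fun s _ _ _ => by simp⟩
  | insert i S hi ih =>
    simp only [Finset.prod_insert hi]
    exact (h i (Finset.mem_insert_self _ _)).mul
      (ih fun j hj => h j (Finset.mem_insert_of_mem hj))

theorem norm_div_le (b s : ℂ) (hs : 1 ≤ |s.im|) : ‖b / s‖ ≤ ‖b‖ / |s.im| := by
  rw [norm_div]
  have := Complex.abs_im_le_norm s
  gcongr

theorem one_add_div (c₁ c₂ : ℝ) (b : ℂ) : VerticalNearOne c₁ c₂ (fun s => 1 + b / s) :=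
  ⟨‖b‖, 1, norm_nonneg _, le_rfl, fun s _ _ h => by simpa using norm_div_le b s h⟩

theorem one_add_div_inv (c₁ c₂ : ℝ) (b : ℂ) : VerticalNearOne c₁ c₂ (fun s => (1 + b / s)⁻¹) := by
  refine ⟨2 * ‖b‖, 2 * ‖b‖ + 1, by positivity, by linarith [norm_nonneg b], fun s _ _ h => ?_⟩
  have h1 : 1 ≤ |s.im| := by linarith [norm_nonneg b]
  have h2 := norm_div_le b s h1
  have h3 : ‖b‖ / |s.im| ≤ 1 / 2 := by
    rw [div_le_iff₀ (by linarith)]; linarith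
  have h4 : 1 / 2 ≤ ‖1 + b / s‖ := by
    have := norm_sub_le (1 + b / s) (b / s)
    rw [add_sub_cancel_right, norm_one] at this
    linarith
  have h5 : 1 + b / s ≠ 0 := by
    intro h0; rw [h0, norm_zero] at h4; linarith
  rw [show (1 + b / s)⁻¹ - 1 = -(b / s) / (1 + b / s) by field_simp; ring, norm_div, norm_neg,
    div_le_iff₀ (by linarith)]
  rw [mul_div_assoc]
  nlinarith [norm_nonneg b, div_nonneg (norm_nonneg b) (abs_nonneg s.im)]

end VerticalNearOne

/-- The functional equation extracts a factor `s` or `-s` from every gamma function. With equally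
many upper and lower parameters and `m + n = p`, the powers `s^m` and `(-s)^n` cancel together with
their signs, so the remaining quotient tends to `+1`. This is what places the singularity at `r =
1`. -/
theorem meijerMellin_add_one {m n p : ℕ} {a b : Fin p → ℂ} (hmn : m + n = p) {s : ℂ}
    (hs : s ≠ 0) (ha : ∀ j, a j + s ≠ 0) (hb : ∀ j, b j + s ≠ 0) :
    meijerMellin m n a b (s + 1) = (((∏ j ∈ Finset.univ.filter (fun j : Fin p => (j : ℕ) < m), (1 + b j / s)) *
      ∏ j ∈ Finset.univ.filter (fun j : Fin p => (j : ℕ) < n), (1 + a j / s)⁻¹) *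
      ((∏ j ∈ Finset.univ.filter (fun j : Fin p => m ≤ (j : ℕ)), (1 + b j / s)) *
      ∏ j ∈ Finset.univ.filter (fun j : Fin p => n ≤ (j : ℕ)), (1 + a j / s)⁻¹)) *
        meijerMellin m n a b s := by
  have g1 : ∀ c : ℂ, c + s ≠ 0 → Complex.Gamma (c + (s + 1)) = s * (1 + c / s) * Complex.Gamma (c + s) := by
    intro c hc
    rw [← add_assoc, Complex.Gamma_add_one _ hc]
    congr 1; field_simp; ring
  have g2 : ∀ c : ℂ, c + s ≠ 0 → Complex.Gamma (1 - c - (s + 1)) =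
      (-s)⁻¹ * (1 + c / s)⁻¹ * Complex.Gamma (1 - c - s) := by
    intro c hc
    have hc' : -c - s ≠ 0 := by
      intro h; apply hc; linear_combination -h
    have hc2 : 1 + c / s ≠ 0 := by
      intro h; apply hc; field_simp at h; linear_combination h
    rw [show 1 - c - s = (-c - s) + 1 by ring, Complex.Gamma_add_one _ hc',
      show 1 - c - (s + 1) = -c - s by ring, ← mul_inv, ← mul_assoc,
      show -s * (1 + c / s) = -c - s by field_simp; ring, inv_mul_cancel₀ hc', one_mul]
  have hm : m ≤ p := by omega
  have hn : n ≤ p := by omega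
  have p1 : ∏ j ∈ Finset.univ.filter (fun j : Fin p => (j : ℕ) < m), Complex.Gamma (b j + (s + 1))
      = s ^ m * ((∏ j ∈ Finset.univ.filter (fun j : Fin p => (j : ℕ) < m), (1 + b j / s)) *
        ∏ j ∈ Finset.univ.filter (fun j : Fin p => (j : ℕ) < m), Complex.Gamma (b j + s)) := by
    rw [Finset.prod_congr rfl (fun j _ => g1 _ (hb j)), Finset.prod_mul_distrib,
      Finset.prod_mul_distrib, Finset.prod_const, Fin.card_filter_val_lt' hm]; ring
  have p2 : ∏ j ∈ Finset.univ.filter (fun j : Fin p => (j : ℕ) < n), Complex.Gamma (1 - a j - (s + 1))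
      = ((-s) ^ n)⁻¹ * ((∏ j ∈ Finset.univ.filter (fun j : Fin p => (j : ℕ) < n), (1 + a j / s)⁻¹) *
        ∏ j ∈ Finset.univ.filter (fun j : Fin p => (j : ℕ) < n), Complex.Gamma (1 - a j - s)) := by
    rw [Finset.prod_congr rfl (fun j _ => g2 _ (ha j)), Finset.prod_mul_distrib,
      Finset.prod_mul_distrib, Finset.prod_const, Fin.card_filter_val_lt' hn, inv_pow]; ring
  have p3 : ∏ j ∈ Finset.univ.filter (fun j : Fin p => m ≤ (j : ℕ)), Complex.Gamma (1 - b j - (s + 1))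
      = ((-s) ^ n)⁻¹ * ((∏ j ∈ Finset.univ.filter (fun j : Fin p => m ≤ (j : ℕ)), (1 + b j / s))⁻¹ *
        ∏ j ∈ Finset.univ.filter (fun j : Fin p => m ≤ (j : ℕ)), Complex.Gamma (1 - b j - s)) := by
    rw [Finset.prod_congr rfl (fun j _ => g2 _ (hb j)), Finset.prod_mul_distrib,
      Finset.prod_mul_distrib, Finset.prod_const, Fin.card_filter_le_val, inv_pow,
      Finset.prod_inv_distrib, show p - m = n by omega]; ring
  have p4 : ∏ j ∈ Finset.univ.filter (fun j : Fin p => n ≤ (j : ℕ)), Complex.Gamma (a j + (s + 1))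
      = s ^ m * ((∏ j ∈ Finset.univ.filter (fun j : Fin p => n ≤ (j : ℕ)), (1 + a j / s)) *
        ∏ j ∈ Finset.univ.filter (fun j : Fin p => n ≤ (j : ℕ)), Complex.Gamma (a j + s)) := by
    rw [Finset.prod_congr rfl (fun j _ => g1 _ (ha j)), Finset.prod_mul_distrib,
      Finset.prod_mul_distrib, Finset.prod_const, Fin.card_filter_le_val,
      show p - n = m by omega]; ring
  unfold meijerMellin
  rw [p1, p2, p3, p4, Finset.prod_inv_distrib (f := fun j => 1 + a j / s) (s := Finset.univ.filter (fun j : Fin p => n ≤ (j : ℕ)))]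
  simp only [div_eq_mul_inv, mul_inv, inv_inv]
  have e1 : s ^ m * (s ^ m)⁻¹ = 1 := mul_inv_cancel₀ (pow_ne_zero _ hs)
  have e2 : (-s) ^ n * ((-s) ^ n)⁻¹ = 1 := mul_inv_cancel₀ (pow_ne_zero _ (neg_ne_zero.2 hs))
  generalize s ^ m = x at e1 ⊢
  generalize (-s) ^ n = y at e2 ⊢
  generalize ∏ j ∈ Finset.univ.filter (fun j : Fin p => (j : ℕ) < m), (1 + b j * s⁻¹) = P₁
  generalize ∏ j ∈ Finset.univ.filter (fun j : Fin p => (j : ℕ) < n), (1 + a j * s⁻¹)⁻¹ = P₂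
  generalize ∏ j ∈ Finset.univ.filter (fun j : Fin p => m ≤ (j : ℕ)), (1 + b j * s⁻¹) = P₃
  generalize (∏ j ∈ Finset.univ.filter (fun j : Fin p => n ≤ (j : ℕ)), (1 + a j * s⁻¹))⁻¹ = P₄
  generalize ∏ j ∈ Finset.univ.filter (fun j : Fin p => (j : ℕ) < m), Complex.Gamma (b j + s) = Q₁
  generalize ∏ j ∈ Finset.univ.filter (fun j : Fin p => (j : ℕ) < n), Complex.Gamma (1 - a j - s) = Q₂
  generalize (∏ j ∈ Finset.univ.filter (fun j : Fin p => m ≤ (j : ℕ)), Complex.Gamma (1 - b j - s))⁻¹ = Q₃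
  generalize (∏ j ∈ Finset.univ.filter (fun j : Fin p => n ≤ (j : ℕ)), Complex.Gamma (a j + s))⁻¹ = Q₄
  linear_combination (P₁ * P₂ * (P₃ * P₄) * (Q₁ * Q₂ * (Q₃ * Q₄)) * (y * y⁻¹)) * e1
    + (P₁ * P₂ * (P₃ * P₄) * (Q₁ * Q₂ * (Q₃ * Q₄))) * e2

/-- The difference equals `𝒢(s)` times one minus a finite product of factors `1 + O(1/|Im s|)`,
hence gains one power of `|Im s|` over `𝒢` itself. -/
theorem verticalBound_meijerMellin_sub {m n p : ℕ} {a b : Fin p → ℂ} (hmn : m + n = p)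
    (c₁ c₂ : ℝ) : VerticalBound c₁ c₂ (fun _ => -(meijerNu a b + 1)) 0
      (fun s => meijerMellin m n a b s - meijerMellin m n a b (s + 1)) := by
  obtain ⟨C, T, hC, hT, h⟩ := ((VerticalNearOne.prod (Finset.univ.filter (fun j : Fin p => (j : ℕ) < m))
      (fun j _ => VerticalNearOne.one_add_div c₁ c₂ (b j))).mul
    (VerticalNearOne.prod (Finset.univ.filter (fun j : Fin p => (j : ℕ) < n))
      (fun j _ => VerticalNearOne.one_add_div_inv c₁ c₂ (a j)))).mul
    ((VerticalNearOne.prod (Finset.univ.filter (fun j : Fin p => m ≤ (j : ℕ)))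
      (fun j _ => VerticalNearOne.one_add_div c₁ c₂ (b j))).mul
    (VerticalNearOne.prod (Finset.univ.filter (fun j : Fin p => n ≤ (j : ℕ)))
      (fun j _ => VerticalNearOne.one_add_div_inv c₁ c₂ (a j))))
  obtain ⟨C', T', hC', hT', h'⟩ := verticalBound_meijerMellin (a := a) (b := b) (m := m) (n := n)
    (by omega) (by omega) c₁ c₂
  -- Adding all norms of parameters to the threshold ensures that no `a j + s` or `b j + s`
  -- vanishes.
  refine ⟨C * C', T + T' + ∑ j, ‖a j‖ + ∑ j, ‖b j‖, by positivity, ?_, fun s h1 h2 h3 => ?_⟩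
  · have := Finset.sum_nonneg (fun (j : Fin p) (_ : j ∈ Finset.univ) => norm_nonneg (a j))
    have := Finset.sum_nonneg (fun (j : Fin p) (_ : j ∈ Finset.univ) => norm_nonneg (b j))
    linarith
  have sa := Finset.sum_nonneg (fun (j : Fin p) (_ : j ∈ Finset.univ) => norm_nonneg (a j))
  have sb := Finset.sum_nonneg (fun (j : Fin p) (_ : j ∈ Finset.univ) => norm_nonneg (b j))
  have ht0 : 0 < |s.im| := by linarith
  have key : ∀ c : ℂ, ‖c‖ < |s.im| → c + s ≠ 0 := by
    intro c hc h0
    have : s = -c := by linear_combination h0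
    have h4 := Complex.abs_im_le_norm c
    rw [this, Complex.neg_im, abs_neg] at hc
    linarith
  have hs : s ≠ 0 := by
    rintro rfl; simp at ht0
  have ha : ∀ j, a j + s ≠ 0 := fun j => key _ (by
    have := Finset.single_le_sum (fun (j : Fin p) (_ : j ∈ Finset.univ) => norm_nonneg (a j)) (Finset.mem_univ j)
    linarith)
  have hb : ∀ j, b j + s ≠ 0 := fun j => key _ (by
    have := Finset.single_le_sum (fun (j : Fin p) (_ : j ∈ Finset.univ) => norm_nonneg (b j)) (Finset.mem_univ j)
    linarith)
  have k1 := h s h1 h2 (by linarith)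
  have k2 := h' s h1 h2 (by linarith)
  simp only [meijerMellin_add_one hmn hs ha hb]
  have hk : (2 * (m : ℝ) + 2 * n - p - p) = 0 := by
    have : (m : ℝ) + n = p := by exact_mod_cast hmn
    linarith
  rw [hk] at k2
  simp only [sub_self, zero_mul, add_zero, neg_zero, Real.exp_zero, mul_one] at k2 ⊢
  rw [← one_sub_mul, norm_mul, norm_sub_rev]
  calc _ ≤ _ := mul_le_mul k1 k2 (norm_nonneg _) (by positivity)
    _ = _ := by
      rw [neg_add, Real.rpow_add ht0, Real.rpow_neg_one]; ring

/-! ### Residues and shifting vertical lines -/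

/-- Subtracting the leading term `h(z)(s-z)^(-n-1)` leaves `(h(s) - h(z))/(s-z)` over `(s-z)^n`;
`dslope` extends this numerator analytically, so the pole order drops by one. -/
theorem exists_principalPart_aux (z : ℂ) (n : ℕ) : ∀ (F h : ℂ → ℂ), AnalyticAt ℂ h z →
    (∀ᶠ s in 𝓝[≠] z, F s * (s - z) ^ n = h s) →
    ∃ (g : ℂ → ℂ) (c : ℕ → ℂ), AnalyticAt ℂ g z ∧
      ∀ᶠ s in 𝓝[≠] z, F s = g s + ∑ k ∈ Finset.range n, c k * ((s - z)⁻¹) ^ (k + 1) := by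
  induction n with
  | zero => exact fun F h hh hF => ⟨h, 0, hh, by simpa using hF⟩
  | succ n ih =>
    intro F h hh hF
    obtain ⟨g, c, hg, hgc⟩ := ih (fun s => F s - h z * ((s - z)⁻¹) ^ (n + 1)) (dslope h z)
      (by
        have := hh.hasFPowerSeriesAt
        exact this.has_fpower_series_dslope_fslope.analyticAt)
      (by
        filter_upwards [hF, self_mem_nhdsWithin] with s hs hsz
        have hsz' : s - z ≠ 0 := sub_ne_zero.2 hsz
        have e1 : ((s - z)⁻¹) ^ (n + 1) * (s - z) ^ (n + 1) = 1 := by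
          rw [← mul_pow, inv_mul_cancel₀ hsz', one_pow]
        rw [dslope_of_ne _ hsz, slope_def_field, ← hs, eq_div_iff hsz']
        linear_combination (-h z) * e1)
    refine ⟨g, fun k => if k = n then h z else c k, hg, ?_⟩
    filter_upwards [hgc] with s hs
    rw [Finset.sum_range_succ, if_pos rfl, Finset.sum_congr rfl (g := fun k => c k * ((s - z)⁻¹) ^ (k + 1))]
    · rw [← add_assoc, ← hs]; ring
    · intro k hk
      rw [if_neg (Finset.mem_range.1 hk).ne]

theorem MeromorphicAt.exists_principalPart {F : ℂ → ℂ} {z : ℂ} (hF : MeromorphicAt F z) :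
    ∃ (n : ℕ) (g : ℂ → ℂ) (c : ℕ → ℂ), AnalyticAt ℂ g z ∧
      ∀ᶠ s in 𝓝[≠] z, F s = g s + ∑ k ∈ Finset.range (n + 1), c k * ((s - z)⁻¹) ^ (k + 1) := by
  obtain ⟨n, hn⟩ := hF
  -- The superfluous factor `s - z` makes the list of coefficients nonempty, so that the residue is
  -- `c 0` even at a removable singularity.
  have h1 : AnalyticAt ℂ (fun s => (s - z) * ((s - z) ^ n • F s)) z :=
    (by fun_prop : AnalyticAt ℂ (fun s => s - z) z).mul hn
  obtain ⟨g, c, hg, hc⟩ := exists_principalPart_aux z (n + 1) F _ h1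
    (Eventually.of_forall fun s => by simp only [smul_eq_mul]; ring)
  exact ⟨n, g, c, hg, hc⟩

theorem circleIntegral_inv_pow_succ {z : ℂ} {ρ : ℝ} (hρ : ρ ≠ 0) (k : ℕ) :
    ∮ w in C(z, ρ), ((w - z)⁻¹) ^ (k + 1) = if k = 0 then 2 * Real.pi * Complex.I else 0 := by
  split_ifs with hk
  · subst hk
    simpa using circleIntegral.integral_sub_center_inv z hρ
  · have h := circleIntegral.integral_sub_zpow_of_ne (n := -((k + 1 : ℕ) : ℤ)) (by omega) z z ρ
    simp only [zpow_neg, zpow_natCast] at h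
    simp only [inv_pow]
    exact h

theorem residueAt_eq_of_principalPart {F g : ℂ → ℂ} {z : ℂ} {n : ℕ} {c : ℕ → ℂ}
    (hg : AnalyticAt ℂ g z)
    (hF : ∀ᶠ s in 𝓝[≠] z, F s = g s + ∑ k ∈ Finset.range (n + 1), c k * ((s - z)⁻¹) ^ (k + 1)) :
    residueAt F z = c 0 := by
  refine Tendsto.limUnder_eq ?_
  refine tendsto_const_nhds.congr' ?_
  rw [eventually_nhdsWithin_iff, Metric.eventually_nhds_iff] at hF
  obtain ⟨ε, hε, hF⟩ := hF
  obtain ⟨δ, hδ, hgδ⟩ := Metric.eventually_nhds_iff.1 hg.eventually_analyticAt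
  have hmem : Set.Ioo (0 : ℝ) (min ε δ) ∈ 𝓝[>] (0 : ℝ) := Ioo_mem_nhdsGT (lt_min hε hδ)
  filter_upwards [hmem] with ρ hρ
  obtain ⟨hρ0, hρ1⟩ := hρ
  have hne : ∀ w ∈ Metric.sphere z ρ, w ≠ z := by
    rintro w hw rfl
    simp at hw; linarith
  have h1 : ∮ w in C(z, ρ), F w
      = ∮ w in C(z, ρ), (g w + ∑ k ∈ Finset.range (n + 1), c k * ((w - z)⁻¹) ^ (k + 1)) := by
    refine circleIntegral.integral_congr hρ0.le fun w hw => ?_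
    refine hF ?_ (hne w hw)
    rw [Metric.mem_sphere.1 hw]; exact hρ1.trans_le (min_le_left _ _)
  have hgd : ∀ w ∈ Metric.closedBall z ρ, DifferentiableAt ℂ g w := fun w hw =>
    (hgδ ((Metric.mem_closedBall.1 hw).trans_lt (hρ1.trans_le (min_le_right _ _)))).differentiableAt
  have hgi : CircleIntegrable g z ρ := ContinuousOn.circleIntegrable hρ0.le fun w hw =>
    (hgd w (Metric.sphere_subset_closedBall hw)).continuousAt.continuousWithinAt
  have hpi : ∀ k, CircleIntegrable (fun w => c k * ((w - z)⁻¹) ^ (k + 1)) z ρ := by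
    intro k
    refine ContinuousOn.circleIntegrable hρ0.le fun w hw => ?_
    have : w - z ≠ 0 := sub_ne_zero.2 (hne w hw)
    exact ContinuousAt.continuousWithinAt (by fun_prop (disch := assumption))
  have h2 : ∮ w in C(z, ρ), g w = 0 :=
    Complex.circleIntegral_eq_zero_of_differentiable_on_off_countable hρ0.le Set.countable_empty
      (fun w hw => (hgd w hw).continuousAt.continuousWithinAt)
      (fun w hw => hgd w (Metric.ball_subset_closedBall hw.1))
  rw [h1, circleIntegral.integral_add hgi (CircleIntegrable.fun_sum _ fun k _ => hpi k), h2, zero_add,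
    circleIntegral.integral_fun_sum fun k _ => hpi k]
  simp only [circleIntegral.integral_const_mul, circleIntegral_inv_pow_succ hρ0.ne']
  rw [Finset.sum_eq_single 0]
  · rw [if_pos rfl]
    field_simp [Complex.two_pi_I_ne_zero]
  · intro k _ hk; simp [hk]
  · simp

/-- Deformation across the annulus makes the radius free. A residue thereby becomes an integral over
one fixed circle, independent of the function as long as the punctured disc stays free of
singularities, which is the form to which Fubini applies. -/
theorem residueAt_eq_circleIntegral {F : ℂ → ℂ} {z : ℂ} {ρ : ℝ} (hρ : 0 < ρ)
    (hF : ∀ w ∈ Metric.closedBall z ρ, w ≠ z → DifferentiableAt ℂ F w) :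
    residueAt F z = (2 * Real.pi * Complex.I)⁻¹ * ∮ w in C(z, ρ), F w := by
  refine Tendsto.limUnder_eq (tendsto_const_nhds.congr' ?_)
  have hmem : Set.Ioo (0 : ℝ) ρ ∈ 𝓝[>] (0 : ℝ) := Ioo_mem_nhdsGT hρ
  filter_upwards [hmem] with r hr
  congr 1
  have hd : ∀ w ∈ Metric.closedBall z ρ \ Metric.ball z r, DifferentiableAt ℂ F w := by
    intro w hw
    refine hF w hw.1 ?_
    rintro rfl
    exact hw.2 (Metric.mem_ball_self hr.1)
  refine Complex.circleIntegral_eq_of_differentiable_on_annulus_off_countable hr.1 hr.2.le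
    Set.countable_empty (fun w hw => (hd w hw).continuousAt.continuousWithinAt) (fun w hw => hd w ?_)
  exact ⟨Metric.ball_subset_closedBall hw.1.1, fun h => hw.1.2 (Metric.ball_subset_closedBall h)⟩

/-- `|Im s| → ∞` inside the strip `c₁ ≤ Re s ≤ c₂`. -/
def stripFilter (c₁ c₂ : ℝ) : Filter ℂ :=
  comap (fun s : ℂ => |s.im|) atTop ⊓ 𝓟 {s | c₁ ≤ s.re ∧ s.re ≤ c₂}

theorem tendsto_inv_sub_stripFilter (c₁ c₂ : ℝ) (z : ℂ) :
    Tendsto (fun s : ℂ => (s - z)⁻¹) (stripFilter c₁ c₂) (𝓝 0) := by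
  refine tendsto_inv₀_cobounded.comp ?_
  rw [← tendsto_norm_atTop_iff_cobounded]
  refine Tendsto.mono_left ?_ inf_le_left
  refine tendsto_atTop_mono (f := fun s : ℂ => |s.im| - |z.im|) (fun s => ?_)
    (tendsto_atTop_add_const_right _ _ tendsto_comap)
  calc |s.im| - |z.im| ≤ |(s - z).im| := by simpa using abs_sub_abs_le_abs_sub s.im z.im
    _ ≤ _ := Complex.abs_im_le_norm _

theorem tendsto_stripFilter_zero_iff {c₁ c₂ : ℝ} {F : ℂ → ℂ} :
    Tendsto F (stripFilter c₁ c₂) (𝓝 0) ↔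
      ∀ ε > 0, ∃ T : ℝ, ∀ s : ℂ, c₁ ≤ s.re → s.re ≤ c₂ → T ≤ |s.im| → ‖F s‖ < ε := by
  rw [stripFilter, ((atTop_basis.comap _).inf_principal _).tendsto_iff Metric.nhds_basis_ball]
  simp only [Metric.mem_ball, dist_zero_right, true_and]
  refine forall₂_congr fun ε _ => exists_congr fun T => ?_
  constructor
  · intro h s h1 h2 h3; exact h s ⟨h3, h1, h2⟩
  · intro h s hs; exact h s hs.2.1 hs.2.2 hs.1

theorem tendsto_integral_line_sub_of_differentiable {H : ℂ → ℂ} {c₁ c₂ : ℝ} (hc : c₁ < c₂)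
    (hd : ∀ s : ℂ, c₁ ≤ s.re → s.re ≤ c₂ → DifferentiableAt ℂ H s)
    (h0 : Tendsto H (stripFilter c₁ c₂) (𝓝 0)) :
    Tendsto (fun T : ℝ => (∫ t in (-T)..T, H (c₂ + t * Complex.I))
      - ∫ t in (-T)..T, H (c₁ + t * Complex.I)) atTop (𝓝 0) := by
  rw [tendsto_stripFilter_zero_iff] at h0
  rw [Metric.tendsto_atTop]
  intro ε hε
  obtain ⟨T₀, hT₀⟩ := h0 (ε / (4 * (c₂ - c₁))) (div_pos hε (by linarith))
  refine ⟨max T₀ 0, fun T hT => ?_⟩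
  have hTT₀ : T₀ ≤ T := (le_max_left _ _).trans hT
  have hT0 : 0 ≤ T := (le_max_right _ _).trans hT
  have key := Complex.integral_boundary_rect_eq_zero_of_differentiableOn H
    (c₁ + (-T : ℝ) * Complex.I) (c₂ + (T : ℝ) * Complex.I) (by
      intro s hs
      rw [Complex.mem_reProdIm] at hs
      have h1 := hs.1
      simp only [Complex.add_re, Complex.mul_re, Complex.ofReal_re, Complex.I_re, mul_zero,
        Complex.ofReal_im, Complex.I_im, mul_one, sub_zero, add_zero, Set.uIcc_of_le hc.le] at h1
      exact (hd s h1.1 h1.2).differentiableWithinAt)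
  simp only [Complex.add_re, Complex.mul_re, Complex.ofReal_re, Complex.I_re, mul_zero,
    Complex.ofReal_im, Complex.I_im, mul_one, sub_zero, add_zero, Complex.add_im, Complex.mul_im,
    zero_add] at key
  have hbd : ∀ y : ℝ, |y| = T →
      ‖∫ x in c₁..c₂, H (x + y * Complex.I)‖ ≤ ε / (4 * (c₂ - c₁)) * |c₂ - c₁| := by
    intro y hy
    refine intervalIntegral.norm_integral_le_of_norm_le_const fun x hx => ?_
    rw [Set.uIoc_of_le hc.le] at hx
    refine (hT₀ _ ?_ ?_ ?_).le
    · simpa using hx.1.le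
    · simpa using hx.2
    · simpa [hy] using hTT₀
  have h1 := hbd T (abs_of_nonneg hT0)
  have h2 := hbd (-T) (by rw [abs_neg, abs_of_nonneg hT0])
  have hcc : ε / (4 * (c₂ - c₁)) * |c₂ - c₁| = ε / 4 := by
    rw [abs_of_pos (by linarith)]
    field_simp [(sub_pos.2 hc).ne']
  rw [hcc] at h1 h2
  rw [dist_zero_right]
  have h3 : Complex.I * ((∫ t in (-T)..T, H (c₂ + t * Complex.I))
      - ∫ t in (-T)..T, H (c₁ + t * Complex.I))
      = (∫ x in c₁..c₂, H (x + T * Complex.I)) - ∫ x in c₁..c₂, H (x + (-T : ℝ) * Complex.I) := by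
    simp only [smul_eq_mul] at key
    linear_combination key
  have h4 := congrArg norm h3
  rw [norm_mul, Complex.norm_I, one_mul] at h4
  rw [h4]
  calc _ ≤ _ := norm_sub_le _ _
    _ < ε := by linarith

/-! ### Symmetric integrals of inverse powers along vertical lines. -/

theorem tendsto_div_atTop_add_mul_I (u y : ℝ) (e : ℝ) :
    Tendsto (fun T : ℝ => ((u : ℂ) + ((e * T - y : ℝ) : ℂ) * Complex.I) / T) atTop (𝓝 (e * Complex.I)) := by
  have h1 : Tendsto (fun T : ℝ => ((u : ℂ) - y * Complex.I) * ((T⁻¹ : ℝ) : ℂ) + e * Complex.I) atTop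
      (𝓝 (((u : ℂ) - y * Complex.I) * ((0 : ℝ) : ℂ) + e * Complex.I)) :=
    (((Complex.continuous_ofReal.tendsto 0).comp tendsto_inv_atTop_zero).const_mul _).add_const _
  simp only [Complex.ofReal_zero, mul_zero, zero_add] at h1
  refine h1.congr' ?_
  filter_upwards [eventually_gt_atTop 0] with T hT
  have : (T : ℂ) ≠ 0 := by exact_mod_cast hT.ne'
  push_cast
  field_simp
  ring

/-- For `u > 0` the path stays in the slit plane, so `-i log` is a primitive. After `log T` is
removed at both ends, the limit is `-i (log i - log(-i)) = π`. -/
theorem tendsto_integral_inv_line_of_pos {u : ℝ} (hu : 0 < u) (y : ℝ) :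
    Tendsto (fun T : ℝ => ∫ t in (-T)..T, ((u : ℂ) + ((t - y : ℝ) : ℂ) * Complex.I)⁻¹) atTop
      (𝓝 Real.pi) := by
  have hslit : ∀ t : ℝ, (u : ℂ) + ((t - y : ℝ) : ℂ) * Complex.I ∈ Complex.slitPlane := fun t => by
    left; simpa using hu
  have h1 : ∀ T : ℝ, ∫ t in (-T)..T, ((u : ℂ) + ((t - y : ℝ) : ℂ) * Complex.I)⁻¹
      = Complex.I⁻¹ * Complex.log ((u : ℂ) + ((T - y : ℝ) : ℂ) * Complex.I)
        - Complex.I⁻¹ * Complex.log ((u : ℂ) + ((-T - y : ℝ) : ℂ) * Complex.I) := by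
    intro T
    refine intervalIntegral.integral_eq_sub_of_hasDerivAt
      (f := fun t : ℝ => Complex.I⁻¹ * Complex.log ((u : ℂ) + ((t - y : ℝ) : ℂ) * Complex.I)) (fun t _ => ?_) ?_
    · have h2 : HasDerivAt (fun t : ℝ => (u : ℂ) + ((t - y : ℝ) : ℂ) * Complex.I) (1 * Complex.I) t := by
        simpa using (((hasDerivAt_id t).sub_const y).ofReal_comp.mul_const Complex.I).const_add (u : ℂ)
      have h4 := (HasDerivAt.clog_real h2 (hslit t)).const_mul Complex.I⁻¹
      refine h4.congr_deriv ?_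
      field_simp [Complex.slitPlane_ne_zero (hslit t)]
    · refine Continuous.intervalIntegrable ?_ _ _
      exact Continuous.inv₀ (by fun_prop) fun t => Complex.slitPlane_ne_zero (hslit t)
  have h2 : ∀ e : ℝ, (e : ℂ) * Complex.I ∈ Complex.slitPlane →
      Tendsto (fun T : ℝ => Complex.log ((u : ℂ) + ((e * T - y : ℝ) : ℂ) * Complex.I) - Real.log T) atTop
        (𝓝 (Complex.log (e * Complex.I))) := by
    intro e he
    refine ((continuousAt_clog he).tendsto.comp (tendsto_div_atTop_add_mul_I u y e)).congr' ?_
    filter_upwards [eventually_gt_atTop 0] with T hT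
    have hne : (u : ℂ) + ((e * T - y : ℝ) : ℂ) * Complex.I ≠ 0 := by
      intro h; have := congrArg Complex.re h; simp at this; linarith
    rw [Function.comp, div_eq_inv_mul, ← Complex.ofReal_inv, Complex.log_ofReal_mul (inv_pos.2 hT) hne,
      Real.log_inv]
    push_cast; ring
  have h3 := (((h2 1 (by simp [Complex.mem_slitPlane_iff])).sub
    (h2 (-1) (by simp [Complex.mem_slitPlane_iff]))).const_mul Complex.I⁻¹)
  have h4 : Complex.I⁻¹ * (Complex.log (((1 : ℝ) : ℂ) * Complex.I) - Complex.log (((-1 : ℝ) : ℂ) * Complex.I))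
      = Real.pi := by
    push_cast
    rw [one_mul, neg_one_mul, Complex.log_I, Complex.log_neg_I]
    field_simp
    ring
  rw [h4] at h3
  refine h3.congr fun T => ?_
  rw [h1]
  simp only [one_mul, neg_one_mul]
  ring

theorem tendsto_integral_inv_line {u : ℝ} (hu : u ≠ 0) (y : ℝ) :
    Tendsto (fun T : ℝ => ∫ t in (-T)..T, ((u : ℂ) + ((t - y : ℝ) : ℂ) * Complex.I)⁻¹) atTop
      (𝓝 (SignType.sign u * Real.pi)) := by
  rcases lt_or_gt_of_ne hu with h | h
  · rw [sign_neg h]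
    have h1 := (tendsto_integral_inv_line_of_pos (neg_pos.2 h) (-y)).neg
    simp only [SignType.coe_neg_one, neg_one_mul]
    refine h1.congr fun T => ?_
    have h2 := intervalIntegral.integral_comp_neg (a := -T) (b := T)
      (fun t : ℝ => ((u : ℂ) + ((t - y : ℝ) : ℂ) * Complex.I)⁻¹)
    rw [neg_neg] at h2
    rw [← h2, ← intervalIntegral.integral_neg]
    refine intervalIntegral.integral_congr fun t _ => ?_
    rw [← inv_neg]
    congr 1
    push_cast
    ring
  · rw [sign_pos h]
    simpa using tendsto_integral_inv_line_of_pos h y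

theorem tendsto_integral_inv_pow_line {u : ℝ} (hu : u ≠ 0) (y : ℝ) (k : ℕ) (hk : k ≠ 0) :
    Tendsto (fun T : ℝ => ∫ t in (-T)..T, (((u : ℂ) + ((t - y : ℝ) : ℂ) * Complex.I)⁻¹) ^ (k + 1)) atTop
      (𝓝 0) := by
  have hne : ∀ t : ℝ, (u : ℂ) + ((t - y : ℝ) : ℂ) * Complex.I ≠ 0 := fun t h => by
    have := congrArg Complex.re h; simp at this; exact hu this
  set f : ℝ → ℂ := fun t => (-Complex.I⁻¹ / k) * (((u : ℂ) + ((t - y : ℝ) : ℂ) * Complex.I)⁻¹) ^ k with hf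
  have h1 : ∀ T : ℝ, ∫ t in (-T)..T, (((u : ℂ) + ((t - y : ℝ) : ℂ) * Complex.I)⁻¹) ^ (k + 1)
      = f T - f (-T) := by
    intro T
    refine intervalIntegral.integral_eq_sub_of_hasDerivAt (f := f) (fun t _ => ?_) ?_
    · have h2 : HasDerivAt (fun t : ℝ => (u : ℂ) + ((t - y : ℝ) : ℂ) * Complex.I) (1 * Complex.I) t := by
        simpa using (((hasDerivAt_id t).sub_const y).ofReal_comp.mul_const Complex.I).const_add (u : ℂ)
      have h4 := ((HasDerivAt.fun_inv h2 (hne t)).fun_pow k).const_mul (-Complex.I⁻¹ / (k : ℂ))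
      refine h4.congr_deriv ?_
      obtain ⟨j, rfl⟩ := Nat.exists_eq_succ_of_ne_zero hk
      have hk' : ((j.succ : ℕ) : ℂ) ≠ 0 := by exact_mod_cast hk
      have hw := hne t
      simp only [Nat.succ_sub_one]
      generalize (u : ℂ) + ((t - y : ℝ) : ℂ) * Complex.I = w at hw ⊢
      rw [inv_pow, inv_pow, ← Nat.succ_eq_add_one]
      field_simp
      rw [Nat.succ_eq_add_one]
      ring
    · refine Continuous.intervalIntegrable ?_ _ _
      exact (Continuous.inv₀ (by fun_prop) hne).pow _
  have h2 : ∀ e : ℝ, |e| = 1 → Tendsto (fun T : ℝ => f (e * T)) atTop (𝓝 0) := by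
    intro e he
    have h3 : Tendsto (fun T : ℝ => ((u : ℂ) + ((e * T - y : ℝ) : ℂ) * Complex.I)) atTop
        (comap (fun s : ℂ => |s.im|) atTop ⊓ 𝓟 {s | u ≤ s.re ∧ s.re ≤ u}) := by
      refine tendsto_inf.2 ⟨tendsto_comap_iff.2 ?_, tendsto_principal.2 (Eventually.of_forall fun T => by simp)⟩
      refine tendsto_atTop_mono (f := fun T : ℝ => T - |y|) (fun T => ?_)
        (tendsto_atTop_add_const_right _ _ tendsto_id)
      simp only [Function.comp, Complex.add_im, Complex.ofReal_im, Complex.mul_im, Complex.ofReal_re,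
        Complex.I_im, mul_one, Complex.I_re, mul_zero, add_zero, zero_add]
      have h5 := abs_sub_abs_le_abs_sub (e * T) y
      rw [abs_mul, he, one_mul] at h5
      linarith [le_abs_self T]
    have h4 := (((tendsto_inv_sub_stripFilter u u 0).comp h3).pow k).const_mul (-Complex.I⁻¹ / (k : ℂ))
    simp only [zero_pow hk, mul_zero, Function.comp_def, sub_zero] at h4
    exact h4
  have h5 := (h2 1 (by simp)).sub (h2 (-1) (by simp))
  rw [sub_zero] at h5
  refine h5.congr fun T => ?_
  rw [h1]
  simp

theorem tendsto_integral_principal_line_sub {c₁ c₂ : ℝ} {z : ℂ} (h1 : c₁ < z.re) (h2 : z.re < c₂)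
    (k : ℕ) :
    Tendsto (fun T : ℝ => (∫ t in (-T)..T, (((c₂ : ℂ) + t * Complex.I - z)⁻¹) ^ (k + 1))
      - ∫ t in (-T)..T, (((c₁ : ℂ) + t * Complex.I - z)⁻¹) ^ (k + 1)) atTop
      (𝓝 (if k = 0 then 2 * Real.pi else 0)) := by
  have e : ∀ c t : ℝ, (c : ℂ) + t * Complex.I - z = ((c - z.re : ℝ) : ℂ) + ((t - z.im : ℝ) : ℂ) * Complex.I := by
    intro c t; apply Complex.ext <;> simp
  simp only [e]
  have n1 : c₁ - z.re < 0 := by linarith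
  have n2 : 0 < c₂ - z.re := by linarith
  split_ifs with hk
  · subst hk
    have := (tendsto_integral_inv_line n2.ne' z.im).sub (tendsto_integral_inv_line n1.ne z.im)
    rw [sign_pos n2, sign_neg n1] at this
    simp only [zero_add, pow_one]
    convert! this using 2
    simp; ring
  · simpa using (tendsto_integral_inv_pow_line n2.ne' z.im k hk).sub
      (tendsto_integral_inv_pow_line n1.ne z.im k hk)

/-- Residue theorem for an infinite strip. Subtracting the principal parts leaves a function `H`
holomorphic on the strip, to which Cauchy's theorem on rectangles applies. The principal parts are
integrated explicitly, and only the simple-pole terms contribute, `2π` each. -/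
theorem tendsto_integral_line_sub {F : ℂ → ℂ} {c₁ c₂ : ℝ} (hc : c₁ < c₂) (S : Finset ℂ)
    (hS : ∀ z ∈ S, c₁ < z.re ∧ z.re < c₂)
    (hd : ∀ s : ℂ, c₁ ≤ s.re → s.re ≤ c₂ → s ∉ S → DifferentiableAt ℂ F s)
    (hm : ∀ z ∈ S, MeromorphicAt F z)
    (h0 : Tendsto F (stripFilter c₁ c₂) (𝓝 0)) :
    Tendsto (fun T : ℝ => (2 * Real.pi : ℂ)⁻¹ * (∫ t in (-T)..T, F (c₂ + t * Complex.I))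
      - (2 * Real.pi : ℂ)⁻¹ * ∫ t in (-T)..T, F (c₁ + t * Complex.I)) atTop
      (𝓝 (∑ z ∈ S, residueAt F z)) := by
  classical
  have hpp : ∀ z : ℂ, ∃ (n : ℕ) (g : ℂ → ℂ) (c : ℕ → ℂ), z ∈ S → AnalyticAt ℂ g z ∧
      ∀ᶠ s in 𝓝[≠] z, F s = g s + ∑ k ∈ Finset.range (n + 1), c k * ((s - z)⁻¹) ^ (k + 1) := by
    intro z
    by_cases hz : z ∈ S
    · obtain ⟨n, g, c, h⟩ := (hm z hz).exists_principalPart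
      exact ⟨n, g, c, fun _ => h⟩
    · exact ⟨0, 0, 0, fun h => absurd h hz⟩
  choose n g c hgc using hpp
  set P : ℂ → ℂ → ℂ := fun z s => ∑ k ∈ Finset.range (n z + 1), c z k * ((s - z)⁻¹) ^ (k + 1) with hP
  have hPd : ∀ z s, s ≠ z → DifferentiableAt ℂ (P z) s := by
    intro z s hs
    have : s - z ≠ 0 := sub_ne_zero.2 hs
    simp only [hP]
    fun_prop (disch := assumption)
  -- At a pole `s` the removable singularity is filled in: `g s` is the regular part there, and only
  -- the principal parts of the other poles are subtracted.
  set H : ℂ → ℂ := fun s => if s ∈ S then g s s - ∑ z ∈ S.erase s, P z s else F s - ∑ z ∈ S, P z s with hH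
  have hHd : ∀ s : ℂ, c₁ ≤ s.re → s.re ≤ c₂ → DifferentiableAt ℂ H s := by
    intro s h1 h2
    by_cases hs : s ∈ S
    · have h3 : DifferentiableAt ℂ (fun w => g s w - ∑ z ∈ S.erase s, P z w) s := by
        refine (hgc s hs).1.differentiableAt.sub (DifferentiableAt.fun_sum fun z hz => hPd z s ?_)
        exact (Finset.ne_of_mem_erase hz).symm
      refine h3.congr_of_eventuallyEq ?_
      have h4 := (hgc s hs).2
      have h5 : ∀ᶠ w in 𝓝[≠] s, w ∉ S := by
        have : IsClosed ((S.erase s : Finset ℂ) : Set ℂ) := (Finset.finite_toSet _).isClosed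
        have h6 : ∀ᶠ w in 𝓝 s, w ∈ ((S.erase s : Finset ℂ) : Set ℂ)ᶜ :=
          this.isOpen_compl.mem_nhds (by simp)
        filter_upwards [h6.filter_mono nhdsWithin_le_nhds, self_mem_nhdsWithin] with w hw hws hwS
        exact hw (Finset.mem_coe.2 (Finset.mem_erase.2 ⟨hws, hwS⟩))
      have h7 : ∀ᶠ w in 𝓝[≠] s, H w = g s w - ∑ z ∈ S.erase s, P z w := by
        filter_upwards [h4, h5] with w hw hwS
        simp only [hH, if_neg hwS]
        rw [hw, ← Finset.add_sum_erase S _ hs]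
        simp only [hP]; ring
      rw [eventually_nhdsWithin_iff] at h7
      filter_upwards [h7] with w hw
      by_cases hws : w = s
      · subst hws; simp only [hH, if_pos hs]
      · exact hw hws
    · have h3 : DifferentiableAt ℂ (fun w => F w - ∑ z ∈ S, P z w) s := by
        refine (hd s h1 h2 hs).sub (DifferentiableAt.fun_sum fun z hz => hPd z s ?_)
        rintro rfl; exact hs hz
      refine h3.congr_of_eventuallyEq ?_
      filter_upwards [(Finset.finite_toSet S).isClosed.isOpen_compl.mem_nhds hs] with w hw
      exact if_neg hw
  have hoff : ∀ s : ℂ, s ∉ S → H s = F s - ∑ z ∈ S, P z s := fun s hs => if_neg hs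
  have hPt : ∀ z, Tendsto (P z) (stripFilter c₁ c₂) (𝓝 0) := by
    intro z
    have : Tendsto (P z) (stripFilter c₁ c₂)
        (𝓝 (∑ k ∈ Finset.range (n z + 1), c z k * (0 : ℂ) ^ (k + 1))) :=
      tendsto_finsetSum _ fun k _ => ((tendsto_inv_sub_stripFilter c₁ c₂ z).pow _).const_mul _
    simpa using this
  have hHt : Tendsto H (stripFilter c₁ c₂) (𝓝 0) := by
    have h1 : Tendsto (fun s => F s - ∑ z ∈ S, P z s) (stripFilter c₁ c₂) (𝓝 (0 - ∑ z ∈ S, 0)) :=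
      h0.sub (tendsto_finsetSum _ fun z _ => hPt z)
    simp only [Finset.sum_const_zero, sub_zero] at h1
    rw [tendsto_stripFilter_zero_iff] at h1 ⊢
    intro ε hε
    obtain ⟨T, hT⟩ := h1 ε hε
    refine ⟨max T (1 + ∑ z ∈ S, |z.im|), fun s h2 h3 h4 => ?_⟩
    rw [hoff]
    · exact hT s h2 h3 ((le_max_left _ _).trans h4)
    · intro hs
      have := Finset.single_le_sum (f := fun z : ℂ => |z.im|) (fun z _ => abs_nonneg _) hs
      have h5 := (le_max_right _ _).trans h4
      linarith
  have hline : ∀ c' : ℝ, (c' = c₁ ∨ c' = c₂) → ∀ T : ℝ, ∫ t in (-T)..T, F (c' + t * Complex.I)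
      = (∫ t in (-T)..T, H (c' + t * Complex.I)) + ∑ z ∈ S, ∑ k ∈ Finset.range (n z + 1),
          c z k * ∫ t in (-T)..T, (((c' : ℂ) + t * Complex.I - z)⁻¹) ^ (k + 1) := by
    intro c' hc' T
    have hcS : ∀ t : ℝ, ∀ z ∈ S, (c' : ℂ) + t * Complex.I - z ≠ 0 := by
      intro t z hz h
      have := congrArg Complex.re h
      simp at this
      have := hS z hz
      rcases hc' with rfl | rfl <;> linarith
    have hcont : Continuous fun t : ℝ => H (c' + t * Complex.I) := by
      refine continuous_iff_continuousAt.2 fun t => ?_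
      have : ContinuousAt H (c' + t * Complex.I) := (hHd _ (by rcases hc' with rfl | rfl <;> simp [hc.le])
        (by rcases hc' with rfl | rfl <;> simp [hc.le])).continuousAt
      exact ContinuousAt.comp (f := fun t : ℝ => (c' : ℂ) + t * Complex.I) this (by fun_prop)
    have hpc : ∀ z ∈ S, ∀ k : ℕ, Continuous fun t : ℝ => (((c' : ℂ) + t * Complex.I - z)⁻¹) ^ (k + 1) :=
      fun z hz k => (Continuous.inv₀ (by fun_prop) fun t => hcS t z hz).pow _
    simp only [← intervalIntegral.integral_const_mul]
    rw [Finset.sum_congr rfl fun z hz => (intervalIntegral.integral_finsetSum fun k _ =>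
      ((hpc z hz k).const_mul (c z k)).intervalIntegrable _ _).symm,
      ← intervalIntegral.integral_finsetSum, ← intervalIntegral.integral_add]
    · refine intervalIntegral.integral_congr fun t _ => ?_
      rw [hoff]
      · simp only [hP]; ring
      · intro h; exact hcS t _ h (sub_self _)
    · exact hcont.intervalIntegrable _ _
    · exact (continuous_finsetSum _ fun z hz => continuous_finsetSum _ fun k _ =>
        (hpc z hz k).const_mul (c z k)).intervalIntegrable _ _
    · exact fun z hz => (continuous_finsetSum _ fun k _ =>
        (hpc z hz k).const_mul (c z k)).intervalIntegrable _ _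
  have hlim := ((tendsto_integral_line_sub_of_differentiable hc hHd hHt).add
    (tendsto_finsetSum S fun z hz => tendsto_finsetSum (Finset.range (n z + 1)) fun k _ =>
      (tendsto_integral_principal_line_sub (hS z hz).1 (hS z hz).2 k).const_mul (c z k))).const_mul
      (2 * Real.pi : ℂ)⁻¹
  have hval : (2 * Real.pi : ℂ)⁻¹ * (0 + ∑ z ∈ S, ∑ k ∈ Finset.range (n z + 1),
      c z k * (if k = 0 then (2 * Real.pi : ℂ) else 0)) = ∑ z ∈ S, residueAt F z := by
    have hpi : (2 * Real.pi : ℂ) ≠ 0 := by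
      simp [Real.pi_ne_zero]
    rw [zero_add, Finset.mul_sum]
    refine Finset.sum_congr rfl fun z hz => ?_
    rw [residueAt_eq_of_principalPart (hgc z hz).1 (hgc z hz).2, Finset.sum_eq_single 0]
    · rw [if_pos rfl]; field_simp
    · intro k _ hk; simp [hk]
    · simp
  rw [hval] at hlim
  refine hlim.congr fun T => ?_
  rw [hline c₁ (Or.inl rfl), hline c₂ (Or.inr rfl)]
  simp only [mul_sub, Finset.sum_sub_distrib]
  ring

/-! ### Poles of the Mellin transform -/

/-- The denominators enter through `1/Γ`, which is entire; the convention that `Γ` and inverses take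
the value 0 at poles gives its correct zeros. Only numerator factors produce poles. -/
theorem differentiableAt_meijerMellin {m n p q : ℕ} {a : Fin p → ℂ} {b : Fin q → ℂ} {s : ℂ}
    (hl : s ∉ lowerPoles m b) (hu : s ∉ upperPoles n a) :
    DifferentiableAt ℂ (meijerMellin m n a b) s := by
  have e : meijerMellin m n a b = fun s =>
      ((∏ j ∈ Finset.univ.filter (fun j : Fin q => (j : ℕ) < m), Complex.Gamma (b j + s)) *
      ∏ j ∈ Finset.univ.filter (fun j : Fin p => (j : ℕ) < n), Complex.Gamma (1 - a j - s)) *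
      ((∏ j ∈ Finset.univ.filter (fun j : Fin q => m ≤ (j : ℕ)), (Complex.Gamma (1 - b j - s))⁻¹) *
      ∏ j ∈ Finset.univ.filter (fun j : Fin p => n ≤ (j : ℕ)), (Complex.Gamma (a j + s))⁻¹) := by
    funext s
    simp only [meijerMellin, div_eq_mul_inv, mul_inv, Finset.prod_inv_distrib]
  rw [e]
  refine DifferentiableAt.mul (DifferentiableAt.mul ?_ ?_) (DifferentiableAt.mul ?_ ?_)
  · refine DifferentiableAt.fun_finsetProd fun j hj => ?_
    refine DifferentiableAt.comp s (g := Complex.Gamma) (f := fun s => b j + s)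
      (Complex.differentiableAt_Gamma _ fun k hk => hl ?_) (by fun_prop)
    exact ⟨j, (Finset.mem_filter.1 hj).2, k, by linear_combination hk⟩
  · refine DifferentiableAt.fun_finsetProd fun j hj => ?_
    refine DifferentiableAt.comp s (g := Complex.Gamma) (f := fun s => 1 - a j - s)
      (Complex.differentiableAt_Gamma _ fun k hk => hu ?_) (by fun_prop)
    exact ⟨j, (Finset.mem_filter.1 hj).2, k, by linear_combination -hk⟩
  · refine DifferentiableAt.fun_finsetProd fun j hj => ?_
    exact DifferentiableAt.comp s (f := fun s => 1 - b j - s)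
      (Complex.differentiable_one_div_Gamma _) (by fun_prop)
  · refine DifferentiableAt.fun_finsetProd fun j hj => ?_
    exact DifferentiableAt.comp s (f := fun s => a j + s)
      (Complex.differentiable_one_div_Gamma _) (by fun_prop)

theorem meromorphicAt_meijerMellin {m n p q : ℕ} (a : Fin p → ℂ) (b : Fin q → ℂ) (s : ℂ) :
    MeromorphicAt (meijerMellin m n a b) s := by
  have h1 : ∀ c : ℂ, MeromorphicAt (fun s => Complex.Gamma (c + s)) s := fun c => by
    refine MeromorphicAt.inv_iff.1 ?_
    exact (Differentiable.analyticAt (f := fun s => (Complex.Gamma (c + s))⁻¹)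
      (Complex.differentiable_one_div_Gamma.comp (by fun_prop : Differentiable ℂ fun s => c + s)) s).meromorphicAt
  have h2 : ∀ c : ℂ, MeromorphicAt (fun s => Complex.Gamma (1 - c - s)) s := fun c => by
    refine MeromorphicAt.inv_iff.1 ?_
    exact (Differentiable.analyticAt (f := fun s => (Complex.Gamma (1 - c - s))⁻¹)
      (Complex.differentiable_one_div_Gamma.comp (by fun_prop : Differentiable ℂ fun s => 1 - c - s)) s).meromorphicAt
  unfold meijerMellin
  refine MeromorphicAt.fun_div (MeromorphicAt.fun_mul ?_ ?_) (MeromorphicAt.fun_mul ?_ ?_)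
  · exact MeromorphicAt.fun_prod fun j _ => h1 _
  · exact MeromorphicAt.fun_prod fun j _ => h2 _
  · exact MeromorphicAt.fun_prod fun j _ => h2 _
  · exact MeromorphicAt.fun_prod fun j _ => h1 _

/-- The integrand of the Meijer G-function. -/
def meijerIntegrand (m n : ℕ) {p q : ℕ} (a : Fin p → ℂ) (b : Fin q → ℂ) (r : ℝ) (s : ℂ) : ℂ :=
  meijerMellin m n a b s * (r : ℂ) ^ (-s)

theorem differentiable_const_cpow_neg {r : ℝ} (hr : 0 < r) :
    Differentiable ℂ fun s : ℂ => (r : ℂ) ^ (-s) := fun s =>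
  (differentiableAt_neg_iff.2 differentiableAt_id : DifferentiableAt ℂ (fun s : ℂ => -s) s).const_cpow
    (Or.inl (by exact_mod_cast hr.ne'))

theorem differentiableAt_meijerIntegrand {m n p q : ℕ} {a : Fin p → ℂ} {b : Fin q → ℂ} {s : ℂ}
    {r : ℝ} (hr : 0 < r) (hl : s ∉ lowerPoles m b) (hu : s ∉ upperPoles n a) :
    DifferentiableAt ℂ (meijerIntegrand m n a b r) s :=
  (differentiableAt_meijerMellin hl hu).mul (differentiable_const_cpow_neg hr s)

theorem meromorphicAt_meijerIntegrand {m n p q : ℕ} (a : Fin p → ℂ) (b : Fin q → ℂ) (s : ℂ)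
    {r : ℝ} (hr : 0 < r) : MeromorphicAt (meijerIntegrand m n a b r) s :=
  (meromorphicAt_meijerMellin a b s).fun_mul
    ((differentiable_const_cpow_neg hr).analyticAt s).meromorphicAt

theorem finite_lowerPoles_lt (m : ℕ) {q : ℕ} (b : Fin q → ℂ) (c : ℝ) :
    {z ∈ lowerPoles m b | c < z.re}.Finite := by
  refine (Set.finite_iUnion fun j : Fin q =>
    ((Set.finite_Iic (⌈-(b j).re - c⌉₊)).image fun k : ℕ => -b j - k)).subset ?_
  rintro z ⟨⟨j, _, k, rfl⟩, hz⟩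
  refine Set.mem_iUnion.2 ⟨j, k, ?_, rfl⟩
  simp at hz
  have : (k : ℝ) ≤ ⌈-(b j).re - c⌉₊ := le_trans (by linarith) (Nat.le_ceil _)
  exact_mod_cast this

theorem finite_upperPoles_lt (n : ℕ) {p : ℕ} (a : Fin p → ℂ) (c : ℝ) :
    {z ∈ upperPoles n a | z.re < c}.Finite := by
  refine (Set.finite_iUnion fun j : Fin p =>
    ((Set.finite_Iic (⌈c - 1 + (a j).re⌉₊)).image fun k : ℕ => 1 - a j + k)).subset ?_
  rintro z ⟨⟨j, _, k, rfl⟩, hz⟩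
  refine Set.mem_iUnion.2 ⟨j, k, ?_, rfl⟩
  simp at hz
  have : (k : ℝ) ≤ ⌈c - 1 + (a j).re⌉₊ := le_trans (by linarith) (Nat.le_ceil _)
  exact_mod_cast this

theorem countable_lowerPoles (m : ℕ) {q : ℕ} (b : Fin q → ℂ) : (lowerPoles m b).Countable := by
  refine (Set.countable_iUnion fun j : Fin q => Set.countable_range fun k : ℕ => -b j - k).mono ?_
  rintro z ⟨j, _, k, rfl⟩
  exact Set.mem_iUnion.2 ⟨j, k, rfl⟩

theorem countable_upperPoles (n : ℕ) {p : ℕ} (a : Fin p → ℂ) : (upperPoles n a).Countable := by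
  refine (Set.countable_iUnion fun j : Fin p => Set.countable_range fun k : ℕ => 1 - a j + k).mono ?_
  rintro z ⟨j, _, k, rfl⟩
  exact Set.mem_iUnion.2 ⟨j, k, rfl⟩

/-- Every nonempty open interval contains an abscissa of a vertical line without poles. -/
theorem exists_mem_Ioo_forall_poles_re_ne (m n : ℕ) {p q : ℕ} (a : Fin p → ℂ) (b : Fin q → ℂ)
    {u v : ℝ} (huv : u < v) :
    ∃ c ∈ Set.Ioo u v, (∀ z ∈ lowerPoles m b, z.re ≠ c) ∧ ∀ z ∈ upperPoles n a, z.re ≠ c := by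
  have hcount : (Complex.re '' (lowerPoles m b ∪ upperPoles n a)).Countable :=
    ((countable_lowerPoles m b).union (countable_upperPoles n a)).image _
  obtain ⟨c, hc, hc'⟩ := (hcount.dense_compl ℝ).exists_between huv
  exact ⟨c, hc', fun z hz h => hc ⟨z, Or.inl hz, h⟩, fun z hz h => hc ⟨z, Or.inr hz, h⟩⟩

theorem MeijerParams.disjoint_poles {m n p q : ℕ} {a : Fin p → ℂ} {b : Fin q → ℂ}
    (h : MeijerParams m n a b) : Disjoint (lowerPoles m b) (upperPoles n a) := by
  rw [Set.disjoint_left]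
  rintro z ⟨i, hi, k, rfl⟩ ⟨j, hj, k', hz⟩
  refine h.no_common_pole i hi j hj (k + k') ?_
  push_cast
  linear_combination hz

/-! ### Decay of the Mellin transform and independence of the abscissa -/

theorem exists_rpow_mul_exp_le (E κ : ℝ) {k : ℝ} (hk : 0 < k) : ∃ T : ℝ, 1 ≤ T ∧ ∀ t, T ≤ t →
    t ^ E * Real.exp (-k * t) ≤ t ^ (-κ) := by
  have h := tendsto_rpow_mul_exp_neg_mul_atTop_nhds_zero (E + κ) k hk
  obtain ⟨T, hT⟩ := eventually_atTop.1 (h.eventually_le_const (zero_lt_one))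
  refine ⟨max T 1, le_max_right _ _, fun t ht => ?_⟩
  have h1 := hT t ((le_max_left _ _).trans ht)
  have ht0 : 0 < t := zero_lt_one.trans_le ((le_max_right _ _).trans ht)
  rw [Real.rpow_add ht0] at h1
  rw [Real.rpow_neg ht0.le, le_inv_comm₀ (by positivity) (by positivity)]
  rw [le_inv_comm₀ (by positivity) (by positivity), ← one_div, le_div_iff₀ (by positivity)]
  linarith

/-- On the strip `c₁ ≤ Re s ≤ c₂` the Mellin transform is `O(|Im s| ^ (-κ))`. -/
def MeijerDecay (m n : ℕ) {p q : ℕ} (a : Fin p → ℂ) (b : Fin q → ℂ) (κ c₁ c₂ : ℝ) : Prop :=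
  ConditionA m n p q ∨ (p + q = 2 * m + 2 * n ∧ κ ≤ meijerNu a b + ((p : ℝ) - q) * (c₁ - 1 / 2) ∧
    κ ≤ meijerNu a b + ((p : ℝ) - q) * (c₂ - 1 / 2))

/-- The exponent of the power is affine in `Re s`, so its values at the two edges control the strip.
Under Condition A the exponential beats every power. -/
theorem MeijerDecay.verticalBound {m n p q : ℕ} {a : Fin p → ℂ} {b : Fin q → ℂ}
    (hm : m ≤ q) (hn : n ≤ p) {κ c₁ c₂ : ℝ} (h : MeijerDecay m n a b κ c₁ c₂) :
    VerticalBound c₁ c₂ (fun _ => -κ) 0 (meijerMellin m n a b) := by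
  obtain ⟨C, T, hC, hT, hb⟩ := verticalBound_meijerMellin (a := a) (b := b) hm hn c₁ c₂
  rcases h with h | ⟨h1, h2, h3⟩
  · have hk : 0 < (2 * (m : ℝ) + 2 * n - p - q) * (Real.pi / 2) := by
      have : (p : ℝ) + q < 2 * m + 2 * n := by exact_mod_cast h
      have : 0 < 2 * (m : ℝ) + 2 * n - p - q := by linarith
      positivity
    set E : ℝ := max (-(meijerNu a b + ((p : ℝ) - q) * (c₁ - 1 / 2)))
      (-(meijerNu a b + ((p : ℝ) - q) * (c₂ - 1 / 2))) with hE
    obtain ⟨T', hT', h'⟩ := exists_rpow_mul_exp_le E κ hk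
    refine ⟨C, max T T', hC, le_max_of_le_left hT, fun s h1 h2 h3 => ?_⟩
    have ht1 : 1 ≤ |s.im| := hT.trans ((le_max_left _ _).trans h3)
    refine (hb s h1 h2 ((le_max_left _ _).trans h3)).trans ?_
    have h4 := h' _ ((le_max_right _ _).trans h3)
    have h5 : -(meijerNu a b + ((p : ℝ) - q) * (s.re - 1 / 2)) ≤ E := by
      rcases le_total (0 : ℝ) ((p : ℝ) - q) with h0 | h0
      · refine le_max_of_le_left ?_
        nlinarith
      · refine le_max_of_le_right ?_
        nlinarith
    have h6 := Real.rpow_le_rpow_of_exponent_le ht1 h5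
    have h7 := Real.exp_pos (-(2 * (m : ℝ) + 2 * n - p - q) * (Real.pi / 2) * |s.im|)
    calc _ ≤ C * |s.im| ^ E * Real.exp (-(2 * (m : ℝ) + 2 * n - p - q) * (Real.pi / 2) * |s.im|) := by gcongr
      _ = C * (|s.im| ^ E * Real.exp (-((2 * (m : ℝ) + 2 * n - p - q) * (Real.pi / 2)) * |s.im|)) := by
        rw [mul_assoc]; ring_nf
      _ ≤ C * |s.im| ^ (-κ) := by gcongr
      _ = _ := by simp
  · refine ⟨C, T, hC, hT, fun s hs1 hs2 hs3 => ?_⟩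
    have ht1 : 1 ≤ |s.im| := hT.trans hs3
    refine (hb s hs1 hs2 hs3).trans ?_
    have hk : 2 * (m : ℝ) + 2 * n - p - q = 0 := by
      have : (p : ℝ) + q = 2 * m + 2 * n := by exact_mod_cast h1
      linarith
    rw [hk]
    have h5 : -(meijerNu a b + ((p : ℝ) - q) * (s.re - 1 / 2)) ≤ -κ := by
      rcases le_total (0 : ℝ) ((p : ℝ) - q) with h0 | h0 <;> nlinarith
    have h6 := Real.rpow_le_rpow_of_exponent_le ht1 h5
    simp only [neg_zero, zero_mul, Real.exp_zero, mul_one]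
    gcongr

theorem norm_cpow_neg_le {r : ℝ} (hr : 0 < r) {c₁ c₂ : ℝ} {s : ℂ} (h1 : c₁ ≤ s.re) (h2 : s.re ≤ c₂) :
    ‖(r : ℂ) ^ (-s)‖ ≤ r ^ (-c₁) + r ^ (-c₂) := by
  rw [Complex.norm_cpow_eq_rpow_re_of_pos hr, Complex.neg_re]
  rcases le_total 1 r with h | h
  · have := Real.rpow_le_rpow_of_exponent_le h (neg_le_neg h1)
    have := Real.rpow_nonneg hr.le (-c₂)
    linarith
  · have := Real.rpow_le_rpow_of_exponent_ge hr h (neg_le_neg h2)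
    have := Real.rpow_nonneg hr.le (-c₁)
    linarith

theorem VerticalBound.tendsto_zero {c₁ c₂ κ : ℝ} {f : ℂ → ℂ} (hκ : 0 < κ)
    (h : VerticalBound c₁ c₂ (fun _ => -κ) 0 f) : Tendsto f (stripFilter c₁ c₂) (𝓝 0) := by
  obtain ⟨C, T, hC, hT, h⟩ := h
  rw [tendsto_stripFilter_zero_iff]
  intro ε hε
  have h1 : Tendsto (fun t : ℝ => C * t ^ (-κ)) atTop (𝓝 0) := by
    simpa using (tendsto_rpow_neg_atTop hκ).const_mul C
  obtain ⟨T', hT'⟩ := eventually_atTop.1 (h1.eventually_lt_const hε)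
  refine ⟨max T T', fun s h1 h2 h3 => ?_⟩
  have := h s h1 h2 ((le_max_left _ _).trans h3)
  simp only [neg_zero, zero_mul, Real.exp_zero, mul_one] at this
  exact this.trans_lt (hT' _ ((le_max_right _ _).trans h3))

theorem tendsto_meijerIntegrand_stripFilter {m n p q : ℕ} {a : Fin p → ℂ} {b : Fin q → ℂ}
    (hm : m ≤ q) (hn : n ≤ p) {κ c₁ c₂ : ℝ} (hκ : 0 < κ) (h : MeijerDecay m n a b κ c₁ c₂)
    {r : ℝ} (hr : 0 < r) :
    Tendsto (meijerIntegrand m n a b r) (stripFilter c₁ c₂) (𝓝 0) := by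
  refine Tendsto.zero_mul_isBoundedUnder_le ((h.verticalBound hm hn).tendsto_zero hκ) ?_
  refine isBoundedUnder_of_eventually_le (a := r ^ (-c₁) + r ^ (-c₂)) ?_
  refine Filter.Eventually.filter_mono inf_le_right ?_
  rw [eventually_principal]
  exact fun s hs => norm_cpow_neg_le hr hs.1 hs.2

/-- The truncated integral along the vertical line. -/
def meijerLine (m n : ℕ) {p q : ℕ} (a : Fin p → ℂ) (b : Fin q → ℂ) (r c T : ℝ) : ℂ :=
  (2 * Real.pi : ℂ)⁻¹ * ∫ t in (-T)..T, meijerIntegrand m n a b r (c + t * Complex.I)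

/-- The contribution of the poles on the wrong side of the vertical line. -/
def meijerResidues (m n : ℕ) {p q : ℕ} (a : Fin p → ℂ) (b : Fin q → ℂ) (r c : ℝ) : ℂ :=
  ∑ᶠ z ∈ {z ∈ lowerPoles m b | c < z.re}, residueAt (meijerIntegrand m n a b r) z
    - ∑ᶠ z ∈ {z ∈ upperPoles n a | z.re < c}, residueAt (meijerIntegrand m n a b r) z

/-- The line integral gains the residues of all poles crossed. The correction loses the same amount:
crossed lower poles are no longer on the wrong side, and crossed upper poles now are, with a minus
sign. -/
theorem tendsto_meijerLine_sub {m n p q : ℕ} {a : Fin p → ℂ} {b : Fin q → ℂ}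
    (hab : MeijerParams m n a b) {κ c₁ c₂ : ℝ} (hc : c₁ < c₂) (hκ : 0 < κ)
    (h : MeijerDecay m n a b κ c₁ c₂)
    (hl₁ : ∀ z ∈ lowerPoles m b, z.re ≠ c₁) (hu₁ : ∀ z ∈ upperPoles n a, z.re ≠ c₁)
    (hl₂ : ∀ z ∈ lowerPoles m b, z.re ≠ c₂) (hu₂ : ∀ z ∈ upperPoles n a, z.re ≠ c₂)
    {r : ℝ} (hr : 0 < r) :
    Tendsto (fun T => (meijerLine m n a b r c₂ T + meijerResidues m n a b r c₂)
      - (meijerLine m n a b r c₁ T + meijerResidues m n a b r c₁)) atTop (𝓝 0) := by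
  classical
  set F := meijerIntegrand m n a b r with hF
  set Lm : Set ℂ := {z ∈ lowerPoles m b | c₁ < z.re ∧ z.re < c₂} with hLm
  set Um : Set ℂ := {z ∈ upperPoles n a | c₁ < z.re ∧ z.re < c₂} with hUm
  have hLf : Lm.Finite := (finite_lowerPoles_lt m b c₁).subset fun z hz => ⟨hz.1, hz.2.1⟩
  have hUf : Um.Finite := (finite_upperPoles_lt n a c₂).subset fun z hz => ⟨hz.1, hz.2.2⟩
  have hLU : Disjoint Lm Um := Set.disjoint_left.2 fun z h1 h2 =>
    Set.disjoint_left.1 hab.disjoint_poles h1.1 h2.1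
  have key := tendsto_integral_line_sub (F := F) hc (hLf.union hUf).toFinset
    (by
      intro z hz
      rw [Set.Finite.mem_toFinset] at hz
      rcases hz with hz | hz <;> exact hz.2)
    (by
      intro s h1 h2 hs
      rw [Set.Finite.mem_toFinset] at hs
      refine differentiableAt_meijerIntegrand hr (fun hl => hs (Or.inl ⟨hl, ?_, ?_⟩))
        (fun hl => hs (Or.inr ⟨hl, ?_, ?_⟩))
      · exact lt_of_le_of_ne h1 (hl₁ s hl).symm
      · exact lt_of_le_of_ne h2 (hl₂ s hl)
      · exact lt_of_le_of_ne h1 (hu₁ s hl).symm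
      · exact lt_of_le_of_ne h2 (hu₂ s hl))
    (fun z _ => meromorphicAt_meijerIntegrand a b z hr)
    (tendsto_meijerIntegrand_stripFilter hab.m_le hab.n_le hκ h hr)
  have hsum : ∑ z ∈ (hLf.union hUf).toFinset, residueAt F z
      = ∑ᶠ z ∈ Lm, residueAt F z + ∑ᶠ z ∈ Um, residueAt F z := by
    rw [← finsum_mem_union hLU hLf hUf, finsum_mem_eq_finite_toFinset_sum]
  have hL : ∑ᶠ z ∈ {z ∈ lowerPoles m b | c₁ < z.re}, residueAt F z
      = ∑ᶠ z ∈ Lm, residueAt F z + ∑ᶠ z ∈ {z ∈ lowerPoles m b | c₂ < z.re}, residueAt F z := by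
    have hset : {z ∈ lowerPoles m b | c₁ < z.re} = Lm ∪ {z ∈ lowerPoles m b | c₂ < z.re} := by
      ext z
      constructor
      · rintro ⟨h1, h2⟩
        rcases lt_or_gt_of_ne (hl₂ z h1) with h3 | h3
        · exact Or.inl ⟨h1, h2, h3⟩
        · exact Or.inr ⟨h1, h3⟩
      · rintro (⟨h1, h2, _⟩ | ⟨h1, h2⟩)
        · exact ⟨h1, h2⟩
        · exact ⟨h1, hc.trans h2⟩
    rw [hset, finsum_mem_union _ hLf (finite_lowerPoles_lt m b c₂)]
    exact Set.disjoint_left.2 fun z h1 h2 => lt_asymm h1.2.2 h2.2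
  have hU : ∑ᶠ z ∈ {z ∈ upperPoles n a | z.re < c₂}, residueAt F z
      = ∑ᶠ z ∈ Um, residueAt F z + ∑ᶠ z ∈ {z ∈ upperPoles n a | z.re < c₁}, residueAt F z := by
    have hset : {z ∈ upperPoles n a | z.re < c₂} = Um ∪ {z ∈ upperPoles n a | z.re < c₁} := by
      ext z
      constructor
      · rintro ⟨h1, h2⟩
        rcases lt_or_gt_of_ne (hu₁ z h1) with h3 | h3
        · exact Or.inr ⟨h1, h3⟩
        · exact Or.inl ⟨h1, h3, h2⟩
      · rintro (⟨h1, _, h2⟩ | ⟨h1, h2⟩)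
        · exact ⟨h1, h2⟩
        · exact ⟨h1, h2.trans hc⟩
    rw [hset, finsum_mem_union _ hUf (finite_upperPoles_lt n a c₁)]
    exact Set.disjoint_left.2 fun z h1 h2 => lt_asymm h1.2.1 h2.2
  have h2 := key.sub_const (∑ z ∈ (hLf.union hUf).toFinset, residueAt F z)
  rw [sub_self] at h2
  refine h2.congr fun T => ?_
  rw [hsum]
  simp only [meijerResidues, meijerLine, ← hF, hL, hU]
  ring

/-- Decay to zero controls only the difference of two truncated line integrals. Convergence along
one line is an input and is transferred to the other; this covers conditionally convergent
integrals. -/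
theorem meijerContourIntegral_eq_of_tendsto {m n p q : ℕ} {a : Fin p → ℂ} {b : Fin q → ℂ}
    (hab : MeijerParams m n a b) {κ c e : ℝ} (hκ : 0 < κ)
    (h : MeijerDecay m n a b κ c e)
    (hl : ∀ z ∈ lowerPoles m b, z.re ≠ c) (hu : ∀ z ∈ upperPoles n a, z.re ≠ c)
    (hle : ∀ z ∈ lowerPoles m b, z.re ≠ e) (hue : ∀ z ∈ upperPoles n a, z.re ≠ e)
    {r : ℝ} (hr : 0 < r) {A : ℂ} (hA : Tendsto (meijerLine m n a b r c) atTop (𝓝 A)) :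
    meijerContourIntegral m n a b r e = A + meijerResidues m n a b r c := by
  have h' : MeijerDecay m n a b κ e c := by
    rcases h with h | ⟨h1, h2, h3⟩
    · exact Or.inl h
    · exact Or.inr ⟨h1, h3, h2⟩
  have key : Tendsto (fun T => (meijerLine m n a b r e T + meijerResidues m n a b r e)
      - (meijerLine m n a b r c T + meijerResidues m n a b r c)) atTop (𝓝 0) := by
    rcases lt_trichotomy c e with hce | rfl | hce
    · exact tendsto_meijerLine_sub hab hce hκ h hl hu hle hue hr
    · simp
    · simpa using (tendsto_meijerLine_sub hab hce hκ h' hle hue hl hu hr).neg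
  have h1 : Tendsto (meijerLine m n a b r e) atTop
      (𝓝 (A + meijerResidues m n a b r c - meijerResidues m n a b r e)) := by
    have := (key.add (hA.add_const (meijerResidues m n a b r c))).sub_const (meijerResidues m n a b r e)
    rw [zero_add] at this
    exact this.congr fun T => by ring
  have h2 : meijerContourIntegral m n a b r e
      = limUnder atTop (meijerLine m n a b r e) + ∑ᶠ z ∈ {z ∈ lowerPoles m b | e < z.re},
        residueAt (meijerIntegrand m n a b r) z
        - ∑ᶠ z ∈ {z ∈ upperPoles n a | z.re < e}, residueAt (meijerIntegrand m n a b r) z := rfl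
  rw [h2, h1.limUnder_eq, add_sub_assoc]
  change _ + meijerResidues m n a b r e = _
  ring

/-- The value of `meijerG` may be computed along any admissible line. -/
theorem meijerG_eq_of_tendsto {m n p q : ℕ} {a : Fin p → ℂ} {b : Fin q → ℂ}
    (hab : MeijerParams m n a b) {c : ℝ} (hc : IsAbscissa m n a b c)
    (hcond : ConditionA m n p q ∨ (ConditionB m n p q ∧ 0 < meijerNu a b) ∨
      ConditionC m n p q ∨ ConditionD m n p q)
    {r : ℝ} (hr : 0 < r) {A : ℂ} (hA : Tendsto (meijerLine m n a b r c) atTop (𝓝 A)) :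
    meijerG m n a b r = A + meijerResidues m n a b r c := by
  have he : IsAbscissa m n a b (Classical.epsilon (IsAbscissa m n a b)) := Classical.epsilon_spec ⟨c, hc⟩
  unfold meijerG
  set e := Classical.epsilon (IsAbscissa m n a b)
  -- Under B the decay exponent is `ν` on every line. Under C and D both abscissae have exponent
  -- greater than 1, and so do all lines between them.
  obtain ⟨κ, hκ, hd⟩ : ∃ κ : ℝ, 0 < κ ∧ MeijerDecay m n a b κ c e := by
    rcases hcond with h | ⟨h, hν⟩ | h
    · exact ⟨1, zero_lt_one, Or.inl h⟩
    · refine ⟨_, hν, Or.inr ⟨h.1, ?_, ?_⟩⟩ <;> simp [h.2]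
    · refine ⟨1, zero_lt_one, Or.inr ⟨?_, (hc.2.2 h).le, (he.2.2 h).le⟩⟩
      rcases h with h | h <;> exact h.1
  exact meijerContourIntegral_eq_of_tendsto hab hκ hd hc.1 hc.2.1 he.1 he.2.1 hr hA

/-! ### Polynomials and Gaussian integrals -/

theorem nontrivial_euclideanSpace_of_pos {d : ℕ} (hd : 0 < d) : Nontrivial (EuclideanSpace ℝ (Fin d)) :=
  Module.nontrivial_of_finrank_pos (R := ℝ) (by simpa using hd)

section Polynomial

variable {d : ℕ}

theorem continuous_evalAt (V : MvPolynomial (Fin d) ℂ) : Continuous (evalAt V) := by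
  unfold evalAt
  exact (MvPolynomial.continuous_eval V).comp (continuous_pi fun i => by fun_prop)

theorem norm_evalAt_le {l : ℕ} {V : MvPolynomial (Fin d) ℂ} (hV : V.IsHomogeneous l) :
    ∃ C : ℝ, 0 ≤ C ∧ ∀ y, ‖evalAt V y‖ ≤ C * ‖y‖ ^ l := by
  refine ⟨∑ m ∈ V.support, ‖V.coeff m‖, Finset.sum_nonneg fun _ _ => norm_nonneg _, fun y => ?_⟩
  rw [evalAt, MvPolynomial.eval_eq', Finset.sum_mul]
  refine (norm_sum_le _ _).trans (Finset.sum_le_sum fun m hm => ?_)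
  rw [norm_mul, norm_prod]
  gcongr
  have hdeg : ∑ i, m i = l := by
    have := hV (MvPolynomial.mem_support_iff.1 hm)
    rwa [Finsupp.weight_apply, Finsupp.sum_fintype _ _ (by simp), Finset.sum_congr rfl (fun i _ => by simp : ∀ i ∈ Finset.univ, m i • (1 : Fin d → ℕ) i = m i)] at this
  calc ∏ i, ‖(y i : ℂ) ^ m i‖ ≤ ∏ i, ‖y‖ ^ m i := by
        refine Finset.prod_le_prod (fun _ _ => norm_nonneg _) fun i _ => ?_
        rw [norm_pow, Complex.norm_real]
        gcongr
        exact PiLp.norm_apply_le y i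
    _ = ‖y‖ ^ l := by rw [Finset.prod_pow_eq_pow_sum, hdeg]

theorem evalAt_smul {l : ℕ} {V : MvPolynomial (Fin d) ℂ} (hV : V.IsHomogeneous l) (t : ℝ)
    (y : EuclideanSpace ℝ (Fin d)) : evalAt V (t • y) = (t : ℂ) ^ l * evalAt V y := by
  simp only [evalAt, MvPolynomial.eval_eq']
  rw [Finset.mul_sum]
  refine Finset.sum_congr rfl fun m hm => ?_
  have hdeg : ∑ i, m i = l := by
    have := hV (MvPolynomial.mem_support_iff.1 hm)
    rwa [Finsupp.weight_apply, Finsupp.sum_fintype _ _ (by simp), Finset.sum_congr rfl (fun i _ => by simp : ∀ i ∈ Finset.univ, m i • (1 : Fin d → ℕ) i = m i)] at this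
  simp only [PiLp.smul_apply, smul_eq_mul, Complex.ofReal_mul, mul_pow, Finset.prod_mul_distrib,
    Finset.prod_pow_eq_pow_sum, hdeg]
  ring

theorem hasDerivAt_evalAt_line (V : MvPolynomial (Fin d) ℂ) (y : EuclideanSpace ℝ (Fin d)) (i : Fin d) :
    HasDerivAt (fun t : ℝ => evalAt V (y + t • EuclideanSpace.single i (1 : ℝ)))
      (evalAt (MvPolynomial.pderiv i V) y) 0 := by
  induction V using MvPolynomial.induction_on with
  | C a => simpa [evalAt] using hasDerivAt_const (0 : ℝ) a
  | add p q hp hq =>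
    have := hp.add hq
    refine (this.congr_deriv ?_).congr_of_eventuallyEq (Eventually.of_forall fun t => ?_)
    · simp [evalAt]
    · simp [evalAt]
  | mul_X p j hp =>
    have h1 : HasDerivAt (fun t : ℝ => (((y + t • EuclideanSpace.single i (1 : ℝ) : EuclideanSpace ℝ (Fin d)) j : ℝ) : ℂ))
        (if j = i then 1 else 0) 0 := by
      have h2 : HasDerivAt (fun t : ℝ => (y + t • EuclideanSpace.single i (1 : ℝ) : EuclideanSpace ℝ (Fin d)) j)
          (if j = i then 1 else 0) 0 := by
        simp only [PiLp.add_apply, PiLp.smul_apply, PiLp.single_apply, smul_eq_mul]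
        simpa using ((hasDerivAt_id (0 : ℝ)).mul_const (if j = i then (1 : ℝ) else 0)).const_add (y j)
      have := h2.ofReal_comp
      split_ifs at this ⊢ <;> simpa using this
    refine ((hp.mul h1).congr_deriv ?_).congr_of_eventuallyEq (Eventually.of_forall fun t => ?_)
    · simp only [evalAt, Derivation.leibniz, MvPolynomial.pderiv_X, Pi.single_apply, zero_smul, add_zero,
        smul_eq_mul, map_add, map_mul, MvPolynomial.eval_X]
      by_cases hji : j = i
      · subst hji; simp; ring
      · simp [hji]; ring
    · simp [evalAt]

theorem integrable_norm_pow_mul_gaussian (hd : 0 < d) {τ : ℝ} (hτ : 0 < τ) (k : ℕ) :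
    Integrable (fun h : EuclideanSpace ℝ (Fin d) => ‖h‖ ^ k * Real.exp (-τ * ‖h‖ ^ 2)) := by
  have := nontrivial_euclideanSpace_of_pos hd
  rw [integrable_fun_norm_addHaar volume (f := fun y => y ^ k * Real.exp (-τ * y ^ 2))]
  have h := integrableOn_rpow_mul_exp_neg_mul_sq hτ (s := ((d - 1 + k : ℕ) : ℝ))
    (by have : (0 : ℝ) ≤ ((d - 1 + k : ℕ) : ℝ) := Nat.cast_nonneg _
        linarith)
  refine h.congr_fun (fun y _ => ?_) measurableSet_Ioi
  simp only [finrank_euclideanSpace, Fintype.card_fin, smul_eq_mul, Real.rpow_natCast]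
  rw [pow_add]; ring

theorem integrable_evalAt_add_mul_gaussian (hd : 0 < d) {τ : ℝ} (hτ : 0 < τ) {l : ℕ}
    {V : MvPolynomial (Fin d) ℂ} (hV : V.IsHomogeneous l) (z : EuclideanSpace ℝ (Fin d)) (k : ℕ) :
    Integrable (fun h : EuclideanSpace ℝ (Fin d) =>
      ‖h‖ ^ k * ‖evalAt V (z + h)‖ * Real.exp (-τ * ‖h‖ ^ 2)) := by
  obtain ⟨C, hC, hb⟩ := norm_evalAt_le hV
  have h1 := ((integrable_norm_pow_mul_gaussian hd hτ k).const_mul (C * 2 ^ l * ‖z‖ ^ l)).add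
    ((integrable_norm_pow_mul_gaussian hd hτ (k + l)).const_mul (C * 2 ^ l))
  refine h1.mono' ?_ (Eventually.of_forall fun h => ?_)
  · refine Continuous.aestronglyMeasurable ?_
    have := continuous_evalAt V
    fun_prop
  · rw [Real.norm_of_nonneg (by positivity)]
    have h2 : ‖z + h‖ ^ l ≤ 2 ^ l * (‖z‖ ^ l + ‖h‖ ^ l) := by
      calc ‖z + h‖ ^ l ≤ (2 * max ‖z‖ ‖h‖) ^ l := by
            gcongr
            have := norm_add_le z h
            have := le_max_left ‖z‖ ‖h‖
            have := le_max_right ‖z‖ ‖h‖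
            linarith
        _ = 2 ^ l * (max ‖z‖ ‖h‖) ^ l := mul_pow _ _ _
        _ ≤ _ := by
            gcongr
            rcases max_choice ‖z‖ ‖h‖ with h3 | h3 <;> rw [h3]
            · exact le_add_of_nonneg_right (by positivity)
            · exact le_add_of_nonneg_left (by positivity)
    calc ‖h‖ ^ k * ‖evalAt V (z + h)‖ * Real.exp (-τ * ‖h‖ ^ 2)
        ≤ ‖h‖ ^ k * (C * (2 ^ l * (‖z‖ ^ l + ‖h‖ ^ l))) * Real.exp (-τ * ‖h‖ ^ 2) := by
          gcongr
          exact (hb _).trans (by gcongr)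
      _ = _ := by simp only [Pi.add_apply]; rw [pow_add]; ring

theorem integrable_gaussian_evalAt (hd : 0 < d) {τ : ℝ} (hτ : 0 < τ) {l : ℕ}
    {V : MvPolynomial (Fin d) ℂ} (hV : V.IsHomogeneous l) (z : EuclideanSpace ℝ (Fin d)) :
    Integrable (fun h : EuclideanSpace ℝ (Fin d) =>
      evalAt V (z + h) * (Real.exp (-τ * ‖h‖ ^ 2) : ℂ)) := by
  have := continuous_evalAt V
  refine (integrable_evalAt_add_mul_gaussian hd hτ hV z 0).mono (Continuous.aestronglyMeasurable (by fun_prop))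
    (Eventually.of_forall fun h => ?_)
  rw [norm_mul, Complex.norm_real, pow_zero, one_mul, norm_mul, norm_norm]

theorem integrable_coord_mul_gaussian_evalAt (hd : 0 < d) {τ : ℝ} (hτ : 0 < τ) {l : ℕ}
    {V : MvPolynomial (Fin d) ℂ} (hV : V.IsHomogeneous l) (z : EuclideanSpace ℝ (Fin d)) (i : Fin d) :
    Integrable (fun h : EuclideanSpace ℝ (Fin d) =>
      (h i : ℂ) * evalAt V (z + h) * (Real.exp (-τ * ‖h‖ ^ 2) : ℂ)) := by
  have := continuous_evalAt V
  refine (integrable_evalAt_add_mul_gaussian hd hτ hV z 1).mono (Continuous.aestronglyMeasurable (by fun_prop))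
    (Eventually.of_forall fun h => ?_)
  rw [norm_mul, norm_mul, Complex.norm_real, Complex.norm_real, pow_one, norm_mul, norm_mul, norm_norm, norm_norm]
  gcongr
  exact PiLp.norm_apply_le h i

/-- Integration by parts, since `h_i exp(-τ‖h‖²)` is `-(2τ)⁻¹` times the `i`-th partial derivative
of the Gaussian. -/
theorem integral_coord_mul_evalAt_gaussian (hd : 0 < d) {τ : ℝ} (hτ : 0 < τ) {l : ℕ}
    {V : MvPolynomial (Fin d) ℂ} (hV : V.IsHomogeneous l) (z : EuclideanSpace ℝ (Fin d)) (i : Fin d) :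
    ∫ h : EuclideanSpace ℝ (Fin d), (h i : ℂ) * evalAt V (z + h) * (Real.exp (-τ * ‖h‖ ^ 2) : ℂ)
      = (2 * τ : ℂ)⁻¹ * ∫ h : EuclideanSpace ℝ (Fin d),
        evalAt (MvPolynomial.pderiv i V) (z + h) * (Real.exp (-τ * ‖h‖ ^ 2) : ℂ) := by
  have hτ' : (2 * τ : ℂ) ≠ 0 := by
    have : (τ : ℂ) ≠ 0 := by exact_mod_cast hτ.ne'
    simpa using this
  have key := integral_bilinear_hasLineDerivAt_right_eq_neg_left_of_integrable
    (μ := (volume : Measure (EuclideanSpace ℝ (Fin d))))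
    (f := fun h => evalAt V (z + h)) (f' := fun h => evalAt (MvPolynomial.pderiv i V) (z + h))
    (g := fun h => (Real.exp (-τ * ‖h‖ ^ 2) : ℂ))
    (g' := fun h => (-2 * τ : ℂ) * (h i : ℂ) * (Real.exp (-τ * ‖h‖ ^ 2) : ℂ))
    (v := EuclideanSpace.single i (1 : ℝ)) (B := ContinuousLinearMap.mul ℝ ℂ)
    (integrable_gaussian_evalAt hd hτ hV.pderiv z)
    (((integrable_coord_mul_gaussian_evalAt hd hτ hV z i).const_mul (-2 * τ : ℂ)).congr
      (Eventually.of_forall fun h => by simp only [ContinuousLinearMap.mul_apply']; ring))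
    (integrable_gaussian_evalAt hd hτ hV z)
    (fun h _ => by
      have := hasDerivAt_evalAt_line V (z + h) i
      simpa only [HasLineDerivAt, add_assoc] using this)
    (fun h _ => by
      have h1 : ∀ t : ℝ, ‖h + t • EuclideanSpace.single i (1 : ℝ)‖ ^ 2 = ‖h‖ ^ 2 + 2 * h i * t + t ^ 2 := by
        intro t
        rw [norm_add_sq_real, inner_smul_right, norm_smul, EuclideanSpace.inner_single_right]
        simp
        ring
      have h2 : HasDerivAt (fun t : ℝ => -τ * (‖h‖ ^ 2 + 2 * h i * t + t ^ 2)) (-τ * (2 * h i)) 0 := by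
        have h3 := ((((hasDerivAt_id (0 : ℝ)).const_mul (2 * h i)).const_add (‖h‖ ^ 2)).add
          ((hasDerivAt_id (0 : ℝ)).pow 2)).const_mul (-τ)
        refine h3.congr_deriv ?_
        simp
      have h4 := h2.exp.ofReal_comp
      unfold HasLineDerivAt
      simp only [h1]
      refine h4.congr_deriv ?_
      push_cast
      simp
      ring)
  simp only [ContinuousLinearMap.mul_apply'] at key
  rw [eq_inv_mul_iff_mul_eq₀ hτ', ← integral_const_mul]
  have e : ∀ h : EuclideanSpace ℝ (Fin d), (2 * τ : ℂ) * ((h i : ℂ) * evalAt V (z + h) * (Real.exp (-τ * ‖h‖ ^ 2) : ℂ))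
      = -(evalAt V (z + h) * ((-2 * τ : ℂ) * (h i : ℂ) * (Real.exp (-τ * ‖h‖ ^ 2) : ℂ))) := fun h => by ring
  simp only [e]
  rw [integral_neg, key, neg_neg]

theorem MvPolynomial.pderiv_pderiv_comm (i j : Fin d) (V : MvPolynomial (Fin d) ℂ) :
    MvPolynomial.pderiv i (MvPolynomial.pderiv j V) = MvPolynomial.pderiv j (MvPolynomial.pderiv i V) := by
  have h : ⁅MvPolynomial.pderiv (R := ℂ) i, MvPolynomial.pderiv (R := ℂ) j⁆ = 0 := by
    refine MvPolynomial.derivation_ext fun k => ?_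
    simp only [Derivation.commutator_apply, MvPolynomial.pderiv_X, Pi.single_apply, Derivation.zero_apply]
    split_ifs <;> simp
  have := DFunLike.congr_fun h V
  rwa [Derivation.commutator_apply, Derivation.zero_apply, sub_eq_zero] at this

theorem IsSolidHarmonic.pderiv {l : ℕ} {V : MvPolynomial (Fin d) ℂ} (hV : IsSolidHarmonic l V)
    (i : Fin d) : IsSolidHarmonic (l - 1) (MvPolynomial.pderiv i V) := by
  refine ⟨hV.1.pderiv, ?_⟩
  have h := congrArg (MvPolynomial.pderiv i) hV.2
  rw [map_sum, map_zero] at h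
  rw [← h]
  refine Finset.sum_congr rfl fun j _ => ?_
  rw [MvPolynomial.pderiv_pderiv_comm j i, MvPolynomial.pderiv_pderiv_comm j i]

/-- Mean value property of solid harmonics with respect to a Gaussian weight. -/
theorem integral_evalAt_add_mul_gaussian (hd : 0 < d) {τ : ℝ} (hτ : 0 < τ) (l : ℕ) :
    ∀ {V : MvPolynomial (Fin d) ℂ}, IsSolidHarmonic l V → ∀ z : EuclideanSpace ℝ (Fin d),
    ∫ h : EuclideanSpace ℝ (Fin d), evalAt V (z + h) * (Real.exp (-τ * ‖h‖ ^ 2) : ℂ)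
      = ((Real.pi / τ) ^ ((d : ℝ) / 2) : ℝ) * evalAt V z := by
  induction l with
  | zero =>
    intro V hV z
    have h0 := hV.1
    rw [← MvPolynomial.totalDegree_zero_iff_isHomogeneous, MvPolynomial.totalDegree_eq_zero_iff_eq_C] at h0
    rw [h0]
    simp only [evalAt, MvPolynomial.eval_C]
    rw [integral_const_mul, integral_complex_ofReal, GaussianFourier.integral_rexp_neg_mul_sq_norm hτ, mul_comm]
    simp
  | succ l ih =>
    intro V hV z
    -- Euler's identity at `z + h` splits the integrand. The terms with `z_i` are handled by
    -- induction, because `∂_i V` is harmonic of lower degree. Those with `h_i` become second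
    -- derivatives after integration by parts and sum to the Laplacian, which is zero.
    have heuler : ∀ y : EuclideanSpace ℝ (Fin d), ∑ i, (y i : ℂ) * evalAt (MvPolynomial.pderiv i V) y
        = ((l + 1 : ℕ) : ℂ) * evalAt V y := by
      intro y
      have := congrArg (fun P => evalAt P y) hV.1.sum_X_mul_pderiv
      simpa [evalAt, nsmul_eq_mul] using this
    have hl : ((l + 1 : ℕ) : ℂ) ≠ 0 := by exact_mod_cast Nat.succ_ne_zero l
    refine mul_left_cancel₀ hl ?_
    rw [← integral_const_mul]
    have e : ∀ h : EuclideanSpace ℝ (Fin d), ((l + 1 : ℕ) : ℂ) * (evalAt V (z + h) * (Real.exp (-τ * ‖h‖ ^ 2) : ℂ))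
        = ∑ i, ((z i : ℂ) * (evalAt (MvPolynomial.pderiv i V) (z + h) * (Real.exp (-τ * ‖h‖ ^ 2) : ℂ)) +
          (h i : ℂ) * evalAt (MvPolynomial.pderiv i V) (z + h) * (Real.exp (-τ * ‖h‖ ^ 2) : ℂ)) := by
      intro h
      rw [← mul_assoc, ← heuler, Finset.sum_mul]
      refine Finset.sum_congr rfl fun i _ => ?_
      simp only [PiLp.add_apply, Complex.ofReal_add]
      ring
    simp only [e]
    have hi1 : ∀ i, Integrable (fun h : EuclideanSpace ℝ (Fin d) =>
        (z i : ℂ) * (evalAt (MvPolynomial.pderiv i V) (z + h) * (Real.exp (-τ * ‖h‖ ^ 2) : ℂ))) := fun i =>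
      (integrable_gaussian_evalAt hd hτ hV.1.pderiv z).const_mul _
    have hi2 : ∀ i, Integrable (fun h : EuclideanSpace ℝ (Fin d) =>
        (h i : ℂ) * evalAt (MvPolynomial.pderiv i V) (z + h) * (Real.exp (-τ * ‖h‖ ^ 2) : ℂ)) := fun i =>
      integrable_coord_mul_gaussian_evalAt hd hτ hV.1.pderiv z i
    rw [integral_finsetSum _ fun i _ => by exact (hi1 i).add (hi2 i)]
    have e2 : ∀ i, ∫ h : EuclideanSpace ℝ (Fin d), ((z i : ℂ) * (evalAt (MvPolynomial.pderiv i V) (z + h) * (Real.exp (-τ * ‖h‖ ^ 2) : ℂ)) +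
          (h i : ℂ) * evalAt (MvPolynomial.pderiv i V) (z + h) * (Real.exp (-τ * ‖h‖ ^ 2) : ℂ))
        = (z i : ℂ) * (((Real.pi / τ) ^ ((d : ℝ) / 2) : ℝ) * evalAt (MvPolynomial.pderiv i V) z)
          + (2 * τ : ℂ)⁻¹ * ∫ h : EuclideanSpace ℝ (Fin d),
            evalAt (MvPolynomial.pderiv i (MvPolynomial.pderiv i V)) (z + h) * (Real.exp (-τ * ‖h‖ ^ 2) : ℂ) := by
      intro i
      rw [integral_add (hi1 i) (hi2 i), integral_const_mul,
        integral_coord_mul_evalAt_gaussian hd hτ hV.1.pderiv z i, ih (hV.pderiv i)]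
    simp only [e2, Finset.sum_add_distrib, ← Finset.mul_sum]
    rw [← integral_finsetSum _ fun i _ => integrable_gaussian_evalAt hd hτ hV.1.pderiv.pderiv z]
    have e3 : ∀ h : EuclideanSpace ℝ (Fin d), ∑ i, evalAt (MvPolynomial.pderiv i (MvPolynomial.pderiv i V)) (z + h)
        * (Real.exp (-τ * ‖h‖ ^ 2) : ℂ) = 0 := by
      intro h
      have := congrArg (fun P => evalAt P (z + h)) hV.2
      simp only [evalAt, map_sum, map_zero] at this
      rw [← Finset.sum_mul]
      simp only [evalAt, this, zero_mul]
    simp only [e3, integral_zero, mul_zero, add_zero]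
    rw [mul_left_comm, ← heuler, Finset.mul_sum]
    exact Finset.sum_congr rfl fun i _ => by ring

end Polynomial

/-! ### A double Gamma integral -/

theorem integrableOn_cpow_mul_exp_neg {s : ℂ} (hs : 0 < s.re) {r : ℝ} (hr : 0 < r) :
    IntegrableOn (fun t : ℝ => (t : ℂ) ^ (s - 1) * (Real.exp (-(r * t)) : ℂ)) (Set.Ioi 0) := by
  have h := integrableOn_rpow_mul_exp_neg_mul_rpow (s := s.re - 1) (p := 1) (b := r) (by linarith) one_pos hr
  refine Integrable.mono' h ?_ ?_
  · refine ContinuousOn.aestronglyMeasurable (fun t ht => ?_) measurableSet_Ioi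
    refine ContinuousAt.continuousWithinAt ?_
    refine ContinuousAt.mul ?_ (by fun_prop)
    exact (Complex.continuousAt_ofReal_cpow_const t (s - 1) (Or.inr (ne_of_gt ht)))
  · filter_upwards [ae_restrict_mem measurableSet_Ioi] with t ht
    rw [norm_mul, Complex.norm_cpow_eq_rpow_re_of_pos ht, Complex.norm_real, Real.norm_of_nonneg (Real.exp_pos _).le,
      Real.rpow_one]
    simp

theorem integral_cpow_mul_exp_neg {s : ℂ} (hs : 0 < s.re) {r : ℝ} (hr : 0 < r) :
    ∫ t in Set.Ioi (0 : ℝ), (t : ℂ) ^ (s - 1) * (Real.exp (-(r * t)) : ℂ)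
      = (r : ℂ) ^ (-s) * Complex.Gamma s := by
  have := Complex.integral_cpow_mul_exp_neg_mul_Ioi hs hr
  push_cast at this ⊢
  rw [this, one_div, Complex.inv_cpow _ _ (by rw [Complex.arg_ofReal_of_nonneg hr.le]; exact Real.pi_ne_zero.symm),
    Complex.cpow_neg]

/-- The kernel whose double integral is `Γ(s) Γ(β) A ^ (-s) B ^ (-β)`. -/
def gammaKernel (s β : ℂ) (A B : ℝ) (w : ℝ × ℝ) : ℂ :=
  (w.1 : ℂ) ^ (s + β - 1) * (w.2 : ℂ) ^ (s - 1) * (Real.exp (-(w.1 * B + w.1 * w.2 * A)) : ℂ)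

/-- Lebesgue measure on the open quadrant. -/
abbrev quadrantMeasure : Measure (ℝ × ℝ) :=
  (volume.restrict (Set.Ioi (0 : ℝ))).prod (volume.restrict (Set.Ioi (0 : ℝ)))

theorem quadrantMeasure_ae : ∀ᵐ w ∂quadrantMeasure, 0 < w.1 ∧ 0 < w.2 := by
  rw [quadrantMeasure, Measure.prod_restrict]
  filter_upwards [ae_restrict_mem (measurableSet_Ioi.prod measurableSet_Ioi)] with w hw
  exact ⟨hw.1, hw.2⟩

theorem measurable_gammaKernel (s β : ℂ) : Measurable fun z : (ℝ × ℝ) × (ℝ × ℝ) =>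
    gammaKernel s β z.1.1 z.1.2 z.2 := by
  unfold gammaKernel
  fun_prop

/-- The modulus is the same kernel at the real parts of the exponents, so absolute convergence and
the integral of the norm come from the same formulas. -/
theorem norm_gammaKernel (s β : ℂ) (A B : ℝ) {w : ℝ × ℝ} (h1 : 0 < w.1) (h2 : 0 < w.2) :
    (‖gammaKernel s β A B w‖ : ℂ) = gammaKernel s.re β.re A B w := by
  rw [gammaKernel, norm_mul, norm_mul, Complex.norm_cpow_eq_rpow_re_of_pos h1,
    Complex.norm_cpow_eq_rpow_re_of_pos h2, Complex.norm_real, Real.norm_of_nonneg (Real.exp_pos _).le, gammaKernel,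
    Complex.ofReal_mul, Complex.ofReal_mul, Complex.ofReal_cpow h1.le, Complex.ofReal_cpow h2.le]
  simp

theorem integral_gammaKernel_snd {s : ℂ} (hs : 0 < s.re) (β : ℂ) {A : ℝ} (hA : 0 < A) (B : ℝ) {u : ℝ} (hu : 0 < u) :
    IntegrableOn (fun ξ : ℝ => gammaKernel s β A B (u, ξ)) (Set.Ioi 0) ∧
    ∫ ξ in Set.Ioi (0 : ℝ), gammaKernel s β A B (u, ξ)
      = (A : ℂ) ^ (-s) * Complex.Gamma s * ((u : ℂ) ^ (β - 1) * (Real.exp (-(B * u)) : ℂ)) := by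
  have e : ∀ ξ : ℝ, gammaKernel s β A B (u, ξ) = ((u : ℂ) ^ (s + β - 1) * (Real.exp (-(B * u)) : ℂ)) *
      ((ξ : ℂ) ^ (s - 1) * (Real.exp (-((u * A) * ξ)) : ℂ)) := by
    intro ξ
    simp only [gammaKernel]
    rw [show -(u * B + u * ξ * A) = -(B * u) + -((u * A) * ξ) by ring, Real.exp_add]
    push_cast; ring
  simp only [e]
  refine ⟨(integrableOn_cpow_mul_exp_neg hs (mul_pos hu hA)).const_mul _, ?_⟩
  rw [integral_const_mul, integral_cpow_mul_exp_neg hs (mul_pos hu hA), Complex.ofReal_mul,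
    Complex.mul_cpow_ofReal_nonneg hu.le hA.le]
  have hu' : (u : ℂ) ≠ 0 := by exact_mod_cast hu.ne'
  have : (u : ℂ) ^ (s + β - 1) * (u : ℂ) ^ (-s) = (u : ℂ) ^ (β - 1) := by
    rw [← Complex.cpow_add _ _ hu']; congr 1; ring
  rw [← this]; ring

/-- The opposite order of integration, used to derive the Beta integral. -/
theorem integral_gammaKernel_fst {s β : ℂ} (hsβ : 0 < (s + β).re) {A B : ℝ} (hA : 0 ≤ A) (hB : 0 < B) {ξ : ℝ} (hξ : 0 < ξ) :
    ∫ u in Set.Ioi (0 : ℝ), gammaKernel s β A B (u, ξ)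
      = (ξ : ℂ) ^ (s - 1) * (((B + ξ * A : ℝ) : ℂ) ^ (-(s + β)) * Complex.Gamma (s + β)) := by
  have hr : 0 < B + ξ * A := by positivity
  have e : ∀ u : ℝ, gammaKernel s β A B (u, ξ) = (ξ : ℂ) ^ (s - 1) *
      ((u : ℂ) ^ (s + β - 1) * (Real.exp (-((B + ξ * A) * u)) : ℂ)) := by
    intro u
    simp only [gammaKernel]
    rw [show -(u * B + u * ξ * A) = -((B + ξ * A) * u) by ring]
    ring
  simp only [e]
  rw [integral_const_mul, integral_cpow_mul_exp_neg hsβ hr]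

theorem integrable_gammaKernel {s β : ℂ} (hs : 0 < s.re) (hβ : 0 < β.re) {A B : ℝ} (hA : 0 < A) (hB : 0 < B) :
    Integrable (gammaKernel s β A B) quadrantMeasure := by
  have hmeas : AEStronglyMeasurable (gammaKernel s β A B) quadrantMeasure :=
    ((measurable_gammaKernel s β).comp (measurable_const.prodMk measurable_id :
      Measurable fun w : ℝ × ℝ => ((A, B), w))).aestronglyMeasurable
  rw [integrable_prod_iff hmeas]
  constructor
  · filter_upwards [ae_restrict_mem measurableSet_Ioi] with u hu
    exact (integral_gammaKernel_snd hs β hA B hu).1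
  · have h1 : IntegrableOn (fun u : ℝ => ((A : ℂ) ^ (-(s.re : ℂ)) * Complex.Gamma (s.re : ℂ) *
        ((u : ℂ) ^ ((β.re : ℂ) - 1) * (Real.exp (-(B * u)) : ℂ))).re) (Set.Ioi 0) :=
      ((integrableOn_cpow_mul_exp_neg (s := (β.re : ℂ)) (by simpa using hβ) hB).const_mul _).re
    refine Integrable.congr h1 ?_
    filter_upwards [ae_restrict_mem measurableSet_Ioi] with u hu
    rw [← (integral_gammaKernel_snd (s := (s.re : ℂ)) (by simpa using hs) (β.re : ℂ) hA B hu).2]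
    have : ∫ ξ in Set.Ioi (0 : ℝ), gammaKernel s.re β.re A B (u, ξ) =
        ((∫ ξ in Set.Ioi (0 : ℝ), ‖gammaKernel s β A B (u, ξ)‖ : ℝ) : ℂ) := by
      rw [← integral_complex_ofReal]
      refine setIntegral_congr_fun measurableSet_Ioi fun ξ hξ => ?_
      exact (norm_gammaKernel s β A B (w := (u, ξ)) hu hξ).symm
    rw [this, Complex.ofReal_re]

theorem integral_gammaKernel {s β : ℂ} (hs : 0 < s.re) (hβ : 0 < β.re) {A B : ℝ} (hA : 0 < A) (hB : 0 < B) :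
    ∫ w, gammaKernel s β A B w ∂quadrantMeasure
      = Complex.Gamma s * Complex.Gamma β * ((A : ℂ) ^ (-s) * (B : ℂ) ^ (-β)) := by
  rw [integral_prod _ (integrable_gammaKernel hs hβ hA hB),
    setIntegral_congr_fun measurableSet_Ioi fun u hu => (integral_gammaKernel_snd hs β hA B hu).2,
    integral_const_mul, integral_cpow_mul_exp_neg hβ hB]
  ring

theorem integral_norm_gammaKernel {s β : ℂ} (hs : 0 < s.re) (hβ : 0 < β.re) {A B : ℝ} (hA : 0 < A) (hB : 0 < B) :
    ∫ w, ‖gammaKernel s β A B w‖ ∂quadrantMeasure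
      = Real.Gamma s.re * Real.Gamma β.re * (A ^ (-s.re) * B ^ (-β.re)) := by
  have h := integral_gammaKernel (s := (s.re : ℂ)) (β := (β.re : ℂ)) (by simpa using hs) (by simpa using hβ) hA hB
  rw [integral_congr_ae (quadrantMeasure_ae.mono fun w hw => (norm_gammaKernel s β A B hw.1 hw.2).symm),
    integral_complex_ofReal, Complex.Gamma_ofReal, Complex.Gamma_ofReal] at h
  have h2 : ((A : ℂ) ^ (-(s.re : ℂ)) * (B : ℂ) ^ (-(β.re : ℂ))) = ((A ^ (-s.re) * B ^ (-β.re) : ℝ) : ℂ) := by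
    rw [Complex.ofReal_mul, Complex.ofReal_cpow hA.le, Complex.ofReal_cpow hB.le]
    simp
  rw [h2] at h
  exact_mod_cast h

/-- The second form of the Beta integral. -/
theorem integral_cpow_mul_one_add_cpow {s β : ℂ} (hs : 0 < s.re) (hβ : 0 < β.re) :
    ∫ ξ in Set.Ioi (0 : ℝ), (ξ : ℂ) ^ (s - 1) * ((1 + ξ : ℝ) : ℂ) ^ (-(s + β))
      = Complex.Gamma s * Complex.Gamma β / Complex.Gamma (s + β) := by
  have hsβ : 0 < (s + β).re := by simp; linarith
  -- With `A = B = 1` the two orders of integration give the two sides of the formula.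
  have h := integral_gammaKernel hs hβ one_pos one_pos
  rw [integral_prod_symm _ (integrable_gammaKernel hs hβ one_pos one_pos),
    setIntegral_congr_fun measurableSet_Ioi fun ξ hξ =>
      integral_gammaKernel_fst hsβ zero_le_one one_pos hξ] at h
  simp only [mul_one, Complex.ofReal_one, Complex.one_cpow, ← mul_assoc] at h
  rw [integral_mul_const] at h
  rw [eq_div_iff (Complex.Gamma_ne_zero_of_re_pos hsβ), h]

/-! ### The Riesz potential of a solid harmonic times a power of the norm -/

section RieszMonomial

variable {d : ℕ}

theorem ofReal_norm_sq_cpow_neg (y : EuclideanSpace ℝ (Fin d)) (t : ℝ) :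
    ((‖y‖ ^ 2 : ℝ) : ℂ) ^ (-(t : ℂ)) = ((‖y‖ ^ (-(2 * t)) : ℝ) : ℂ) := by
  rw [← Complex.ofReal_neg, ← Complex.ofReal_cpow (by positivity), ← Real.rpow_natCast, ← Real.rpow_mul (norm_nonneg _)]
  congr 2; push_cast; ring

theorem ae_ne_point (hd : 0 < d) (x : EuclideanSpace ℝ (Fin d)) : ∀ᵐ z : EuclideanSpace ℝ (Fin d), z ≠ x := by
  have := nontrivial_euclideanSpace_of_pos hd
  exact Measure.ae_ne volume x

/-- Completing the square gives a Gaussian of rate `u(1+ξ)` centred at `x/(1+ξ)` and the constant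
`uξ‖x‖²/(1+ξ)`. The mean value property evaluates `V` at the centre, where homogeneity yields
`(1+ξ)^(-l)`. -/
theorem integral_evalAt_mul_exp_quadratic (hd : 0 < d) {l : ℕ} {V : MvPolynomial (Fin d) ℂ}
    (hV : IsSolidHarmonic l V) (x : EuclideanSpace ℝ (Fin d)) {u ξ : ℝ} (hu : 0 < u) (hξ : 0 < ξ) :
    ∫ z : EuclideanSpace ℝ (Fin d), evalAt V z * (Real.exp (-(u * ‖x - z‖ ^ 2 + u * ξ * ‖z‖ ^ 2)) : ℂ)
      = ((Real.pi / (u * (1 + ξ))) ^ ((d : ℝ) / 2) : ℝ) * (((1 + ξ) ^ (-(l : ℝ)) : ℝ) * evalAt V x) *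
        (Real.exp (-((ξ / (1 + ξ) * ‖x‖ ^ 2) * u)) : ℂ) := by
  have h1 : 0 < 1 + ξ := by linarith
  set y : EuclideanSpace ℝ (Fin d) := (1 + ξ)⁻¹ • x with hy
  rw [← integral_add_left_eq_self _ y]
  have e : ∀ h : EuclideanSpace ℝ (Fin d), u * ‖x - (y + h)‖ ^ 2 + u * ξ * ‖y + h‖ ^ 2
      = (u * (1 + ξ)) * ‖h‖ ^ 2 + (ξ / (1 + ξ) * ‖x‖ ^ 2) * u := by
    intro h
    have e1 : x - (y + h) = (ξ / (1 + ξ)) • x - h := by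
      rw [hy, ← sub_sub]
      congr 1
      have : ξ / (1 + ξ) = 1 - (1 + ξ)⁻¹ := by field_simp; ring
      rw [this, sub_smul, one_smul]
    rw [e1, norm_sub_sq_real, norm_add_sq_real, hy, inner_smul_left, inner_smul_left, norm_smul, norm_smul]
    simp only [Real.norm_eq_abs, mul_pow, sq_abs, conj_trivial]
    field_simp
    ring
  have e2 : ∀ h : EuclideanSpace ℝ (Fin d), evalAt V (y + h) *
      (Real.exp (-(u * ‖x - (y + h)‖ ^ 2 + u * ξ * ‖y + h‖ ^ 2)) : ℂ)
      = evalAt V (y + h) * (Real.exp (-(u * (1 + ξ)) * ‖h‖ ^ 2) : ℂ) * (Real.exp (-((ξ / (1 + ξ) * ‖x‖ ^ 2) * u)) : ℂ) := by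
    intro h
    rw [e, neg_add, Real.exp_add, Complex.ofReal_mul, neg_mul]
    ring
  simp only [e2]
  rw [integral_mul_const, integral_evalAt_add_mul_gaussian hd (mul_pos hu h1) l hV, hy, evalAt_smul hV.1]
  congr 3
  rw [Real.rpow_neg h1.le, Real.rpow_natCast]
  push_cast
  rw [inv_pow]

theorem ae_norm_sq_pos_and (hd : 0 < d) (x : EuclideanSpace ℝ (Fin d)) :
    ∀ᵐ z : EuclideanSpace ℝ (Fin d), 0 < ‖z‖ ^ 2 ∧ 0 < ‖x - z‖ ^ 2 := by
  filter_upwards [ae_ne_point hd 0, ae_ne_point hd x] with z h1 h2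
  have : 0 < ‖z‖ := norm_pos_iff.2 h1
  have : 0 < ‖x - z‖ := norm_pos_iff.2 (sub_ne_zero.2 h2.symm)
  constructor <;> positivity

/-- The norm integrated over the quadrant is a constant times the norm of the original integrand, so
the assumed integrability in `z` is exactly what Fubini requires. -/
theorem integrable_evalAt_mul_gammaKernel (hd : 0 < d) (V : MvPolynomial (Fin d) ℂ)
    (x : EuclideanSpace ℝ (Fin d)) {s β : ℂ} (hs : 0 < s.re) (hβ : 0 < β.re)
    (hint : Integrable fun z : EuclideanSpace ℝ (Fin d) =>
      evalAt V z * ((‖z‖ ^ 2 : ℝ) : ℂ) ^ (-s) * ((‖x - z‖ ^ 2 : ℝ) : ℂ) ^ (-β)) :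
    Integrable (Function.uncurry fun (z : EuclideanSpace ℝ (Fin d)) (w : ℝ × ℝ) =>
      evalAt V z * gammaKernel s β (‖z‖ ^ 2) (‖x - z‖ ^ 2) w) (volume.prod quadrantMeasure) := by
  have hmeas : AEStronglyMeasurable (Function.uncurry fun (z : EuclideanSpace ℝ (Fin d)) (w : ℝ × ℝ) =>
      evalAt V z * gammaKernel s β (‖z‖ ^ 2) (‖x - z‖ ^ 2) w) (volume.prod quadrantMeasure) := by
    refine Measurable.aestronglyMeasurable ?_
    have h1 : Measurable fun p : EuclideanSpace ℝ (Fin d) × (ℝ × ℝ) => evalAt V p.1 :=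
      (continuous_evalAt V).measurable.comp measurable_fst
    have h3 : Measurable fun p : EuclideanSpace ℝ (Fin d) × (ℝ × ℝ) =>
        gammaKernel s β (‖p.1‖ ^ 2) (‖x - p.1‖ ^ 2) p.2 := by
      unfold gammaKernel
      fun_prop
    simp only [Function.uncurry_def]
    exact h1.mul h3
  refine (integrable_prod_iff hmeas).2 ⟨?_, ?_⟩
  · filter_upwards [ae_norm_sq_pos_and hd x] with z hz
    exact Integrable.const_mul (integrable_gammaKernel hs hβ hz.1 hz.2) (evalAt V z)
  · refine (hint.norm.const_mul (Real.Gamma s.re * Real.Gamma β.re)).congr ?_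
    filter_upwards [ae_norm_sq_pos_and hd x] with z hz
    simp only [Function.uncurry_apply_pair, norm_mul]
    rw [integral_const_mul, integral_norm_gammaKernel hs hβ hz.1 hz.2,
      Complex.norm_cpow_eq_rpow_re_of_pos hz.1, Complex.norm_cpow_eq_rpow_re_of_pos hz.2]
    simp only [Complex.neg_re]
    ring

-- Both factors `‖z‖^(-2s)` and `‖x-z‖^(α-d)` are produced by `gammaKernel` with `β = (d-α)/2`, and
-- the `z`-integral is done first. Collecting exponents, the `u`-integral becomes a Gamma integral
-- at `s - α/2` and the `ξ`-integral a Beta integral with arguments `α/2` and `d/2 + l - s`. The two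
-- conditions on `Re s` are those for convergence of these two integrals.
set_option maxHeartbeats 800000 in
theorem integral_evalAt_mul_cpow_mul_rpow {l : ℕ} {α : ℝ} (hα : 0 < α) (hαd : α < d)
    {V : MvPolynomial (Fin d) ℂ} (hV : IsSolidHarmonic l V) {x : EuclideanSpace ℝ (Fin d)} (hx : x ≠ 0)
    {s : ℂ} (hs1 : α / 2 < s.re) (hs2 : s.re < d / 2 + l)
    (hint : Integrable fun z : EuclideanSpace ℝ (Fin d) =>
      evalAt V z * ((‖z‖ ^ 2 : ℝ) : ℂ) ^ (-s) * ((‖x - z‖ ^ (α - d) : ℝ) : ℂ)) :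
    ∫ z : EuclideanSpace ℝ (Fin d), evalAt V z * ((‖z‖ ^ 2 : ℝ) : ℂ) ^ (-s) * ((‖x - z‖ ^ (α - d) : ℝ) : ℂ)
      = (Real.pi ^ ((d : ℝ) / 2) : ℝ) * evalAt V x *
        ((Complex.Gamma (s - α / 2) * Complex.Gamma (d / 2 + l - s) * Complex.Gamma (α / 2)) /
          (Complex.Gamma s * Complex.Gamma ((d - α) / 2) * Complex.Gamma (α / 2 + (d / 2 + l - s)))) *
        ((‖x‖ ^ 2 : ℝ) : ℂ) ^ (α / 2 - s) := by
  have hd : 0 < d := by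
    have : (0 : ℝ) < d := hα.trans hαd
    exact_mod_cast this
  obtain ⟨β, hβdef⟩ : ∃ β : ℂ, β = ((((d : ℝ) - α) / 2 : ℝ) : ℂ) := ⟨_, rfl⟩
  have hβ : 0 < β.re := by rw [hβdef, Complex.ofReal_re]; linarith
  have hs : 0 < s.re := by linarith
  have hBβ : ∀ z : EuclideanSpace ℝ (Fin d), ((‖x - z‖ ^ 2 : ℝ) : ℂ) ^ (-β) = ((‖x - z‖ ^ (α - d) : ℝ) : ℂ) := by
    intro z
    rw [hβdef, ofReal_norm_sq_cpow_neg]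
    congr 2; ring
  have hpos := ae_norm_sq_pos_and hd x
  have hΦint := integrable_evalAt_mul_gammaKernel hd V x hs hβ (hint.congr (Eventually.of_forall fun z => by
    simp only [hBβ]))
  set Φ : EuclideanSpace ℝ (Fin d) → ℝ × ℝ → ℂ := fun z w =>
    evalAt V z * gammaKernel s β (‖z‖ ^ 2) (‖x - z‖ ^ 2) w with hΦ
  have hswap := integral_integral_swap hΦint
  have hL : ∫ z, ∫ w, Φ z w ∂quadrantMeasure = Complex.Gamma s * Complex.Gamma β *
      ∫ z : EuclideanSpace ℝ (Fin d), evalAt V z * ((‖z‖ ^ 2 : ℝ) : ℂ) ^ (-s) * ((‖x - z‖ ^ (α - d) : ℝ) : ℂ) := by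
    rw [← integral_const_mul]
    refine integral_congr_ae ?_
    filter_upwards [hpos] with z hz
    simp only [hΦ]
    rw [integral_const_mul, integral_gammaKernel hs hβ hz.1 hz.2, hBβ]
    ring
  have hR0 : Integrable (fun w => ∫ z, Φ z w) quadrantMeasure := hΦint.integral_prod_right
  set K : ℂ := (Real.pi ^ ((d : ℝ) / 2) : ℝ) * evalAt V x with hK
  have hzint : ∀ u ξ : ℝ, 0 < u → 0 < ξ → ∫ z, Φ z (u, ξ) =
      (K * ((ξ : ℂ) ^ (s - 1) * ((1 + ξ : ℝ) : ℂ) ^ (-(d / 2 + l : ℂ)))) *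
        ((u : ℂ) ^ (s - α / 2 - 1) * (Real.exp (-((ξ / (1 + ξ) * ‖x‖ ^ 2) * u)) : ℂ)) := by
    intro u ξ hu hξ
    have h1 : 0 < 1 + ξ := by linarith
    have e : ∀ z, Φ z (u, ξ) = ((u : ℂ) ^ (s + β - 1) * (ξ : ℂ) ^ (s - 1)) *
        (evalAt V z * (Real.exp (-(u * ‖x - z‖ ^ 2 + u * ξ * ‖z‖ ^ 2)) : ℂ)) := by
      intro z; simp only [hΦ, gammaKernel]; ring
    simp only [e]
    rw [integral_const_mul, integral_evalAt_mul_exp_quadratic hd hV x hu hξ]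
    have e2 : (((Real.pi / (u * (1 + ξ))) ^ ((d : ℝ) / 2) : ℝ) : ℂ) =
        (Real.pi ^ ((d : ℝ) / 2) : ℝ) * (u : ℂ) ^ (-(d / 2 : ℂ)) * ((1 + ξ : ℝ) : ℂ) ^ (-(d / 2 : ℂ)) := by
      rw [Real.div_rpow Real.pi_pos.le (by positivity), Real.mul_rpow hu.le h1.le, div_eq_mul_inv, mul_inv,
        ← Real.rpow_neg hu.le, ← Real.rpow_neg h1.le, Complex.ofReal_mul, Complex.ofReal_mul,
        Complex.ofReal_cpow hu.le, Complex.ofReal_cpow h1.le]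
      push_cast; ring
    have e3 : (((1 + ξ) ^ (-(l : ℝ)) : ℝ) : ℂ) = ((1 + ξ : ℝ) : ℂ) ^ (-(l : ℂ)) := by
      rw [Complex.ofReal_cpow h1.le]; push_cast; rfl
    have hu' : (u : ℂ) ≠ 0 := by exact_mod_cast hu.ne'
    have h1' : ((1 + ξ : ℝ) : ℂ) ≠ 0 := by exact_mod_cast h1.ne'
    have e4 : (u : ℂ) ^ (s + β - 1) * (u : ℂ) ^ (-(d / 2 : ℂ)) = (u : ℂ) ^ (s - α / 2 - 1) := by
      rw [← Complex.cpow_add _ _ hu']; congr 1; rw [hβdef]; push_cast; ring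
    have e5 : ((1 + ξ : ℝ) : ℂ) ^ (-(d / 2 : ℂ)) * ((1 + ξ : ℝ) : ℂ) ^ (-(l : ℂ))
        = ((1 + ξ : ℝ) : ℂ) ^ (-(d / 2 + l : ℂ)) := by
      rw [← Complex.cpow_add _ _ h1']; congr 1; ring
    rw [e2, e3, ← e4, ← e5, hK]
    ring
  have hs' : 0 < (s - α / 2).re := by simp; linarith
  have hα' : 0 < ((α : ℂ) / 2).re := by simp; linarith
  have hc' : 0 < ((d : ℂ) / 2 + l - s).re := by simp; linarith
  have hxn : 0 < ‖x‖ ^ 2 := by have := norm_pos_iff.2 hx; positivity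
  have hR : ∫ w, (∫ z, Φ z w) ∂quadrantMeasure = K * Complex.Gamma (s - α / 2) * ((‖x‖ ^ 2 : ℝ) : ℂ) ^ (α / 2 - s) *
      (Complex.Gamma (α / 2) * Complex.Gamma (d / 2 + l - s) / Complex.Gamma (α / 2 + (d / 2 + l - s))) := by
    rw [← integral_cpow_mul_one_add_cpow hα' hc', ← integral_const_mul, integral_prod_symm _ hR0]
    refine setIntegral_congr_fun measurableSet_Ioi fun ξ (hξ : 0 < ξ) => ?_
    have h1 : 0 < 1 + ξ := by linarith
    have hfr : 0 < ξ / (1 + ξ) := by positivity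
    rw [setIntegral_congr_fun measurableSet_Ioi fun u hu => hzint u ξ hu hξ, integral_const_mul,
      integral_cpow_mul_exp_neg hs' (mul_pos hfr hxn), Complex.ofReal_mul,
      Complex.mul_cpow_ofReal_nonneg hfr.le hxn.le, show ξ / (1 + ξ) = ξ * (1 + ξ)⁻¹ from div_eq_mul_inv _ _,
      Complex.ofReal_mul ξ, Complex.mul_cpow_ofReal_nonneg hξ.le (inv_nonneg.2 h1.le), Complex.ofReal_inv,
      Complex.inv_cpow _ _ (by rw [Complex.arg_ofReal_of_nonneg h1.le]; exact Real.pi_ne_zero.symm),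
      ← Complex.cpow_neg, neg_neg, neg_sub]
    have hξ' : (ξ : ℂ) ≠ 0 := by exact_mod_cast hξ.ne'
    have h1' : ((1 + ξ : ℝ) : ℂ) ≠ 0 := by exact_mod_cast h1.ne'
    have e4 : (ξ : ℂ) ^ (s - 1) * (ξ : ℂ) ^ (α / 2 - s) = (ξ : ℂ) ^ ((α : ℂ) / 2 - 1) := by
      rw [← Complex.cpow_add _ _ hξ']; congr 1; ring
    have e5 : ((1 + ξ : ℝ) : ℂ) ^ (-(d / 2 + l : ℂ)) * ((1 + ξ : ℝ) : ℂ) ^ (s - α / 2)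
        = ((1 + ξ : ℝ) : ℂ) ^ (-((α : ℂ) / 2 + (d / 2 + l - s))) := by
      rw [← Complex.cpow_add _ _ h1']; congr 1; ring
    rw [← e4, ← e5]
    ring
  rw [hL, hR] at hswap
  have hG1 : Complex.Gamma s ≠ 0 := Complex.Gamma_ne_zero_of_re_pos hs
  have hG2 : Complex.Gamma β ≠ 0 := Complex.Gamma_ne_zero_of_re_pos hβ
  have hβ' : β = ((d : ℂ) - α) / 2 := by rw [hβdef]; push_cast; ring
  rw [← hβ']
  refine mul_left_cancel₀ (mul_ne_zero hG1 hG2) (hswap.trans ?_)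
  field_simp

end RieszMonomial

/-! ### Integrability of Riesz kernels against weights singular on the unit sphere -/

/-- Both bases may be replaced by the smaller one. The case `u = 0` is separate because a negative
power of 0 is 0 by convention. -/
theorem rpow_neg_mul_rpow_neg_le {u v s t : ℝ} (hu : 0 ≤ u) (hv : 0 < v) (hs : 0 ≤ s)
    (ht : 0 ≤ t) : u ^ (-s) * v ^ (-t) ≤ u ^ (-(s + t)) + v ^ (-(s + t)) := by
  have hv0 : 0 ≤ v ^ (-(s + t)) := Real.rpow_nonneg hv.le _
  have hu0 : 0 ≤ u ^ (-(s + t)) := Real.rpow_nonneg hu _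
  rcases hu.eq_or_lt with rfl | hu'
  · rcases hs.eq_or_lt with rfl | hs'
    · simp only [neg_zero, Real.rpow_zero, zero_add, one_mul]
      rw [zero_add] at hu0
      linarith
    · rw [Real.zero_rpow (by linarith), zero_mul]
      linarith
  rcases le_total u v with h | h
  · have : v ^ (-t) ≤ u ^ (-t) := Real.rpow_le_rpow_of_nonpos hu' h (by linarith)
    calc u ^ (-s) * v ^ (-t) ≤ u ^ (-s) * u ^ (-t) := by gcongr
      _ = u ^ (-(s + t)) := by rw [← Real.rpow_add hu']; ring_nf
      _ ≤ _ := by linarith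
  · have : u ^ (-s) ≤ v ^ (-s) := Real.rpow_le_rpow_of_nonpos hv h (by linarith)
    calc u ^ (-s) * v ^ (-t) ≤ v ^ (-s) * v ^ (-t) := by gcongr
      _ = v ^ (-(s + t)) := by rw [← Real.rpow_add hv]; ring_nf
      _ ≤ _ := by linarith

/-- The function `‖u‖^{-γ}` cut off outside the unit ball. -/
def cutRpow {F : Type*} [NormedAddCommGroup F] (γ : ℝ) (u : F) : ℝ :=
  (Metric.ball (0 : F) 1).indicator (fun u => ‖u‖ ^ (-γ)) u

theorem cutRpow_nonneg {F : Type*} [NormedAddCommGroup F] (γ : ℝ) (u : F) : 0 ≤ cutRpow γ u :=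
  Set.indicator_nonneg (fun _ _ => Real.rpow_nonneg (norm_nonneg _) _) _

theorem cutRpow_of_lt {F : Type*} [NormedAddCommGroup F] (γ : ℝ) {u : F} (hu : ‖u‖ < 1) :
    cutRpow γ u = ‖u‖ ^ (-γ) :=
  Set.indicator_of_mem (by simpa using hu) _

theorem rpow_neg_le_cutRpow_add_one {F : Type*} [NormedAddCommGroup F] {γ : ℝ} (hγ : 0 ≤ γ)
    (u : F) : ‖u‖ ^ (-γ) ≤ cutRpow γ u + 1 := by
  rcases lt_or_ge ‖u‖ 1 with h | h
  · rw [cutRpow_of_lt γ h]; linarith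
  · have := Real.rpow_le_one_of_one_le_of_nonpos h (by linarith : -γ ≤ 0)
    linarith [cutRpow_nonneg γ u]

theorem measurable_cutRpow {F : Type*} [NormedAddCommGroup F] [MeasurableSpace F] [BorelSpace F]
    (γ : ℝ) : Measurable (cutRpow γ : F → ℝ) :=
  (measurable_norm.pow_const _).indicator measurableSet_ball

theorem integrable_cutRpow {F : Type*} [NormedAddCommGroup F] [NormedSpace ℝ F]
    [FiniteDimensional ℝ F] [MeasurableSpace F] [BorelSpace F] (μ : Measure F)
    [μ.IsAddHaarMeasure] {γ : ℝ} (hF : 0 < Module.finrank ℝ F) (hγ : γ < Module.finrank ℝ F) :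
    Integrable (cutRpow γ : F → ℝ) μ := by
  refine IntegrableOn.integrable_indicator ?_ measurableSet_ball
  refine integrableOn_ball_of_norm_le_rpow (C := 1) (α := γ) hF hγ (ae_of_all _ fun u => ?_)
    (measurable_norm.pow_const _).aestronglyMeasurable
  rw [Real.norm_of_nonneg (Real.rpow_nonneg (norm_nonneg _) _), one_mul]

theorem integrable_cutRpow_sub {F : Type*} [NormedAddCommGroup F] [NormedSpace ℝ F]
    [FiniteDimensional ℝ F] [MeasurableSpace F] [BorelSpace F] (μ : Measure F)
    [μ.IsAddHaarMeasure] {γ : ℝ} (hF : 0 < Module.finrank ℝ F) (hγ : γ < Module.finrank ℝ F)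
    (x : F) : Integrable (fun u => cutRpow γ (u - x)) μ :=
  (integrable_cutRpow μ hF hγ).comp_sub_right x

/-- The conditions force `A` and `B` to be positive. Near `0` and near `x` one factor is bounded and
the other locally integrable; elsewhere the product is at most a multiple of `(1+‖z‖)^(-(A+B))`,
integrable because `A + B` exceeds the dimension. -/
theorem integrable_norm_rpow_mul_norm_sub_rpow {F : Type*} [NormedAddCommGroup F]
    [NormedSpace ℝ F] [FiniteDimensional ℝ F] [MeasurableSpace F] [BorelSpace F] (μ : Measure F)
    [μ.IsAddHaarMeasure] (hF : 0 < Module.finrank ℝ F) {A B : ℝ}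
    (hA : A < Module.finrank ℝ F) (hB : B < Module.finrank ℝ F)
    (hAB : Module.finrank ℝ F < A + B) {x : F} (hx : x ≠ 0) :
    Integrable (fun z => ‖z‖ ^ (-A) * ‖x - z‖ ^ (-B)) μ := by
  obtain ⟨R, hR0, hR1, hRx⟩ : ∃ R : ℝ, 0 < R ∧ R ≤ 1 ∧ 2 * R ≤ ‖x‖ := by
    have := norm_pos_iff.2 hx
    exact ⟨min 1 (‖x‖ / 2), by positivity, min_le_left _ _, by
      linarith [min_le_right 1 (‖x‖ / 2)]⟩
  -- Chosen so that `1 + ‖z‖` is at most `K‖z‖` and at most `K‖x-z‖` as soon as `‖z‖` and `‖x-z‖`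
  -- are at least `R`.
  set K : ℝ := 1 / R + 1 + ‖x‖ / R with hK
  have hK0 : 0 < K := by positivity
  have hdom : Integrable (fun z => R ^ (-B) * cutRpow A z + R ^ (-A) * cutRpow B (z - x)
      + K ^ (A + B) * (1 + ‖z‖) ^ (-(A + B))) μ :=
    (((integrable_cutRpow μ hF hA).const_mul _).add
      ((integrable_cutRpow_sub μ hF hB x).const_mul _)).add
      ((integrable_one_add_norm hAB).const_mul _)
  refine hdom.mono' ?_ (ae_of_all _ fun z => ?_)
  · exact ((measurable_norm.pow_const _).mul
      ((measurable_const.sub measurable_id).norm.pow_const _)).aestronglyMeasurable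
  rw [Real.norm_of_nonneg (by positivity)]
  have h1 : 0 ≤ R ^ (-B) * cutRpow A z := mul_nonneg (by positivity) (cutRpow_nonneg _ _)
  have h2 : 0 ≤ R ^ (-A) * cutRpow B (z - x) := mul_nonneg (by positivity) (cutRpow_nonneg _ _)
  have h3 : 0 ≤ K ^ (A + B) * (1 + ‖z‖) ^ (-(A + B)) := by positivity
  have htri : ‖x‖ ≤ ‖z‖ + ‖x - z‖ := by simpa using norm_add_le z (x - z)
  have htri' : ‖z‖ ≤ ‖x‖ + ‖x - z‖ := by
    have := norm_sub_le x (x - z); simpa using this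
  by_cases hz : ‖z‖ < R
  · rw [cutRpow_of_lt A (hz.trans_le hR1)] at h1 ⊢
    have : ‖x - z‖ ^ (-B) ≤ R ^ (-B) :=
      Real.rpow_le_rpow_of_nonpos hR0 (by linarith) (by linarith)
    have := mul_le_mul_of_nonneg_left this (Real.rpow_nonneg (norm_nonneg z) (-A))
    linarith
  by_cases hzx : ‖x - z‖ < R
  · have hc : cutRpow B (z - x) = ‖x - z‖ ^ (-B) := by
      rw [cutRpow_of_lt B (by rw [norm_sub_rev]; exact hzx.trans_le hR1), norm_sub_rev]
    rw [hc] at h2 ⊢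
    have : ‖z‖ ^ (-A) ≤ R ^ (-A) :=
      Real.rpow_le_rpow_of_nonpos hR0 (by linarith) (by linarith)
    have := mul_le_mul_of_nonneg_right this (Real.rpow_nonneg (norm_nonneg (x - z)) (-B))
    linarith
  push Not at hz hzx
  have hA' : (1 + ‖z‖) / K ≤ ‖z‖ := by
    rw [div_le_iff₀ hK0, hK]
    have : 1 ≤ ‖z‖ * (1 / R) := by rw [mul_one_div, le_div_iff₀ hR0]; linarith
    have : 0 ≤ ‖z‖ * (‖x‖ / R) := by positivity
    nlinarith
  have hB' : (1 + ‖z‖) / K ≤ ‖x - z‖ := by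
    rw [div_le_iff₀ hK0, hK]
    have h1 : 1 ≤ ‖x - z‖ * (1 / R) := by rw [mul_one_div, le_div_iff₀ hR0]; linarith
    have h2 : ‖x‖ ≤ ‖x - z‖ * (‖x‖ / R) := by
      rw [mul_div_assoc', le_div_iff₀ hR0]; nlinarith [norm_nonneg x]
    nlinarith
  have hq : 0 < (1 + ‖z‖) / K := by positivity
  have hfin : ‖z‖ ^ (-A) * ‖x - z‖ ^ (-B) ≤ K ^ (A + B) * (1 + ‖z‖) ^ (-(A + B)) := by
    calc ‖z‖ ^ (-A) * ‖x - z‖ ^ (-B)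
        ≤ ((1 + ‖z‖) / K) ^ (-A) * ((1 + ‖z‖) / K) ^ (-B) :=
          mul_le_mul (Real.rpow_le_rpow_of_nonpos hq hA' (by linarith))
            (Real.rpow_le_rpow_of_nonpos hq hB' (by linarith)) (by positivity) (by positivity)
      _ = K ^ (A + B) * (1 + ‖z‖) ^ (-(A + B)) := by
          rw [← Real.rpow_add hq, ← neg_add, Real.div_rpow (by positivity) hK0.le,
            Real.rpow_neg hK0.le, div_inv_eq_mul, mul_comm]
  linarith

/-- The fibres of the sphere singularity along one coordinate. -/
theorem integrable_prod_cutRpow {n : ℕ} {γ B : ℝ} (hγ : γ < 1) (hB : B < n ∨ n = 0)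
    {κ : (Fin n → ℝ) → ℝ} (hκ : Measurable κ) (x' : Fin n → ℝ) :
    Integrable (fun w : ℝ × (Fin n → ℝ) => cutRpow γ (w.1 - κ w.2) * cutRpow B (w.2 - x')) := by
  have h1 : Integrable (cutRpow γ : ℝ → ℝ) := integrable_cutRpow volume (by simp) (by simpa)
  have hP : Integrable (fun y : Fin n → ℝ => cutRpow B (y - x')) := by
    rcases Nat.eq_zero_or_pos n with rfl | hn
    · exact Integrable.of_finite
    · exact integrable_cutRpow_sub volume (by simpa) (by
        rcases hB with h | h
        · simpa
        · omega) x'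
  have hmeas : Measurable
      (fun w : ℝ × (Fin n → ℝ) => cutRpow γ (w.1 - κ w.2) * cutRpow B (w.2 - x')) :=
    ((measurable_cutRpow γ).comp (measurable_fst.sub (hκ.comp measurable_snd))).mul
      ((measurable_cutRpow B).comp (measurable_snd.sub_const x'))
  rw [Measure.volume_eq_prod, integrable_prod_iff' hmeas.aestronglyMeasurable]
  refine ⟨ae_of_all _ fun y => ?_, ?_⟩
  · exact (h1.comp_sub_right (κ y)).mul_const (cutRpow B (y - x'))
  have : (fun y : Fin n → ℝ => ∫ t : ℝ, ‖cutRpow γ (t - κ y) * cutRpow B (y - x')‖)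
      = fun y => (∫ t : ℝ, cutRpow γ t) * cutRpow B (y - x') := by
    ext y
    rw [← integral_sub_right_eq_self (fun t : ℝ => cutRpow γ t) (κ y), ← integral_mul_const]
    refine integral_congr_ae (ae_of_all _ fun t => ?_)
    exact Real.norm_of_nonneg (mul_nonneg (cutRpow_nonneg _ _) (cutRpow_nonneg _ _))
  simp only [this]
  exact hP.const_mul _

/-- Up to a positive factor, the distance of `t` to a point determined by `K` is at most the
defect `|K - t²|`, as long as `t` stays away from `0` with a fixed sign. -/
theorem mul_abs_sub_sign_mul_sqrt_le {x t K m : ℝ} (ht : m ≤ |t|) (hxt : 0 < x * t) :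
    m * |t - SignType.sign x * √K| ≤ |K - t ^ 2| := by
  rcases le_total 0 K with hK | hK
  · have hs : (√K) ^ 2 = K := Real.sq_sqrt hK
    have h0 := Real.sqrt_nonneg K
    rcases pos_and_pos_or_neg_and_neg_of_mul_pos hxt with ⟨h1, h2⟩ | ⟨h1, h2⟩
    · rw [sign_pos h1]
      rw [abs_of_pos h2] at ht
      have : K - t ^ 2 = -((t - √K) * (t + √K)) := by linear_combination -hs
      rw [this, abs_neg, abs_mul, abs_of_pos (by linarith : 0 < t + √K), mul_comm]
      simp only [SignType.coe_one, one_mul]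
      gcongr
      linarith
    · rw [sign_neg h1]
      rw [abs_of_neg h2] at ht
      have : K - t ^ 2 = (t + √K) * (√K - t) := by linear_combination -hs
      rw [this, abs_mul, abs_of_pos (by linarith : 0 < √K - t), mul_comm]
      simp only [SignType.coe_neg_one, neg_mul, one_mul, sub_neg_eq_add]
      gcongr
      linarith
  · rw [Real.sqrt_eq_zero_of_nonpos hK, mul_zero, sub_zero,
      abs_of_nonpos (a := K - t ^ 2) (by nlinarith [sq_nonneg t])]
    calc m * |t| ≤ |t| * |t| := by gcongr
      _ = t ^ 2 := by rw [abs_mul_abs_self, sq]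
      _ ≤ _ := by linarith

theorem EuclideanSpace.norm_sq_eq_succAbove {n : ℕ} (z : EuclideanSpace ℝ (Fin (n + 1)))
    (i : Fin (n + 1)) : ‖z‖ ^ 2 = z i ^ 2 + ∑ j, z (i.succAbove j) ^ 2 := by
  rw [EuclideanSpace.real_norm_sq_eq, Fin.sum_univ_succAbove _ i]

theorem EuclideanSpace.norm_removeNth_le {n : ℕ} (z : EuclideanSpace ℝ (Fin (n + 1)))
    (i : Fin (n + 1)) : ‖(fun j => z (i.succAbove j) : Fin n → ℝ)‖ ≤ ‖z‖ :=
  (pi_norm_le_iff_of_nonneg (norm_nonneg _)).2 fun _ => PiLp.norm_apply_le z _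

/-- Near a point of the unit sphere, the weight `|1 - ‖z‖|^{-θ} ‖x - z‖^{-B}` is dominated in
coordinates adapted to the point by products of one-dimensional and transversal singularities. -/
theorem abs_one_sub_norm_rpow_mul_le {n : ℕ} {x z : EuclideanSpace ℝ (Fin (n + 1))}
    {i : Fin (n + 1)} {θ A B : ℝ} (hθ : 0 ≤ θ) (hA : 0 ≤ A) (hB : 0 ≤ B) (hx : ‖x‖ = 1)
    (hxi : x i ≠ 0) (hz : ‖x - z‖ < |x i| / 2) (hzi : z i ≠ x i)
    (hzj : 0 < ‖(fun j => z (i.succAbove j) - x (i.succAbove j) : Fin n → ℝ)‖ ∨ B = 0) :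
    |1 - ‖z‖| ^ (-θ) * ‖x - z‖ ^ (-(A + B)) ≤ (|x i| / 6) ^ (-θ) *
      ((cutRpow (θ + A) (z i - SignType.sign (x i) * √(1 - ∑ j, z (i.succAbove j) ^ 2)) + 1
        + cutRpow (θ + A) (z i - x i)) *
        cutRpow B (fun j => z (i.succAbove j) - x (i.succAbove j) : Fin n → ℝ)) := by
  set κ := SignType.sign (x i) * √(1 - ∑ j, z (i.succAbove j) ^ 2) with hκ
  set h' := (fun j => z (i.succAbove j) - x (i.succAbove j) : Fin n → ℝ) with hh'
  have hm : 0 < |x i| := abs_pos.2 hxi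
  have hm1 : |x i| ≤ 1 := by rw [← hx, ← Real.norm_eq_abs]; exact PiLp.norm_apply_le x i
  have hi : |z i - x i| ≤ ‖x - z‖ := by
    have := PiLp.norm_apply_le (x - z) i
    rwa [PiLp.sub_apply, Real.norm_eq_abs, abs_sub_comm] at this
  have hh'le : ‖h'‖ ≤ ‖x - z‖ := by
    have := EuclideanSpace.norm_removeNth_le (z - x) i
    rwa [norm_sub_rev z x] at this
  have hxz0 : 0 < ‖x - z‖ := lt_of_lt_of_le (abs_pos.2 (sub_ne_zero.2 hzi)) hi
  have hzn : ‖z‖ ≤ 2 := by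
    have h1 : ‖z‖ ≤ ‖x‖ + ‖x - z‖ := by simpa using norm_sub_le x (x - z)
    linarith
  have htx : |x i| / 2 ≤ |z i| := by
    have := abs_sub_abs_le_abs_sub (x i) (z i)
    rw [abs_sub_comm] at this
    linarith
  have hsgn : 0 < x i * z i := by
    have h1 := (abs_lt.1 (hi.trans_lt hz))
    rcases lt_or_gt_of_ne hxi with h | h
    · rw [abs_of_neg h] at h1; nlinarith
    · rw [abs_of_pos h] at h1; nlinarith
  have hkey := mul_abs_sub_sign_mul_sqrt_le (K := 1 - ∑ j, z (i.succAbove j) ^ 2)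
    htx hsgn
  rw [← hκ] at hkey
  have hK : 1 - ∑ j, z (i.succAbove j) ^ 2 - z i ^ 2 = (1 - ‖z‖) * (1 + ‖z‖) := by
    have := EuclideanSpace.norm_sq_eq_succAbove z i
    linear_combination this
  rw [hK, abs_mul, abs_of_nonneg (by positivity : 0 ≤ 1 + ‖z‖)] at hkey
  -- The 6 is `2 · 3`: `|z_i|` is at least `|x_i|/2`, and `1 + ‖z‖ ≤ 3`.
  have hdist : |x i| / 6 * |z i - κ| ≤ |1 - ‖z‖| := by
    nlinarith [abs_nonneg (1 - ‖z‖)]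
  have h1 : |1 - ‖z‖| ^ (-θ) ≤ (|x i| / 6) ^ (-θ) * |z i - κ| ^ (-θ) := by
    rw [← Real.mul_rpow (by positivity) (abs_nonneg _)]
    -- On the sphere itself real powers take conventional values, so it must be checked that `|z_i -
    -- κ| = 0` forces `‖z‖ = 1`; both sides then agree.
    rcases (abs_nonneg (z i - κ)).eq_or_lt with h0 | h0
    · have hz1 : |1 - ‖z‖| = 0 := by
        have hzκ : z i = κ := by
          have := abs_eq_zero.1 h0.symm; linarith
        have hsq : 0 ≤ 1 - ∑ j, z (i.succAbove j) ^ 2 := by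
          by_contra! hneg
          rw [hκ, Real.sqrt_eq_zero_of_nonpos hneg.le, mul_zero] at hzκ
          rw [hzκ, mul_zero] at hsgn
          exact hsgn.false
        have h2 : z i ^ 2 = 1 - ∑ j, z (i.succAbove j) ^ 2 := by
          rw [hzκ, hκ, mul_pow, Real.sq_sqrt hsq]
          rcases lt_or_gt_of_ne hxi with h | h
          · simp [sign_neg h]
          · simp [sign_pos h]
        have h3 : (1 - ‖z‖) * (1 + ‖z‖) = 0 := by rw [← hK, h2]; ring
        rcases mul_eq_zero.1 h3 with h | h
        · rw [h, abs_zero]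
        · have := norm_nonneg z; linarith
      rw [← h0, hz1, mul_zero]
    · exact Real.rpow_le_rpow_of_nonpos (by positivity) hdist (by linarith)
  have h2 : ‖x - z‖ ^ (-(A + B)) ≤ |z i - x i| ^ (-A) * ‖h'‖ ^ (-B) := by
    rw [neg_add, Real.rpow_add hxz0]
    refine mul_le_mul (Real.rpow_le_rpow_of_nonpos (abs_pos.2 (sub_ne_zero.2 hzi)) hi
      (by linarith)) ?_ (by positivity) (by positivity)
    rcases hzj with h | rfl
    · exact Real.rpow_le_rpow_of_nonpos h hh'le (by linarith)
    · simp
  have h3 := rpow_neg_mul_rpow_neg_le (abs_nonneg (z i - κ)) (abs_pos.2 (sub_ne_zero.2 hzi)) hθ hA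
  have h4 := rpow_neg_le_cutRpow_add_one (add_nonneg hθ hA) (z i - κ)
  rw [Real.norm_eq_abs] at h4
  rw [cutRpow_of_lt B (u := h') (by linarith), cutRpow_of_lt (θ + A) (u := z i - x i)
    (by rw [Real.norm_eq_abs]; linarith), Real.norm_eq_abs]
  calc |1 - ‖z‖| ^ (-θ) * ‖x - z‖ ^ (-(A + B))
      ≤ ((|x i| / 6) ^ (-θ) * |z i - κ| ^ (-θ)) * (|z i - x i| ^ (-A) * ‖h'‖ ^ (-B)) :=
        mul_le_mul h1 h2 (by positivity) (by positivity)
    _ = (|x i| / 6) ^ (-θ) * ((|z i - κ| ^ (-θ) * |z i - x i| ^ (-A)) * ‖h'‖ ^ (-B)) := by ring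
    _ ≤ _ := by gcongr; linarith

theorem ae_forall_apply_ne {ι : Type*} [Fintype ι] (x : EuclideanSpace ℝ ι) :
    ∀ᵐ z : EuclideanSpace ℝ ι, ∀ j, z j ≠ x j :=
  ae_all_iff.2 fun j => (PiLp.volume_preserving_ofLp ι).quasiMeasurePreserving.ae
    (Measure.ae_eval_ne (fun _ => volume) j (x j))

/-- In a coordinate direction `i` with `x_i ≠ 0`, the sphere near `x` is a graph over the other `n`
coordinates. The kernel exponent is split into a part `A'` for the direction `i`, competing with `θ`
for the one-dimensional bound 1, and a transversal part `B'` with bound `n`. -/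
theorem exists_integrableOn_ball_sphere {n : ℕ} {x : EuclideanSpace ℝ (Fin (n + 1))} (hx : ‖x‖ = 1)
    {θ B : ℝ} (hθ : 0 ≤ θ) (hθ1 : θ < 1) (hθB : θ < n + 1 - B) :
    ∃ ρ, 0 < ρ ∧ ρ < 1 ∧
      IntegrableOn (fun z => |1 - ‖z‖| ^ (-θ) * ‖x - z‖ ^ (-B)) (Metric.ball x ρ) := by
  obtain ⟨i, hi⟩ : ∃ i, x i ≠ 0 := by
    by_contra! h
    have : x = 0 := by ext j; simpa using h j
    rw [this, norm_zero] at hx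
    exact zero_ne_one hx
  have hm : 0 < |x i| := abs_pos.2 hi
  have hm1 : |x i| ≤ 1 := by rw [← hx, ← Real.norm_eq_abs]; exact PiLp.norm_apply_le x i
  refine ⟨|x i| / 2, by positivity, by linarith, ?_⟩
  -- The strict inequality `θ + B < n + 1` leaves room for the split, with `ε` at most half the
  -- slack. If `n = 0` there are no transversal coordinates and everything goes into `A'`.
  obtain ⟨A', B', hA', hB', hBn, hγ, hAB⟩ : ∃ A' B' : ℝ, 0 ≤ A' ∧ 0 ≤ B' ∧
      (B' < n ∧ 0 < n ∨ n = 0 ∧ B' = 0) ∧ θ + A' < 1 ∧ B ≤ A' + B' := by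
    rcases Nat.eq_zero_or_pos n with rfl | hn
    · refine ⟨max B 0, 0, le_max_right _ _, le_rfl, Or.inr ⟨rfl, rfl⟩, ?_, by simp⟩
      rcases max_cases B 0 with h | h <;> rw [h.1] <;> push_cast at hθB <;> linarith
    · have hn' : (1 : ℝ) ≤ n := by exact_mod_cast hn
      set ε := min (1 - θ) (min (n + 1 - B - θ) 1) / 2 with hε
      have e1 := min_le_left (1 - θ) (min (n + 1 - B - θ) 1)
      have e2 := (min_le_right (1 - θ) (min (n + 1 - B - θ) 1)).trans (min_le_left _ _)
      have e3 := (min_le_right (1 - θ) (min (n + 1 - B - θ) 1)).trans (min_le_right _ _)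
      have e0 : 0 < min (1 - θ) (min (n + 1 - B - θ) 1) :=
        lt_min (by linarith) (lt_min (by linarith) one_pos)
      exact ⟨1 - θ - ε, n - ε, by linarith, by linarith, Or.inl ⟨by linarith, hn⟩, by linarith,
        by linarith⟩
  set T : EuclideanSpace ℝ (Fin (n + 1)) → ℝ × (Fin n → ℝ) :=
    fun z => MeasurableEquiv.piFinSuccAbove (fun _ => ℝ) i (WithLp.ofLp z) with hT
  have hTmp : MeasurePreserving T :=
    (volume_preserving_piFinSuccAbove (fun _ => ℝ) i).comp (PiLp.volume_preserving_ofLp _)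
  have hT1 : ∀ z, (T z).1 = z i := fun z => rfl
  have hT2 : ∀ z, (T z).2 = fun j => z (i.succAbove j) := fun z => rfl
  set x' : Fin n → ℝ := fun j => x (i.succAbove j) with hx'
  have hBn' : B' < n ∨ n = 0 := hBn.imp And.left And.left
  have hP : Integrable (fun y : Fin n → ℝ => cutRpow B' (y - x')) := by
    rcases hBn with h | h
    · exact integrable_cutRpow_sub volume (by simpa using h.2) (by simpa using h.1) x'
    · obtain ⟨rfl, -⟩ := h
      exact Integrable.of_finite
  have hD : Integrable (fun w : ℝ × (Fin n → ℝ) =>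
      cutRpow (θ + A') (w.1 - SignType.sign (x i) * √(1 - ∑ j, w.2 j ^ 2)) * cutRpow B' (w.2 - x')
      + cutRpow (0 : ℝ) (w.1 - x i) * cutRpow B' (w.2 - x')
      + cutRpow (θ + A') (w.1 - x i) * cutRpow B' (w.2 - x')) :=
    ((integrable_prod_cutRpow hγ hBn' (κ := fun y => SignType.sign (x i) * √(1 - ∑ j, y j ^ 2))
      (by fun_prop) x').add (integrable_prod_cutRpow one_pos hBn' (κ := fun _ => x i)
        measurable_const x')).add
      (integrable_prod_cutRpow hγ hBn' (κ := fun _ => x i) measurable_const x')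
  have hDT := ((hTmp.integrable_comp hD.aestronglyMeasurable).2 hD).const_mul
    ((|x i| / 6) ^ (-θ))
  refine hDT.integrableOn.mono' (Measurable.aestronglyMeasurable (by fun_prop)) ?_
  refine (ae_restrict_iff' measurableSet_ball).2 ?_
  filter_upwards [ae_forall_apply_ne x] with z hz hzb
  rw [mem_ball_iff_norm, norm_sub_rev] at hzb
  rw [Real.norm_of_nonneg (by positivity)]
  have hxz0 : 0 < ‖x - z‖ := by
    rw [norm_pos_iff, sub_ne_zero]; rintro rfl; exact hz i rfl
  have hzj : 0 < ‖(fun j => z (i.succAbove j) - x (i.succAbove j) : Fin n → ℝ)‖ ∨ B' = 0 := by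
    rcases hBn with h | h
    · left
      rw [norm_pos_iff]
      intro h0
      exact hz _ (sub_eq_zero.1 (congrFun h0 ⟨0, h.2⟩))
    · exact Or.inr h.2
  have hmain := abs_one_sub_norm_rpow_mul_le hθ hA' hB' hx hi hzb (hz i) hzj
  have hBle : ‖x - z‖ ^ (-B) ≤ ‖x - z‖ ^ (-(A' + B')) :=
    Real.rpow_le_rpow_of_exponent_ge hxz0 (by linarith) (by linarith)
  refine (mul_le_mul_of_nonneg_left hBle (by positivity)).trans (hmain.trans_eq ?_)
  have hone : cutRpow (0 : ℝ) (z i - x i) = 1 := by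
    rw [cutRpow_of_lt, neg_zero, Real.rpow_zero]
    have := PiLp.norm_apply_le (x - z) i
    rw [PiLp.sub_apply, norm_sub_rev] at this
    linarith
  simp only [Function.comp, hT1, hT2]
  rw [hone, ← add_mul, ← add_mul]
  rfl

theorem one_add_sq_div_rpow_le {ρ θ : ℝ} (hρ : 0 ≤ ρ) (hθ : 0 ≤ θ) (hθ1 : θ ≤ 1) :
    ((1 + ρ ^ 2) / |1 - ρ ^ 2|) ^ θ ≤
      3 + 4 * {ρ : ℝ | |1 - ρ| < 1 / 2}.indicator (fun ρ => |1 - ρ| ^ (-θ)) ρ := by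
  have hfac : |1 - ρ ^ 2| = |1 - ρ| * (1 + ρ) := by
    rw [← abs_of_nonneg (by linarith : 0 ≤ 1 + ρ), ← abs_mul]
    congr 1
    ring
  have hle : ∀ c : ℝ, 1 ≤ c → c ^ θ ≤ c := fun c hc => by
    simpa using Real.rpow_le_rpow_of_exponent_le hc hθ1
  by_cases h : |1 - ρ| < 1 / 2
  · rw [Set.indicator_of_mem (show ρ ∈ {ρ : ℝ | |1 - ρ| < 1 / 2} from h)]
    have hρ2 : ρ < 3 / 2 := by linarith [(abs_lt.1 h).1]
    rcases (abs_nonneg (1 - ρ)).eq_or_lt with h0 | h0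
    · rw [hfac, ← h0, zero_mul, div_zero]
      rcases hθ.eq_or_lt with rfl | hθ'
      · simp; norm_num
      · rw [Real.zero_rpow hθ'.ne', Real.zero_rpow (by linarith)]; norm_num
    · have h1 : (1 + ρ ^ 2) / |1 - ρ ^ 2| ≤ 4 * |1 - ρ|⁻¹ := by
        rw [hfac, div_le_iff₀ (by positivity)]
        field_simp
        nlinarith
      have h2 : ((1 + ρ ^ 2) / |1 - ρ ^ 2|) ^ θ ≤ (4 * |1 - ρ|⁻¹) ^ θ :=
        Real.rpow_le_rpow (by positivity) h1 hθ
      rw [Real.mul_rpow (by norm_num) (by positivity), Real.inv_rpow h0.le,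
        ← Real.rpow_neg h0.le] at h2
      have h3 := mul_le_mul_of_nonneg_right (hle 4 (by norm_num))
        (Real.rpow_nonneg h0.le (-θ))
      linarith
  · rw [Set.indicator_of_notMem (show ρ ∉ {ρ : ℝ | |1 - ρ| < 1 / 2} from h), mul_zero, add_zero]
    rw [not_lt] at h
    have h1 : (1 + ρ ^ 2) / |1 - ρ ^ 2| ≤ 3 := by
      rw [hfac, div_le_iff₀ (by positivity)]
      rcases le_abs.1 h with h | h
      · rw [abs_of_nonneg (by linarith)]; nlinarith
      · rw [abs_of_nonpos (by linarith)]; nlinarith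
    exact (Real.rpow_le_rpow (by positivity) h1 hθ).trans (hle 3 (by norm_num))

theorem measurableSet_shell : MeasurableSet {ρ : ℝ | |1 - ρ| < 1 / 2} :=
  measurableSet_lt (by fun_prop) measurable_const

theorem integrable_shell_rpow {n : ℕ} {θ : ℝ} (hθ1 : θ < 1) :
    Integrable fun z : EuclideanSpace ℝ (Fin (n + 1)) =>
      {ρ : ℝ | |1 - ρ| < 1 / 2}.indicator (fun ρ => |1 - ρ| ^ (-θ)) ‖z‖ := by
  rw [integrable_fun_norm_addHaar volume
    (f := {ρ : ℝ | |1 - ρ| < 1 / 2}.indicator (fun ρ => |1 - ρ| ^ (-θ)))]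
  have h1 : Integrable (fun r : ℝ => (3 / 2 : ℝ) ^ n * cutRpow θ (r - 1)) :=
    (integrable_cutRpow_sub volume (by simp) (by simpa) 1).const_mul _
  refine h1.integrableOn.mono' ?_ ?_
  · have hm : Measurable fun ρ : ℝ => |1 - ρ| ^ (-θ) := by fun_prop
    exact ((measurable_id.pow_const _).smul
      (hm.indicator measurableSet_shell)).aestronglyMeasurable
  · refine (ae_restrict_iff' measurableSet_Ioi).2 (ae_of_all _ fun r (hr : 0 < r) => ?_)
    rw [finrank_euclideanSpace, Fintype.card_fin, Nat.add_sub_cancel, smul_eq_mul]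
    by_cases h : |1 - r| < 1 / 2
    · rw [Set.indicator_of_mem (show r ∈ {ρ : ℝ | |1 - ρ| < 1 / 2} from h),
        Real.norm_of_nonneg (by positivity),
        cutRpow_of_lt θ (by rw [Real.norm_eq_abs, abs_sub_comm]; linarith), Real.norm_eq_abs,
        abs_sub_comm]
      gcongr
      linarith [(abs_lt.1 h).1]
    · rw [Set.indicator_of_notMem (show r ∉ {ρ : ℝ | |1 - ρ| < 1 / 2} from h), mul_zero, norm_zero]
      exact mul_nonneg (by positivity) (cutRpow_nonneg _ _)

/-- For `‖x‖ = 1` the two singularities meet and the local lemma applies. Otherwise they are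
separated by twice the distance `η`: where `‖x-z‖ ≥ η` the kernel is bounded, and elsewhere the
weight is. -/
theorem integrable_shell_rpow_mul {n : ℕ} {x : EuclideanSpace ℝ (Fin (n + 1))} (hx : x ≠ 0)
    {A B θ : ℝ} (hA : A < n + 1) (hB : B < n + 1) (hAB : n + 1 < A + B)
    (hθ : 0 ≤ θ) (hθ1 : θ < 1) (hθx : ‖x‖ = 1 → θ < n + 1 - B) :
    Integrable fun z : EuclideanSpace ℝ (Fin (n + 1)) =>
      {ρ : ℝ | |1 - ρ| < 1 / 2}.indicator (fun ρ => |1 - ρ| ^ (-θ)) ‖z‖ * ‖x - z‖ ^ (-B) := by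
  have hshell := integrable_shell_rpow (n := n) hθ1
  have hind : ∀ r : ℝ, 0 ≤ {ρ : ℝ | |1 - ρ| < 1 / 2}.indicator (fun ρ => |1 - ρ| ^ (-θ)) r :=
    Set.indicator_nonneg fun _ _ => by positivity
  have hmeas : Measurable fun z : EuclideanSpace ℝ (Fin (n + 1)) =>
      {ρ : ℝ | |1 - ρ| < 1 / 2}.indicator (fun ρ => |1 - ρ| ^ (-θ)) ‖z‖ * ‖x - z‖ ^ (-B) := by
    refine Measurable.mul ?_ (by fun_prop)
    exact (Measurable.indicator (by fun_prop) measurableSet_shell).comp measurable_norm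
  by_cases hx1 : ‖x‖ = 1
  · obtain ⟨ρ, hρ, hρ1, hint⟩ := exists_integrableOn_ball_sphere hx1 hθ hθ1 (hθx hx1)
    refine ((hshell.const_mul (ρ ^ (-B))).add (hint.integrable_indicator measurableSet_ball)).mono'
      hmeas.aestronglyMeasurable (ae_of_all _ fun z => ?_)
    rw [Real.norm_of_nonneg (mul_nonneg (hind _) (by positivity)), Pi.add_apply]
    by_cases hz : z ∈ Metric.ball x ρ
    · rw [Set.indicator_of_mem hz]
      have h1 : {ρ : ℝ | |1 - ρ| < 1 / 2}.indicator (fun ρ => |1 - ρ| ^ (-θ)) ‖z‖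
          ≤ |1 - ‖z‖| ^ (-θ) := Set.indicator_le_self' (fun _ _ => by positivity) _
      have h2 := mul_le_mul_of_nonneg_right h1 (Real.rpow_nonneg (norm_nonneg (x - z)) (-B))
      have h3 := mul_nonneg (Real.rpow_nonneg hρ.le (-B)) (hind ‖z‖)
      linarith
    · rw [Set.indicator_of_notMem hz, add_zero, mul_comm]
      refine mul_le_mul_of_nonneg_right (Real.rpow_le_rpow_of_nonpos hρ ?_ (by linarith)) (hind _)
      rw [mem_ball_iff_norm, norm_sub_rev, not_lt] at hz
      exact hz
  · set η := |1 - ‖x‖| / 2 with hη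
    have hη0 : 0 < η := by
      have : 1 - ‖x‖ ≠ 0 := fun h => hx1 (by linarith)
      positivity
    have hf := integrable_norm_rpow_mul_norm_sub_rpow
      (volume : Measure (EuclideanSpace ℝ (Fin (n + 1)))) (by simp) (A := A) (B := B)
      (by simpa) (by simpa) (by simpa) hx
    refine ((hshell.const_mul (η ^ (-B))).add (hf.const_mul (η ^ (-θ) * (3 / 2) ^ A))).mono'
      hmeas.aestronglyMeasurable (ae_of_all _ fun z => ?_)
    rw [Real.norm_of_nonneg (mul_nonneg (hind _) (by positivity)), Pi.add_apply]
    have h3 := mul_nonneg (Real.rpow_nonneg hη0.le (-B)) (hind ‖z‖)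
    by_cases hzη : η ≤ ‖x - z‖
    · have h1 := mul_le_mul_of_nonneg_right
        (Real.rpow_le_rpow_of_nonpos hη0 hzη (by linarith : -B ≤ 0)) (hind ‖z‖)
      have : 0 ≤ η ^ (-θ) * (3 / 2) ^ A * (‖z‖ ^ (-A) * ‖x - z‖ ^ (-B)) := by positivity
      linarith
    · have hz1 : η ≤ |1 - ‖z‖| := by
        have h1 := abs_norm_sub_norm_le x z
        have h2 := abs_sub_abs_le_abs_sub (1 - ‖x‖) (1 - ‖z‖)
        have h4 : |1 - ‖x‖ - (1 - ‖z‖)| = |(‖x‖ - ‖z‖)| := by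
          rw [← abs_neg]; congr 1; ring
        rw [h4] at h2
        linarith
      by_cases hs : |1 - ‖z‖| < 1 / 2
      · rw [Set.indicator_of_mem (show ‖z‖ ∈ {ρ : ℝ | |1 - ρ| < 1 / 2} from hs)] at h3 ⊢
        have h1 : |1 - ‖z‖| ^ (-θ) ≤ η ^ (-θ) :=
          Real.rpow_le_rpow_of_nonpos hη0 hz1 (by linarith)
        have hz := abs_lt.1 hs
        have hz0 : 0 < ‖z‖ := by linarith
        -- On the shell `‖z‖ < 3/2`, so this factor can be inserted to reach the two-point kernel,
        -- which is already known to be integrable.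
        have h2 : 1 ≤ (3 / 2 : ℝ) ^ A * ‖z‖ ^ (-A) := by
          rw [Real.rpow_neg hz0.le, ← div_eq_mul_inv, ← Real.div_rpow (by norm_num) hz0.le]
          exact Real.one_le_rpow ((one_le_div hz0).2 (by linarith)) (by linarith)
        have h5 : |1 - ‖z‖| ^ (-θ) * ‖x - z‖ ^ (-B)
            ≤ η ^ (-θ) * ((3 / 2) ^ A * ‖z‖ ^ (-A)) * ‖x - z‖ ^ (-B) := by
          gcongr
          exact h1.trans (le_mul_of_one_le_right (by positivity) h2)
        linarith
      · rw [Set.indicator_of_notMem (show ‖z‖ ∉ {ρ : ℝ | |1 - ρ| < 1 / 2} from hs)] at h3 ⊢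
        have : 0 ≤ η ^ (-θ) * (3 / 2) ^ A * (‖z‖ ^ (-A) * ‖x - z‖ ^ (-B)) := by positivity
        linarith

/-- Riesz kernels stay integrable after multiplication by a weight with a singularity of order
`θ < 1` on the unit sphere, provided `θ < d - B` if the base point lies on the sphere. -/
theorem integrable_sphere_weight {d : ℕ} {x : EuclideanSpace ℝ (Fin d)} (hx : x ≠ 0)
    {A B θ : ℝ} (hA : A < d) (hB : B < d) (hAB : d < A + B)
    (hθ : 0 ≤ θ) (hθ1 : θ < 1) (hθx : ‖x‖ = 1 → θ < d - B) :
    Integrable fun z : EuclideanSpace ℝ (Fin d) =>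
      ‖z‖ ^ (-A) * ((1 + ‖z‖ ^ 2) / |1 - ‖z‖ ^ 2|) ^ θ * ‖x - z‖ ^ (-B) := by
  obtain ⟨n, rfl⟩ : ∃ n, d = n + 1 := by
    rcases d with _ | n
    · exact absurd (Subsingleton.elim _ _) hx
    · exact ⟨n, rfl⟩
  push_cast at hA hB hAB hθx
  have hf := integrable_norm_rpow_mul_norm_sub_rpow
    (volume : Measure (EuclideanSpace ℝ (Fin (n + 1)))) (by simp) (A := A) (B := B)
    (by simpa) (by simpa) (by simpa) hx
  have hg := integrable_shell_rpow_mul hx hA hB hAB hθ hθ1 hθx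
  refine ((hf.const_mul 3).add (hg.const_mul (2 ^ A * 4))).mono'
    (Measurable.aestronglyMeasurable (by fun_prop)) (ae_of_all _ fun z => ?_)
  rw [Real.norm_of_nonneg (by positivity), Pi.add_apply]
  have h1 := one_add_sq_div_rpow_le (norm_nonneg z) hθ hθ1.le
  have h2 : ‖z‖ ^ (-A) * {ρ : ℝ | |1 - ρ| < 1 / 2}.indicator (fun ρ => |1 - ρ| ^ (-θ)) ‖z‖
      ≤ 2 ^ A * {ρ : ℝ | |1 - ρ| < 1 / 2}.indicator (fun ρ => |1 - ρ| ^ (-θ)) ‖z‖ := by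
    by_cases hs : |1 - ‖z‖| < 1 / 2
    · refine mul_le_mul_of_nonneg_right ?_ (Set.indicator_nonneg (fun _ _ => by positivity) _)
      have hz := abs_lt.1 hs
      calc ‖z‖ ^ (-A) ≤ (1 / 2 : ℝ) ^ (-A) :=
            Real.rpow_le_rpow_of_nonpos (by norm_num) (by linarith) (by linarith)
        _ = 2 ^ A := by rw [one_div, Real.inv_rpow (by norm_num), Real.rpow_neg (by norm_num),
            inv_inv]
    · rw [Set.indicator_of_notMem (show ‖z‖ ∉ {ρ : ℝ | |1 - ρ| < 1 / 2} from hs)]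
      simp
  have h3 := mul_le_mul_of_nonneg_left h1 (Real.rpow_nonneg (norm_nonneg z) (-A))
  have h4 : 0 ≤ ‖x - z‖ ^ (-B) := by positivity
  nlinarith

/-! ### Integrals along vertical lines: uniform bounds and convergence -/

theorem integral_abs_rpow_neg_add_one_le {e N t₁ t₂ : ℝ} (he : 0 < e) (hN : 0 < N)
    (ht : t₁ ≤ t₂) (h : N ≤ t₁ ∨ t₂ ≤ -N) :
    ∫ t in t₁..t₂, |t| ^ (-(e + 1)) ≤ N ^ (-e) / e := by
  have key : ∀ u v : ℝ, u ≤ v → N ≤ u → ∫ t in u..v, |t| ^ (-(e + 1)) ≤ N ^ (-e) / e := by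
    intro u v huv hu
    have hu0 : 0 < u := hN.trans_le hu
    have : ∫ t in u..v, |t| ^ (-(e + 1)) = ∫ t in u..v, t ^ (-(e + 1)) := by
      refine intervalIntegral.integral_congr fun t ht => ?_
      rw [Set.uIcc_of_le huv] at ht
      simp only [abs_of_pos (hu0.trans_le ht.1)]
    rw [this, integral_rpow (Or.inr ⟨by linarith, by
      rw [Set.uIcc_of_le huv]; exact fun h0 => absurd h0.1 (not_le.2 hu0)⟩)]
    have e1 : -(e + 1) + 1 = -e := by ring
    rw [e1, div_neg, ← neg_div, neg_sub]
    have h1 : u ^ (-e) ≤ N ^ (-e) := Real.rpow_le_rpow_of_nonpos hN hu (by linarith)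
    have h2 : 0 ≤ v ^ (-e) := Real.rpow_nonneg (by linarith) _
    gcongr
    linarith
  rcases h with h | h
  · exact key _ _ ht h
  · have := key (-t₂) (-t₁) (by linarith) (by linarith)
    rw [← intervalIntegral.integral_comp_neg (fun t : ℝ => |t| ^ (-(e + 1)))] at this
    simpa using this

/-- Since `r^(-(s-1)) = r · r^(-s)`, `r` times the integral is an integral of `g(u+1) r^(-u)` over
`Re u = c - 1`. Moving it to `Re u = c` by Cauchy and subtracting turns `1 - r` times the integral
into one of `g(s) - g(s+1)`, which is absolutely convergent, plus two horizontal sides. These give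
the `1/e` and the `2` in the constant. -/
theorem norm_integral_vertical_tail_le {g : ℂ → ℂ} {c C T₀ e : ℝ} (he : 0 < e) (hC : 0 ≤ C)
    (hT₀ : 0 < T₀)
    (hd : ∀ s : ℂ, c ≤ s.re → s.re ≤ c + 1 → T₀ ≤ |s.im| → DifferentiableAt ℂ g s)
    (hg : ∀ s : ℂ, c ≤ s.re → s.re ≤ c + 1 → T₀ ≤ |s.im| → ‖g s‖ ≤ C * |s.im| ^ (-e))
    (hg1 : ∀ s : ℂ, s.re = c → T₀ ≤ |s.im| → ‖g s - g (s + 1)‖ ≤ C * |s.im| ^ (-(e + 1)))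
    {r : ℝ} (hr : 0 < r) (hr1 : r ≠ 1) {N t₁ t₂ : ℝ} (hN : T₀ ≤ N) (ht : t₁ ≤ t₂)
    (h : N ≤ t₁ ∨ t₂ ≤ -N) :
    ‖∫ t in t₁..t₂, g (c + t * Complex.I) * (r : ℂ) ^ (-(c + t * Complex.I))‖ ≤
      C * (1 / e + 2) * N ^ (-e) * r ^ (-c) * ((1 + r) / |1 - r|) := by
  have hN0 : 0 < N := hT₀.trans_le hN
  have habs : ∀ t ∈ Set.Icc t₁ t₂, N ≤ |t| := fun t ht => by
    rcases h with h | h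
    · exact (h.trans ht.1).trans (le_abs_self t)
    · exact (by linarith [ht.2] : N ≤ -t).trans (neg_le_abs t)
  have hr0 : (r : ℂ) ≠ 0 := by exact_mod_cast hr.ne'
  set H : ℂ → ℂ := fun u => g (u + 1) * (r : ℂ) ^ (-u) with hH
  set F : ℝ → ℂ := fun t => g (c + t * Complex.I) * (r : ℂ) ^ (-(c + t * Complex.I)) with hF
  set D : ℝ → ℂ := fun t => (g (c + t * Complex.I) - g (c + t * Complex.I + 1)) *
    (r : ℂ) ^ (-(c + t * Complex.I)) with hD
  have hHd : ∀ u : ℂ, c - 1 ≤ u.re → u.re ≤ c → T₀ ≤ |u.im| → DifferentiableAt ℂ H u := by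
    intro u h1 h2 h3
    have hd' : DifferentiableAt ℂ g (u + 1) := hd _ (by simp; linarith) (by simp; linarith) (by simpa)
    exact (hd'.comp u (differentiableAt_id.add_const (1 : ℂ))).mul (differentiable_const_cpow_neg hr u)
  have hrect := Complex.integral_boundary_rect_eq_zero_of_differentiableOn H
    (⟨c - 1, t₁⟩ : ℂ) (⟨c, t₂⟩ : ℂ) (fun u hu => by
      rw [Complex.mem_reProdIm, Set.uIcc_of_le (by simp), Set.uIcc_of_le ht] at hu
      exact (hHd u hu.1.1 hu.1.2 (hN.trans (habs _ hu.2))).differentiableWithinAt)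
  simp only at hrect
  have hcont : ∀ G : ℂ → ℂ, ∀ σ : ℝ, (∀ t ∈ Set.Icc t₁ t₂, DifferentiableAt ℂ G (σ + t * Complex.I)) →
      IntervalIntegrable (fun t : ℝ => G (σ + t * Complex.I)) volume t₁ t₂ := by
    intro G σ hG
    refine ContinuousOn.intervalIntegrable fun t ht' => ?_
    rw [Set.uIcc_of_le ht] at ht'
    exact ((hG t ht').continuousAt.comp (f := fun t : ℝ => (σ : ℂ) + t * Complex.I)
      (by fun_prop)).continuousWithinAt
  have hFi : IntervalIntegrable F volume t₁ t₂ :=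
    hcont (fun s => g s * (r : ℂ) ^ (-s)) c fun t ht' =>
      (hd _ (by simp) (by simp) (by simpa using hN.trans (habs t ht'))).mul
        (differentiable_const_cpow_neg hr _)
  have hHi : IntervalIntegrable (fun t : ℝ => H (c + t * Complex.I)) volume t₁ t₂ :=
    hcont H c fun t ht' => hHd _ (by simp) (by simp) (by simpa using hN.trans (habs t ht'))
  have hDF : ∀ t, D t = F t - H (c + t * Complex.I) := fun t => by
    simp only [hD, hF, hH]; ring
  have hleft : ∀ t : ℝ, H ((c - 1 : ℝ) + t * Complex.I) = r * F t := fun t => by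
    simp only [hF, hH]
    have e1 : ((c - 1 : ℝ) : ℂ) + t * Complex.I + 1 = c + t * Complex.I := by push_cast; ring
    have e2 : -(((c - 1 : ℝ) : ℂ) + t * Complex.I) = -(c + t * Complex.I) + 1 := by push_cast; ring
    rw [e1, e2, Complex.cpow_add _ _ hr0, Complex.cpow_one]
    ring
  have hDint : ∫ t in t₁..t₂, D t = (∫ t in t₁..t₂, F t) - ∫ t in t₁..t₂, H (c + t * Complex.I) := by
    rw [← intervalIntegral.integral_sub hFi hHi]
    exact intervalIntegral.integral_congr fun t _ => hDF t
  simp only [hleft, intervalIntegral.integral_const_mul, smul_eq_mul] at hrect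
  have hid : (1 - r : ℂ) * ∫ t in t₁..t₂, F t = (∫ t in t₁..t₂, D t) + Complex.I *
      ((∫ σ in (c - 1)..c, H (σ + t₁ * Complex.I)) - ∫ σ in (c - 1)..c, H (σ + t₂ * Complex.I)) := by
    rw [hDint]
    linear_combination (-Complex.I) * hrect + ((∫ t in t₁..t₂, H (c + t * Complex.I)) -
      r * ∫ t in t₁..t₂, F t) * Complex.I_sq
  have hDle : ‖∫ t in t₁..t₂, D t‖ ≤ C * r ^ (-c) * (N ^ (-e) / e) := by
    have hi : IntervalIntegrable (fun t : ℝ => C * r ^ (-c) * |t| ^ (-(e + 1))) volume t₁ t₂ := by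
      refine ContinuousOn.intervalIntegrable fun t ht' => ?_
      rw [Set.uIcc_of_le ht] at ht'
      have : |t| ≠ 0 := (hN0.trans_le (habs t ht')).ne'
      exact (continuousAt_const.mul ((continuous_abs.continuousAt).rpow_const
        (Or.inl this))).continuousWithinAt
    refine (intervalIntegral.norm_integral_le_of_norm_le ht (ae_of_all _ fun t ht' => ?_) hi).trans ?_
    · have h1 := hg1 (c + t * Complex.I) (by simp) (by
        simpa using hN.trans (habs t (Set.Ioc_subset_Icc_self ht')))
      rw [hD, norm_mul, Complex.norm_cpow_eq_rpow_re_of_pos hr]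
      simp only [Complex.neg_re, Complex.add_re, Complex.ofReal_re, Complex.mul_re, Complex.I_re,
        mul_zero, Complex.ofReal_im, Complex.I_im, mul_one, sub_self, add_zero, Complex.add_im,
        Complex.mul_im, zero_add] at h1 ⊢
      nlinarith [Real.rpow_nonneg hr.le (-c)]
    · rw [intervalIntegral.integral_const_mul]
      gcongr
      exact integral_abs_rpow_neg_add_one_le he hN0 ht h
  have hHle : ∀ t, N ≤ |t| → ‖∫ σ in (c - 1)..c, H (σ + t * Complex.I)‖ ≤
      C * N ^ (-e) * (r ^ (-c) * (1 + r)) := by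
    intro t ht'
    have := intervalIntegral.norm_integral_le_of_norm_le_const (a := c - 1) (b := c)
      (f := fun σ : ℝ => H (σ + t * Complex.I)) (C := C * N ^ (-e) * (r ^ (-c) * (1 + r)))
      (fun σ hσ => by
        rw [Set.uIoc_of_le (by linarith)] at hσ
        have h1 := hg (σ + t * Complex.I + 1) (by simp; linarith [hσ.1]) (by simp; linarith [hσ.2])
          (by simpa using hN.trans ht')
        have h2 := norm_cpow_neg_le hr (c₁ := c - 1) (c₂ := c) (s := σ + t * Complex.I)
          (by simpa using hσ.1.le) (by simpa using hσ.2)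
        have h3 : |t| ^ (-e) ≤ N ^ (-e) := Real.rpow_le_rpow_of_nonpos hN0 ht' (by linarith)
        have h4 : r ^ (-(c - 1)) + r ^ (-c) = r ^ (-c) * (1 + r) := by
          rw [show -(c - 1) = -c + 1 by ring, Real.rpow_add hr, Real.rpow_one]; ring
        rw [h4] at h2
        simp only [Complex.add_im, Complex.ofReal_im, Complex.mul_im, Complex.ofReal_re,
          Complex.I_im, mul_one, Complex.I_re, mul_zero, add_zero, zero_add, Complex.one_im] at h1
        simp only [hH, norm_mul]
        exact mul_le_mul (h1.trans (by gcongr)) h2 (norm_nonneg _) (by positivity))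
    simpa using this
  have hpos : 0 < |1 - r| := abs_pos.2 (sub_ne_zero.2 hr1.symm)
  have hfin : |1 - r| * ‖∫ t in t₁..t₂, F t‖ ≤
      C * (1 / e + 2) * N ^ (-e) * r ^ (-c) * (1 + r) := by
    have h1 : |1 - r| * ‖∫ t in t₁..t₂, F t‖ = ‖(1 - r : ℂ) * ∫ t in t₁..t₂, F t‖ := by
      rw [norm_mul, ← Complex.ofReal_one, ← Complex.ofReal_sub, Complex.norm_real, Real.norm_eq_abs]
    rw [h1, hid]
    refine (norm_add_le _ _).trans ?_
    rw [norm_mul, Complex.norm_I, one_mul]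
    have h2 := norm_sub_le (∫ σ in (c - 1)..c, H (σ + t₁ * Complex.I))
      (∫ σ in (c - 1)..c, H (σ + t₂ * Complex.I))
    have h3 := hHle t₁ (habs _ ⟨le_rfl, ht⟩)
    have h4 := hHle t₂ (habs _ ⟨ht, le_rfl⟩)
    have h5 : C * r ^ (-c) * (N ^ (-e) / e) ≤ C * r ^ (-c) * (N ^ (-e) / e) * (1 + r) :=
      le_mul_of_one_le_right (by positivity) (by linarith)
    have h6 : C * (1 / e + 2) * N ^ (-e) * r ^ (-c) * (1 + r) =
      C * r ^ (-c) * (N ^ (-e) / e) * (1 + r) + 2 * (C * N ^ (-e) * (r ^ (-c) * (1 + r))) := by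
      ring
    linarith
  rw [← mul_div_assoc, le_div_iff₀ hpos, mul_comm]
  exact hfin

/-- Here `W` will be `(1+r)/|1-r|`. Up to `T₀W` the integrand is bounded absolutely by `t^(-e)`,
beyond it the tail bound `N^(-e) W` is better. Both pieces are of order `W^(1-e)`, which brings the
singularity at `r = 1` below order one. -/
theorem norm_integral_le_of_tail {F : ℝ → ℂ} (hF : Continuous F) {e C K R W T₀ : ℝ}
    (he : 0 < e) (he1 : e < 1) (hC : 0 ≤ C) (hK : 0 ≤ K) (hR : 0 ≤ R) (hW : 1 ≤ W) (hT₀ : 1 ≤ T₀)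
    (h1 : ∀ t, T₀ ≤ t → ‖F t‖ ≤ R * C * t ^ (-e))
    (h2 : ∀ N t₁ t₂, T₀ ≤ N → N ≤ t₁ → t₁ ≤ t₂ → ‖∫ t in t₁..t₂, F t‖ ≤ R * K * N ^ (-e) * W)
    {T : ℝ} (hT : T₀ ≤ T) :
    ‖∫ t in T₀..T, F t‖ ≤ R * (C / (1 - e) * T₀ ^ (1 - e) + K) * W ^ (1 - e) := by
  have hT0 : 0 < T₀ := by linarith
  have he' : 0 < 1 - e := by linarith
  have crude : ∀ v, T₀ ≤ v → v ≤ T₀ * W →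
      ‖∫ t in T₀..v, F t‖ ≤ R * (C / (1 - e) * T₀ ^ (1 - e)) * W ^ (1 - e) := by
    intro v hv hvW
    have hi : IntervalIntegrable (fun t : ℝ => R * C * t ^ (-e)) volume T₀ v :=
      (intervalIntegral.intervalIntegrable_rpow' (by linarith)).const_mul _
    refine (intervalIntegral.norm_integral_le_of_norm_le hv
      (ae_of_all _ fun t ht => h1 t ht.1.le) hi).trans ?_
    rw [intervalIntegral.integral_const_mul, integral_rpow (Or.inl (by linarith)),
      show -e + 1 = 1 - e by ring]
    have h3 : v ^ (1 - e) ≤ T₀ ^ (1 - e) * W ^ (1 - e) := by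
      rw [← Real.mul_rpow hT0.le (by linarith)]
      exact Real.rpow_le_rpow (by linarith) hvW he'.le
    have h4 : 0 ≤ T₀ ^ (1 - e) := by positivity
    calc R * C * ((v ^ (1 - e) - T₀ ^ (1 - e)) / (1 - e))
        ≤ R * C * ((T₀ ^ (1 - e) * W ^ (1 - e)) / (1 - e)) := by gcongr; linarith
      _ = _ := by ring
  have hWp : 0 ≤ W ^ (1 - e) := by positivity
  rcases le_total T (T₀ * W) with h | h
  · refine (crude T hT h).trans ?_
    gcongr
    linarith
  · have hN : T₀ ≤ T₀ * W := le_mul_of_one_le_right hT0.le hW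
    rw [← intervalIntegral.integral_add_adjacent_intervals (hF.intervalIntegrable T₀ (T₀ * W))
      (hF.intervalIntegrable _ T)]
    refine (norm_add_le _ _).trans ?_
    have h3 := crude (T₀ * W) hN le_rfl
    have h4 := h2 (T₀ * W) (T₀ * W) T hN le_rfl h
    have h5 : R * K * (T₀ * W) ^ (-e) * W ≤ R * K * W ^ (1 - e) := by
      have h6 : (T₀ * W) ^ (-e) * W = T₀ ^ (-e) * W ^ (1 - e) := by
        rw [Real.mul_rpow hT0.le (by linarith), mul_assoc, show (1 - e) = -e + 1 by ring,
          Real.rpow_add (by linarith), Real.rpow_one]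
      have h7 : T₀ ^ (-e) ≤ 1 := Real.rpow_le_one_of_one_le_of_nonpos hT₀ (by linarith)
      rw [mul_assoc, h6]
      have := mul_le_of_le_one_left hWp h7
      gcongr
    linarith

theorem one_le_one_add_div_abs_one_sub {r : ℝ} (hr : 0 < r) (hr1 : r ≠ 1) :
    1 ≤ (1 + r) / |1 - r| := by
  rw [one_le_div (abs_pos.2 (sub_ne_zero.2 hr1.symm)), abs_le]
  constructor <;> linarith

section Line

variable {g : ℂ → ℂ} {c C T₀ e : ℝ}

theorem continuous_vertical_mul_cpow (hgc : Continuous fun t : ℝ => g (c + t * Complex.I))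
    {r : ℝ} (hr : 0 < r) :
    Continuous fun t : ℝ => g (c + t * Complex.I) * (r : ℂ) ^ (-(c + t * Complex.I)) :=
  hgc.mul ((differentiable_const_cpow_neg hr).continuous.comp
    (by fun_prop : Continuous fun t : ℝ => (c : ℂ) + t * Complex.I))

theorem norm_vertical_mul_cpow {r : ℝ} (hr : 0 < r) (t : ℝ) :
    ‖g (c + t * Complex.I) * (r : ℂ) ^ (-(c + t * Complex.I))‖
      = r ^ (-c) * ‖g (c + t * Complex.I)‖ := by
  rw [norm_mul, Complex.norm_cpow_eq_rpow_re_of_pos hr, mul_comm]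
  simp

theorem exists_norm_integral_vertical_le (he : 0 < e) (he1 : e < 1) (hC : 0 ≤ C) (hT₀ : 1 ≤ T₀)
    (hgc : Continuous fun t : ℝ => g (c + t * Complex.I))
    (hd : ∀ s : ℂ, c ≤ s.re → s.re ≤ c + 1 → T₀ ≤ |s.im| → DifferentiableAt ℂ g s)
    (hg : ∀ s : ℂ, c ≤ s.re → s.re ≤ c + 1 → T₀ ≤ |s.im| → ‖g s‖ ≤ C * |s.im| ^ (-e))
    (hg1 : ∀ s : ℂ, s.re = c → T₀ ≤ |s.im| → ‖g s - g (s + 1)‖ ≤ C * |s.im| ^ (-(e + 1))) :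
    ∃ M, 0 ≤ M ∧ ∀ r : ℝ, 0 < r → r ≠ 1 → ∀ T, 0 ≤ T →
      ‖∫ t in (-T)..T, g (c + t * Complex.I) * (r : ℂ) ^ (-(c + t * Complex.I))‖ ≤
        M * r ^ (-c) * ((1 + r) / |1 - r|) ^ (1 - e) := by
  have hT0 : 0 < T₀ := by linarith
  obtain ⟨M₀, hM₀⟩ := (isCompact_Icc (a := -T₀) (b := T₀)).exists_bound_of_continuousOn
    hgc.continuousOn
  have hM0 : 0 ≤ M₀ := (norm_nonneg _).trans (hM₀ 0 ⟨by linarith, hT0.le⟩)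
  set K := C * (1 / e + 2) with hK
  have hK0 : 0 ≤ K := by positivity
  have he' : 0 < 1 - e := by linarith
  set Q := C / (1 - e) * T₀ ^ (1 - e) + K with hQ
  have hQ0 : 0 ≤ Q := by positivity
  refine ⟨2 * T₀ * M₀ + 2 * Q, by positivity, fun r hr hr1 T hT => ?_⟩
  set W := (1 + r) / |1 - r| with hW
  have hW1 : 1 ≤ W := one_le_one_add_div_abs_one_sub hr hr1
  set F : ℝ → ℂ := fun t => g (c + t * Complex.I) * (r : ℂ) ^ (-(c + t * Complex.I)) with hFdef
  have hF : Continuous F := continuous_vertical_mul_cpow hgc hr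
  have hFn : ∀ t, ‖F t‖ = r ^ (-c) * ‖g (c + t * Complex.I)‖ := norm_vertical_mul_cpow hr
  have hR : 0 ≤ r ^ (-c) := by positivity
  have hWp : 1 ≤ W ^ (1 - e) := Real.one_le_rpow hW1 he'.le
  have hmid : ∀ S, 0 ≤ S → S ≤ T₀ → ‖∫ t in (-S)..S, F t‖ ≤ 2 * T₀ * M₀ * r ^ (-c) := by
    intro S hS hST
    have h1 := intervalIntegral.norm_integral_le_of_norm_le_const (a := -S) (b := S) (f := F)
      (C := r ^ (-c) * M₀) (fun t ht => by
        rw [Set.uIoc_of_le (by linarith)] at ht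
        rw [hFn]
        gcongr
        exact hM₀ t ⟨by linarith [ht.1], by linarith [ht.2]⟩)
    rw [sub_neg_eq_add, abs_of_nonneg (by linarith)] at h1
    refine h1.trans ?_
    have : r ^ (-c) * M₀ * (S + S) ≤ r ^ (-c) * M₀ * (T₀ + T₀) := by gcongr
    linarith
  have hFle : ∀ t, T₀ ≤ |t| → ‖F t‖ ≤ r ^ (-c) * C * |t| ^ (-e) := by
    intro t ht
    rw [hFn, mul_assoc]
    gcongr
    simpa using hg (c + t * Complex.I) (by simp) (by simp) (by simpa)
  have htail := fun N t₁ t₂ hN ht h => norm_integral_vertical_tail_le he hC hT0 hd hg hg1 hr hr1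
    (N := N) (t₁ := t₁) (t₂ := t₂) hN ht h
  rcases le_total T T₀ with h | h
  · refine (hmid T hT h).trans ?_
    have : 2 * T₀ * M₀ * r ^ (-c) ≤ (2 * T₀ * M₀ + 2 * Q) * r ^ (-c) := by gcongr; linarith
    exact this.trans (le_mul_of_one_le_right (by positivity) hWp)
  · have hplus := norm_integral_le_of_tail hF he he1 hC hK0 hR hW1 hT₀
      (fun t ht => by
        have := hFle t (ht.trans (le_abs_self t))
        rwa [abs_of_nonneg (by linarith)] at this)
      (fun N t₁ t₂ hN h1 h2 => (htail N t₁ t₂ hN h2 (Or.inl h1)).trans_eq (by rw [hK]; ring)) h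
    have hminus := norm_integral_le_of_tail (F := fun t => F (-t)) (hF.comp continuous_neg)
      he he1 hC hK0 hR hW1 hT₀
      (fun t ht => by
        have := hFle (-t) (by rw [abs_neg]; exact ht.trans (le_abs_self t))
        rwa [abs_neg, abs_of_nonneg (by linarith)] at this)
      (fun N t₁ t₂ hN h1 h2 => by
        rw [intervalIntegral.integral_comp_neg]
        exact (htail N (-t₂) (-t₁) hN (by linarith) (Or.inr (by linarith))).trans_eq
          (by rw [hK]; ring)) h
    rw [intervalIntegral.integral_comp_neg] at hminus
    have hm := hmid T₀ hT0.le le_rfl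
    rw [← intervalIntegral.integral_add_adjacent_intervals (hF.intervalIntegrable (-T) (-T₀))
      (hF.intervalIntegrable _ T), ← intervalIntegral.integral_add_adjacent_intervals
      (hF.intervalIntegrable (-T₀) T₀) (hF.intervalIntegrable _ T)]
    have hn := norm_add_le (∫ t in (-T)..(-T₀), F t)
      ((∫ t in (-T₀)..T₀, F t) + ∫ t in T₀..T, F t)
    have hn' := norm_add_le (∫ t in (-T₀)..T₀, F t) (∫ t in T₀..T, F t)
    have h3 : 2 * T₀ * M₀ * r ^ (-c) ≤ 2 * T₀ * M₀ * r ^ (-c) * W ^ (1 - e) :=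
      le_mul_of_one_le_right (by positivity) hWp
    have h4 : (2 * T₀ * M₀ + 2 * Q) * r ^ (-c) * W ^ (1 - e) =
      2 * T₀ * M₀ * r ^ (-c) * W ^ (1 - e) + 2 * (r ^ (-c) * Q * W ^ (1 - e)) := by ring
    linarith

theorem exists_tendsto_integral_vertical (he : 0 < e) (hC : 0 ≤ C) (hT₀ : 1 ≤ T₀)
    (hgc : Continuous fun t : ℝ => g (c + t * Complex.I))
    (hd : ∀ s : ℂ, c ≤ s.re → s.re ≤ c + 1 → T₀ ≤ |s.im| → DifferentiableAt ℂ g s)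
    (hg : ∀ s : ℂ, c ≤ s.re → s.re ≤ c + 1 → T₀ ≤ |s.im| → ‖g s‖ ≤ C * |s.im| ^ (-e))
    (hg1 : ∀ s : ℂ, s.re = c → T₀ ≤ |s.im| → ‖g s - g (s + 1)‖ ≤ C * |s.im| ^ (-(e + 1)))
    {r : ℝ} (hr : 0 < r) (hr1 : r ≠ 1) :
    ∃ A, Tendsto (fun T : ℝ => ∫ t in (-T)..T,
      g (c + t * Complex.I) * (r : ℂ) ^ (-(c + t * Complex.I))) atTop (𝓝 A) := by
  have hT0 : 0 < T₀ := by linarith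
  set F : ℝ → ℂ := fun t => g (c + t * Complex.I) * (r : ℂ) ^ (-(c + t * Complex.I)) with hFdef
  have hF : Continuous F := continuous_vertical_mul_cpow hgc hr
  have htail := fun N t₁ t₂ hN ht h => norm_integral_vertical_tail_le he hC hT0 hd hg hg1 hr hr1
    (N := N) (t₁ := t₁) (t₂ := t₂) hN ht h
  set Q := C * (1 / e + 2) * r ^ (-c) * ((1 + r) / |1 - r|) with hQ
  have hlim : Tendsto (fun N : ℝ => 2 * (Q * N ^ (-e))) atTop (𝓝 0) := by
    simpa using ((tendsto_rpow_neg_atTop he).const_mul Q).const_mul 2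
  refine cauchySeq_tendsto_of_complete (Metric.cauchySeq_iff'.2 fun ε hε => ?_)
  obtain ⟨N, hN, hNT⟩ := ((hlim.eventually (gt_mem_nhds hε)).and (eventually_ge_atTop T₀)).exists
  refine ⟨N, fun T hT => lt_of_le_of_lt ?_ hN⟩
  rw [dist_eq_norm]
  have hsplit : (∫ t in (-T)..T, F t) - ∫ t in (-N)..N, F t
      = (∫ t in (-T)..(-N), F t) + ∫ t in N..T, F t := by
    rw [← intervalIntegral.integral_add_adjacent_intervals (hF.intervalIntegrable (-T) (-N))
      (hF.intervalIntegrable _ T), ← intervalIntegral.integral_add_adjacent_intervals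
      (hF.intervalIntegrable (-N) N) (hF.intervalIntegrable _ T)]
    ring
  rw [hsplit]
  have h1 := htail N (-T) (-N) hNT (by linarith) (Or.inr le_rfl)
  have h2 := htail N N T hNT hT (Or.inl le_rfl)
  have h3 : C * (1 / e + 2) * N ^ (-e) * r ^ (-c) * ((1 + r) / |1 - r|) = Q * N ^ (-e) := by
    rw [hQ]; ring
  rw [h3] at h1 h2
  exact (norm_add_le _ _).trans (by linarith)

end Line

/-! ### Truncated line integrals of the Meijer integrand. -/

theorem exists_forall_le_abs_im_notMem_poles (m n : ℕ) {p q : ℕ} (a : Fin p → ℂ) (b : Fin q → ℂ) :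
    ∃ T : ℝ, ∀ s : ℂ, T ≤ |s.im| → s ∉ lowerPoles m b ∧ s ∉ upperPoles n a := by
  refine ⟨1 + ∑ j, |(b j).im| + ∑ j, |(a j).im|, fun s hs => ⟨?_, ?_⟩⟩
  · rintro ⟨j, -, k, rfl⟩
    have h1 := Finset.single_le_sum (f := fun j => |(b j).im|) (fun _ _ => abs_nonneg _)
      (Finset.mem_univ j)
    have h2 := Finset.sum_nonneg (s := Finset.univ) fun (j : Fin p) _ => abs_nonneg (a j).im
    simp at hs h1
    linarith
  · rintro ⟨j, -, k, rfl⟩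
    have h1 := Finset.single_le_sum (f := fun j => |(a j).im|) (fun _ _ => abs_nonneg _)
      (Finset.mem_univ j)
    have h2 := Finset.sum_nonneg (s := Finset.univ) fun (j : Fin q) _ => abs_nonneg (b j).im
    simp at hs h1
    linarith

theorem differentiableAt_meijerMellin_vertical {m n p q : ℕ} {a : Fin p → ℂ} {b : Fin q → ℂ} {c : ℝ}
    (hl : ∀ z ∈ lowerPoles m b, z.re ≠ c) (hu : ∀ z ∈ upperPoles n a, z.re ≠ c) (t : ℝ) :
    DifferentiableAt ℂ (meijerMellin m n a b) (c + t * Complex.I) :=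
  differentiableAt_meijerMellin (fun h => hl _ h (by simp)) (fun h => hu _ h (by simp))

theorem continuous_meijerMellin_vertical {m n p q : ℕ} {a : Fin p → ℂ} {b : Fin q → ℂ} {c : ℝ}
    (hl : ∀ z ∈ lowerPoles m b, z.re ≠ c) (hu : ∀ z ∈ upperPoles n a, z.re ≠ c) :
    Continuous fun t : ℝ => meijerMellin m n a b (c + t * Complex.I) :=
  continuous_iff_continuousAt.2 fun t =>
    (differentiableAt_meijerMellin_vertical hl hu t).continuousAt.comp
      (f := fun t : ℝ => (c : ℂ) + t * Complex.I) (by fun_prop)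

theorem integrable_meijerMellin_vertical {m n p q : ℕ} {a : Fin p → ℂ} {b : Fin q → ℂ} {c κ : ℝ}
    (hm : m ≤ q) (hn : n ≤ p) (hl : ∀ z ∈ lowerPoles m b, z.re ≠ c)
    (hu : ∀ z ∈ upperPoles n a, z.re ≠ c) (hκ : 1 < κ) (hdec : MeijerDecay m n a b κ c c) :
    Integrable fun t : ℝ => meijerMellin m n a b (c + t * Complex.I) := by
  have hcont := continuous_meijerMellin_vertical hl hu
  obtain ⟨C, T, hC, hT, hbd⟩ := hdec.verticalBound hm hn
  obtain ⟨M₀, hM₀⟩ := (isCompact_Icc (a := -T) (b := T)).exists_bound_of_continuousOn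
    hcont.continuousOn
  have hM0 : 0 ≤ M₀ := (norm_nonneg _).trans (hM₀ 0 ⟨by linarith, by linarith⟩)
  have hi : Integrable (fun t : ℝ => (C * 2 ^ κ + M₀ * (1 + T) ^ κ) * (1 + ‖t‖) ^ (-κ)) :=
    (integrable_one_add_norm (by simpa)).const_mul _
  refine hi.mono' hcont.aestronglyMeasurable (ae_of_all _ fun t => ?_)
  rw [Real.norm_eq_abs]
  have hp : 0 < 1 + |t| := by positivity
  rw [add_mul]
  rcases le_total T |t| with h | h
  · have h1 := hbd (c + t * Complex.I) (by simp) (by simp) (by simpa)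
    simp at h1
    have h2 : |t| ^ (-κ) ≤ 2 ^ κ * (1 + |t|) ^ (-κ) := by
      have h3 : ((1 + |t|) / 2) ≤ |t| := by linarith
      refine (Real.rpow_le_rpow_of_nonpos (by positivity) h3 (by linarith)).trans_eq ?_
      rw [Real.div_rpow hp.le (by norm_num), Real.rpow_neg (by norm_num : (0 : ℝ) ≤ 2),
        div_inv_eq_mul, mul_comm]
    have h4 := mul_le_mul_of_nonneg_left h2 hC
    have : 0 ≤ M₀ * (1 + T) ^ κ * (1 + |t|) ^ (-κ) := by positivity
    linarith
  · have h1 := hM₀ t (abs_le.1 h)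
    have h2 : 1 ≤ (1 + T) ^ κ * (1 + |t|) ^ (-κ) := by
      rw [Real.rpow_neg hp.le, ← div_eq_mul_inv, ← Real.div_rpow (by linarith) hp.le]
      exact Real.one_le_rpow ((one_le_div hp).2 (by linarith)) (by linarith)
    have h3 := mul_le_mul_of_nonneg_left h2 hM0
    have : 0 ≤ C * 2 ^ κ * (1 + |t|) ^ (-κ) := by positivity
    linarith

/-- The truncated line integrals are bounded by the power function with weight `θ` on the unit
sphere and converge off the unit sphere. -/
def MeijerLineEstimate (m n : ℕ) {p q : ℕ} (a : Fin p → ℂ) (b : Fin q → ℂ) (c θ : ℝ) : Prop :=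
  (∃ M, 0 ≤ M ∧ ∀ r : ℝ, 0 < r → r ≠ 1 → ∀ T, 0 ≤ T →
    ‖meijerLine m n a b r c T‖ ≤ M * r ^ (-c) * ((1 + r) / |1 - r|) ^ θ) ∧
  ∀ r : ℝ, 0 < r → r ≠ 1 → ∃ A, Tendsto (meijerLine m n a b r c) atTop (𝓝 A)

theorem norm_inv_two_pi_le_one : ‖((2 * Real.pi : ℂ))⁻¹‖ ≤ 1 := by
  rw [norm_inv]
  refine inv_le_one_of_one_le₀ ?_
  have : ‖(2 * Real.pi : ℂ)‖ = 2 * Real.pi := by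
    rw [norm_mul, Complex.norm_real, Real.norm_of_nonneg Real.pi_pos.le]; simp
  rw [this]
  linarith [Real.pi_gt_three]

theorem meijerLineEstimate_zero {m n p q : ℕ} {a : Fin p → ℂ} {b : Fin q → ℂ} {c κ : ℝ}
    (hm : m ≤ q) (hn : n ≤ p) (hl : ∀ z ∈ lowerPoles m b, z.re ≠ c)
    (hu : ∀ z ∈ upperPoles n a, z.re ≠ c) (hκ : 1 < κ) (hdec : MeijerDecay m n a b κ c c) :
    MeijerLineEstimate m n a b c 0 := by
  have hint := integrable_meijerMellin_vertical hm hn hl hu hκ hdec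
  have hcont := continuous_meijerMellin_vertical hl hu
  have hnorm : ∀ r : ℝ, 0 < r → ∀ t : ℝ, ‖meijerIntegrand m n a b r (c + t * Complex.I)‖
      = r ^ (-c) * ‖meijerMellin m n a b (c + t * Complex.I)‖ := fun r hr t =>
    norm_vertical_mul_cpow hr t
  have hi : ∀ r : ℝ, 0 < r → Integrable fun t : ℝ => meijerIntegrand m n a b r (c + t * Complex.I) :=
    fun r hr => (hint.norm.const_mul (r ^ (-c))).mono'
      (continuous_vertical_mul_cpow hcont hr).aestronglyMeasurable
      (ae_of_all _ fun t => (hnorm r hr t).le)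
  refine ⟨⟨∫ t : ℝ, ‖meijerMellin m n a b (c + t * Complex.I)‖,
    integral_nonneg fun _ => norm_nonneg _, fun r hr _ T hT => ?_⟩, fun r hr _ => ?_⟩
  · rw [Real.rpow_zero, mul_one, meijerLine, norm_mul]
    refine (mul_le_of_le_one_left (norm_nonneg _) norm_inv_two_pi_le_one).trans ?_
    refine (intervalIntegral.norm_integral_le_integral_norm (by linarith)).trans ?_
    simp only [hnorm r hr]
    rw [intervalIntegral.integral_const_mul, mul_comm]
    gcongr
    rw [intervalIntegral.integral_of_le (by linarith)]
    exact setIntegral_le_integral hint.norm (ae_of_all _ fun _ => norm_nonneg _)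
  · exact ⟨_, (intervalIntegral_tendsto_integral (hi r hr) tendsto_neg_atTop_atBot
      tendsto_id).const_mul _⟩

/-- Any `e` in `(0, 1)` not exceeding `ν` is allowed. The bounds for `𝒢` on the unit strip and for
the shifted difference feed the general line estimates. -/
theorem meijerLineEstimate_of_conditionB {m n p q : ℕ} {a : Fin p → ℂ} {b : Fin q → ℂ} {c e : ℝ}
    (hB : ConditionB m n p q) (hm : m ≤ q) (hn : n ≤ p)
    (hl : ∀ z ∈ lowerPoles m b, z.re ≠ c) (hu : ∀ z ∈ upperPoles n a, z.re ≠ c)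
    (he : 0 < e) (he1 : e < 1) (heν : e ≤ meijerNu a b) :
    MeijerLineEstimate m n a b c (1 - e) := by
  obtain ⟨hB1, rfl⟩ := hB
  obtain ⟨T₁, hT₁⟩ := exists_forall_le_abs_im_notMem_poles m n a b
  have hdec : MeijerDecay m n a b e c (c + 1) :=
    Or.inr ⟨hB1, by simpa using heν, by simpa using heν⟩
  obtain ⟨C₂, T₂, hC₂, hT₂, h2⟩ := hdec.verticalBound hm hn
  obtain ⟨C₃, T₃, hC₃, hT₃, h3⟩ := verticalBound_meijerMellin_sub (a := a) (b := b)
    (by omega : m + n = p) c c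
  set T₀ := max T₁ (max T₂ T₃) with hT₀
  have hle1 : T₁ ≤ T₀ := le_max_left _ _
  have hle2 : T₂ ≤ T₀ := (le_max_left _ _).trans (le_max_right _ _)
  have hle3 : T₃ ≤ T₀ := (le_max_right _ _).trans (le_max_right _ _)
  have hC : 0 ≤ max C₂ C₃ := hC₂.trans (le_max_left _ _)
  have hgc := continuous_meijerMellin_vertical hl hu
  have hd : ∀ s : ℂ, c ≤ s.re → s.re ≤ c + 1 → T₀ ≤ |s.im| →
      DifferentiableAt ℂ (meijerMellin m n a b) s := fun s _ _ h =>
    differentiableAt_meijerMellin (hT₁ s (hle1.trans h)).1 (hT₁ s (hle1.trans h)).2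
  have hg : ∀ s : ℂ, c ≤ s.re → s.re ≤ c + 1 → T₀ ≤ |s.im| →
      ‖meijerMellin m n a b s‖ ≤ max C₂ C₃ * |s.im| ^ (-e) := fun s h4 h5 h => by
    have := h2 s h4 h5 (hle2.trans h)
    simp only [neg_zero, zero_mul, Real.exp_zero, mul_one] at this
    exact this.trans (mul_le_mul_of_nonneg_right (le_max_left _ _) (by positivity))
  have hg1 : ∀ s : ℂ, s.re = c → T₀ ≤ |s.im| →
      ‖meijerMellin m n a b s - meijerMellin m n a b (s + 1)‖ ≤
        max C₂ C₃ * |s.im| ^ (-(e + 1)) := fun s h4 h => by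
    have := h3 s h4.ge h4.le (hle3.trans h)
    simp only [neg_zero, zero_mul, Real.exp_zero, mul_one] at this
    refine this.trans (mul_le_mul (le_max_right _ _) ?_ (by positivity) hC)
    exact Real.rpow_le_rpow_of_exponent_le (hT₂.trans (hle2.trans h)) (by linarith)
  obtain ⟨M, hM, hMb⟩ := exists_norm_integral_vertical_le he he1 hC (hT₂.trans hle2) hgc hd hg hg1
  refine ⟨⟨M, hM, fun r hr hr1 T hT => ?_⟩, fun r hr hr1 => ?_⟩
  · rw [meijerLine, norm_mul]
    exact (mul_le_of_le_one_left (norm_nonneg _) norm_inv_two_pi_le_one).trans (hMb r hr hr1 T hT)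
  · obtain ⟨A, hA⟩ := exists_tendsto_integral_vertical he hC (hT₂.trans hle2) hgc hd hg hg1 hr hr1
    exact ⟨_, hA.const_mul _⟩

/-! ### Riesz potentials of a solid harmonic times a radial function -/

/-- The value of the Riesz multiplier on `V(z) ‖z‖^{-2s}`. -/
def rieszRatio (d l : ℕ) (α : ℝ) (s : ℂ) : ℂ :=
  Complex.Gamma (s - α / 2) * Complex.Gamma ((d : ℂ) / 2 + l - s) /
    (Complex.Gamma s * Complex.Gamma (α / 2 + ((d : ℂ) / 2 + l - s)))

/-- The Riesz potential of `V(z) φ(‖z‖²)` at `x` is absolutely convergent, with value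
`2^{-α} V(x) A`. -/
def RieszPair {d : ℕ} (α : ℝ) (V : MvPolynomial (Fin d) ℂ) (x : EuclideanSpace ℝ (Fin d))
    (φ : ℝ → ℂ) (A : ℂ) : Prop :=
  Integrable (fun z => evalAt V z * φ (‖z‖ ^ 2) * ((‖x - z‖ ^ (α - d) : ℝ) : ℂ)) ∧
  ((1 / rieszGamma d α : ℝ) : ℂ) *
    ∫ z, evalAt V z * φ (‖z‖ ^ 2) * ((‖x - z‖ ^ (α - d) : ℝ) : ℂ) =
      (2 : ℂ) ^ (-α : ℂ) * evalAt V x * A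

theorem ae_ne_zero_and_norm_sq_ne_one {d : ℕ} (hd : Nontrivial (EuclideanSpace ℝ (Fin d))) :
    ∀ᵐ z : EuclideanSpace ℝ (Fin d), z ≠ 0 ∧ ‖z‖ ^ 2 ≠ 1 := by
  have h0 : ∀ᵐ z : EuclideanSpace ℝ (Fin d), z ≠ 0 := by simp [ae_iff, measure_singleton]
  have h1 : ∀ᵐ z : EuclideanSpace ℝ (Fin d), z ∉ Metric.sphere 0 1 :=
    measure_eq_zero_iff_ae_notMem.1 (Measure.addHaar_sphere volume 0 1)
  filter_upwards [h0, h1] with z hz hz1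
  refine ⟨hz, fun h => hz1 ?_⟩
  rw [mem_sphere_zero_iff_norm]
  exact (pow_eq_one_iff_of_nonneg (norm_nonneg z) two_ne_zero).1 h

namespace RieszPair

variable {d l : ℕ} {α : ℝ} {V : MvPolynomial (Fin d) ℂ} {x : EuclideanSpace ℝ (Fin d)}
  {φ ψ : ℝ → ℂ} {A B : ℂ}

theorem add (h : RieszPair α V x φ A) (h' : RieszPair α V x ψ B) :
    RieszPair α V x (fun r => φ r + ψ r) (A + B) := by
  have e : (fun z => evalAt V z * (φ (‖z‖ ^ 2) + ψ (‖z‖ ^ 2)) * ((‖x - z‖ ^ (α - d) : ℝ) : ℂ))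
      = fun z => evalAt V z * φ (‖z‖ ^ 2) * ((‖x - z‖ ^ (α - d) : ℝ) : ℂ) +
        evalAt V z * ψ (‖z‖ ^ 2) * ((‖x - z‖ ^ (α - d) : ℝ) : ℂ) := by
    ext z; ring
  refine ⟨by rw [e]; exact h.1.add h'.1, ?_⟩
  rw [e, integral_add h.1 h'.1, mul_add, h.2, h'.2]
  ring

theorem neg (h : RieszPair α V x φ A) : RieszPair α V x (fun r => -φ r) (-A) := by
  have e : (fun z => evalAt V z * (-φ (‖z‖ ^ 2)) * ((‖x - z‖ ^ (α - d) : ℝ) : ℂ))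
      = fun z => -(evalAt V z * φ (‖z‖ ^ 2) * ((‖x - z‖ ^ (α - d) : ℝ) : ℂ)) := by
    ext z; ring
  refine ⟨by rw [e]; exact h.1.neg, ?_⟩
  rw [e, integral_neg, mul_neg, h.2]
  ring

theorem sub (h : RieszPair α V x φ A) (h' : RieszPair α V x ψ B) :
    RieszPair α V x (fun r => φ r - ψ r) (A - B) := by
  simpa [sub_eq_add_neg] using h.add h'.neg

theorem zero : RieszPair α V x (fun _ => 0) 0 := by
  refine ⟨by simp, by simp⟩

theorem sum {ι : Type*} (s : Finset ι) {φ : ι → ℝ → ℂ} {A : ι → ℂ}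
    (h : ∀ i ∈ s, RieszPair α V x (φ i) (A i)) :
    RieszPair α V x (fun r => ∑ i ∈ s, φ i r) (∑ i ∈ s, A i) := by
  classical
  induction s using Finset.induction_on with
  | empty => simpa using zero
  | insert i s hi ih =>
    simp only [Finset.sum_insert hi]
    exact (h i (Finset.mem_insert_self _ _)).add
      (ih fun j hj => h j (Finset.mem_insert_of_mem hj))

theorem congr (hx : x ≠ 0) (h : RieszPair α V x φ A)
    (he : ∀ r : ℝ, 0 < r → r ≠ 1 → φ r = ψ r) : RieszPair α V x ψ A := by
  have hd : Nontrivial (EuclideanSpace ℝ (Fin d)) := ⟨x, 0, hx⟩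
  have hae : (fun z => evalAt V z * φ (‖z‖ ^ 2) * ((‖x - z‖ ^ (α - d) : ℝ) : ℂ)) =ᵐ[volume]
      fun z => evalAt V z * ψ (‖z‖ ^ 2) * ((‖x - z‖ ^ (α - d) : ℝ) : ℂ) := by
    filter_upwards [ae_ne_zero_and_norm_sq_ne_one hd] with z hz
    have hz0 : 0 < ‖z‖ := norm_pos_iff.2 hz.1
    rw [he _ (by positivity) hz.2]
  exact ⟨h.1.congr hae, by rw [← integral_congr_ae hae]; exact h.2⟩

/-- At zeros of `V` the claimed value vanishes whatever `A` is. This disposes of points where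
convergence of the transformed contour integral cannot be read off from the potential. -/
theorem congr_value (h : RieszPair α V x φ A) (he : A = B ∨ evalAt V x = 0) :
    RieszPair α V x φ B := by
  rcases he with rfl | he
  · exact h
  · refine ⟨h.1, ?_⟩
    rw [h.2, he, mul_zero, zero_mul, zero_mul]

end RieszPair

section Kernel

variable {d l : ℕ} {α : ℝ} {V : MvPolynomial (Fin d) ℂ} {x : EuclideanSpace ℝ (Fin d)}

theorem norm_evalAt_mul_kernel_le {C : ℝ} (hC : ∀ y, ‖evalAt V y‖ ≤ C * ‖y‖ ^ l)
    {z : EuclideanSpace ℝ (Fin d)} (hz : z ≠ 0) {w : ℂ} {σ M : ℝ}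
    (hw : ‖w‖ ≤ M * (‖z‖ ^ 2) ^ (-σ)) :
    ‖evalAt V z * w * ((‖x - z‖ ^ (α - d) : ℝ) : ℂ)‖ ≤
      C * M * (‖z‖ ^ (-(2 * σ - l)) * ‖x - z‖ ^ (-(d - α))) := by
  have hz0 : 0 < ‖z‖ := norm_pos_iff.2 hz
  have e1 : (‖z‖ ^ 2 : ℝ) ^ (-σ) = ‖z‖ ^ (-(2 * σ)) := by
    rw [← Real.rpow_natCast ‖z‖ 2, ← Real.rpow_mul hz0.le]; congr 1; push_cast; ring
  have e2 : ‖z‖ ^ (-(2 * σ - l)) = ‖z‖ ^ l * ‖z‖ ^ (-(2 * σ)) := by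
    rw [← Real.rpow_natCast ‖z‖ l, ← Real.rpow_add hz0]; congr 1; ring
  rw [norm_mul, norm_mul, Complex.norm_real, Real.norm_of_nonneg (by positivity), e2, ← e1,
    show -((d : ℝ) - α) = α - d by ring]
  calc _ ≤ (C * ‖z‖ ^ l) * (M * (‖z‖ ^ 2) ^ (-σ)) * ‖x - z‖ ^ (α - d) := by
        gcongr
        · exact (norm_nonneg _).trans (hC z)
        · exact hC z
    _ = _ := by ring

/-- The majorant of the Fubini argument on vertical strips. -/
theorem integrable_kernel (hα : 0 < α) (hαd : α < d) (hx : x ≠ 0) {σ : ℝ}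
    (h1 : α + l < 2 * σ) (h2 : 2 * σ < d + l) :
    Integrable fun z : EuclideanSpace ℝ (Fin d) =>
      ‖z‖ ^ (-(2 * σ - l)) * ‖x - z‖ ^ (-(d - α)) := by
  have hd : 0 < d := by
    rcases Nat.eq_zero_or_pos d with rfl | h
    · norm_num at hαd; linarith
    · exact h
  refine integrable_norm_rpow_mul_norm_sub_rpow volume ?_ ?_ ?_ ?_ hx <;>
    simp only [finrank_euclideanSpace, Fintype.card_fin]
  · exact hd
  · linarith
  · linarith
  · linarith

theorem measurable_evalAt (V : MvPolynomial (Fin d) ℂ) : Measurable (evalAt V) :=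
  (continuous_evalAt V).measurable

/-- The normalising constant of the Riesz potential cancels `π^(d/2) Γ(α/2) / Γ((d-α)/2)` in the
power formula and leaves `2^(-α)`. -/
theorem RieszPair.cpow (hα : 0 < α) (hαd : α < d) (hV : IsSolidHarmonic l V) (hx : x ≠ 0) {s : ℂ}
    (h1 : α + l < 2 * s.re) (h2 : 2 * s.re < d + l) :
    RieszPair α V x (fun r => (r : ℂ) ^ (-s))
      (rieszRatio d l α s * ((‖x‖ ^ 2 : ℝ) : ℂ) ^ (α / 2 - s)) := by
  have hd : Nontrivial (EuclideanSpace ℝ (Fin d)) := ⟨x, 0, hx⟩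
  have hl : (0 : ℝ) ≤ l := Nat.cast_nonneg l
  obtain ⟨C, hC0, hC⟩ := norm_evalAt_le hV.1
  have hmeas : Measurable fun z : EuclideanSpace ℝ (Fin d) =>
      evalAt V z * ((‖z‖ ^ 2 : ℝ) : ℂ) ^ (-s) * ((‖x - z‖ ^ (α - d) : ℝ) : ℂ) := by
    refine ((measurable_evalAt V).mul ?_).mul ?_
    · exact (Complex.measurable_ofReal.comp (by fun_prop)).pow_const _
    · exact Complex.measurable_ofReal.comp (by fun_prop)
  have hint : Integrable fun z : EuclideanSpace ℝ (Fin d) =>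
      evalAt V z * ((‖z‖ ^ 2 : ℝ) : ℂ) ^ (-s) * ((‖x - z‖ ^ (α - d) : ℝ) : ℂ) := by
    refine ((integrable_kernel (l := l) hα hαd hx h1 h2).const_mul (C * 1)).mono'
      hmeas.aestronglyMeasurable ?_
    have h0 : ∀ᵐ z : EuclideanSpace ℝ (Fin d), z ≠ 0 := by simp [ae_iff, measure_singleton]
    filter_upwards [h0] with z hz
    refine norm_evalAt_mul_kernel_le hC hz ?_
    rw [Complex.norm_cpow_eq_rpow_re_of_pos (by positivity), Complex.neg_re, one_mul]
  refine ⟨hint, ?_⟩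
  rw [integral_evalAt_mul_cpow_mul_rpow hα hαd hV hx (by linarith) (by linarith) hint]
  have hG1 : Complex.Gamma (α / 2) ≠ 0 := by
    rw [show (α / 2 : ℂ) = ((α / 2 : ℝ) : ℂ) by push_cast; ring, Complex.Gamma_ofReal]
    exact_mod_cast (Real.Gamma_pos_of_pos (by linarith)).ne'
  have hG2 : Complex.Gamma ((d - α) / 2) ≠ 0 := by
    rw [show ((d - α) / 2 : ℂ) = (((d - α) / 2 : ℝ) : ℂ) by push_cast; ring, Complex.Gamma_ofReal]
    exact_mod_cast (Real.Gamma_pos_of_pos (by linarith)).ne'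
  have hπ : ((Real.pi ^ ((d : ℝ) / 2) : ℝ) : ℂ) ≠ 0 := by
    exact_mod_cast (Real.rpow_pos_of_pos Real.pi_pos _).ne'
  have hγ : ((1 / rieszGamma d α : ℝ) : ℂ) = (2 : ℂ) ^ (-α : ℂ) *
      (Complex.Gamma ((d - α) / 2) / (((Real.pi ^ ((d : ℝ) / 2) : ℝ) : ℂ) * Complex.Gamma (α / 2))) := by
    have e1 : ((2 ^ α : ℝ) : ℂ) = (2 : ℂ) ^ (α : ℂ) := by
      rw [Complex.ofReal_cpow (by norm_num)]; simp
    have e2 : ((Real.Gamma (α / 2) : ℝ) : ℂ) = Complex.Gamma (α / 2) := by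
      rw [← Complex.Gamma_ofReal]; push_cast; ring_nf
    have e3 : ((Real.Gamma ((d - α) / 2) : ℝ) : ℂ) = Complex.Gamma ((d - α) / 2) := by
      rw [← Complex.Gamma_ofReal]; push_cast; ring_nf
    rw [rieszGamma, one_div_div, Complex.ofReal_div, Complex.ofReal_mul, Complex.ofReal_mul, e1, e2,
      e3, Complex.cpow_neg]
    field_simp
  rw [hγ, rieszRatio]
  field_simp

/-- Fubini for superpositions of powers along a compact path in the strip. -/
theorem RieszPair.integral_path (hα : 0 < α) (hαd : α < d) (hV : IsSolidHarmonic l V) (hx : x ≠ 0)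
    {h γ : ℝ → ℂ} (hh : Continuous h) (hγ : Continuous γ) {σ₁ σ₂ : ℝ}
    (hσ₁ : α + l < 2 * σ₁) (hσ₂ : 2 * σ₂ < d + l) (hγ₁ : ∀ t, σ₁ ≤ (γ t).re)
    (hγ₂ : ∀ t, (γ t).re ≤ σ₂) {u v : ℝ} (huv : u ≤ v) :
    RieszPair α V x (fun r => ∫ t in u..v, h t * (r : ℂ) ^ (-γ t))
      (∫ t in u..v, h t * (rieszRatio d l α (γ t) * ((‖x‖ ^ 2 : ℝ) : ℂ) ^ (α / 2 - γ t))) := by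
  have hd : Nontrivial (EuclideanSpace ℝ (Fin d)) := ⟨x, 0, hx⟩
  have hσ : σ₁ ≤ σ₂ := (hγ₁ 0).trans (hγ₂ 0)
  obtain ⟨C, hC0, hC⟩ := norm_evalAt_le hV.1
  set k : EuclideanSpace ℝ (Fin d) → ℂ := fun z => ((‖x - z‖ ^ (α - d) : ℝ) : ℂ) with hk
  set Φ : EuclideanSpace ℝ (Fin d) → ℝ → ℂ := fun z t =>
    h t * (evalAt V z * ((‖z‖ ^ 2 : ℝ) : ℂ) ^ (-γ t) * k z) with hΦ
  have hkm : Measurable k := Complex.measurable_ofReal.comp (by fun_prop)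
  have hΦm : Measurable (Function.uncurry Φ) := by
    refine (hh.measurable.comp measurable_snd).mul
      ((((measurable_evalAt V).comp measurable_fst).mul ?_).mul (hkm.comp measurable_fst))
    exact Measurable.pow (Complex.measurable_ofReal.comp (by fun_prop))
      (hγ.measurable.comp measurable_snd).neg
  have hhi : Integrable (fun t => ‖h t‖) (volume.restrict (Set.Ioc u v)) :=
    (hh.norm.integrableOn_Icc).mono_set Set.Ioc_subset_Icc_self
  -- The two edge powers together dominate all intermediate powers of `‖z‖²`, whether `‖z‖` is small
  -- or large.
  have hdom := ((integrable_kernel (l := l) hα hαd hx hσ₁ (by linarith)).add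
    (integrable_kernel (l := l) hα hαd hx (by linarith) hσ₂)).const_mul C
  have hΦi : Integrable (Function.uncurry Φ) (volume.prod (volume.restrict (Set.Ioc u v))) := by
    refine (hdom.mul_prod hhi).mono' hΦm.aestronglyMeasurable ?_
    have h0 : ∀ᵐ z : EuclideanSpace ℝ (Fin d), z ≠ 0 :=
      (ae_ne_zero_and_norm_sq_ne_one hd).mono fun _ => And.left
    filter_upwards [Measure.quasiMeasurePreserving_fst.ae h0] with w hw
    obtain ⟨z, t⟩ := w
    have hz : z ≠ 0 := hw
    have h1 := norm_cpow_neg_le (r := ‖z‖ ^ 2) (by positivity) (hγ₁ t) (hγ₂ t)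
    have hp1 : 0 ≤ (‖z‖ ^ 2) ^ (-σ₁) := by positivity
    have h2 := norm_evalAt_mul_kernel_le (α := α) (x := x) hC hz
      (w := (((‖z‖ ^ 2) ^ (-σ₁) : ℝ) : ℂ)) (σ := σ₁) (M := 1)
      (by rw [Complex.norm_real, Real.norm_of_nonneg hp1, one_mul])
    have hp2 : 0 ≤ (‖z‖ ^ 2) ^ (-σ₂) := by positivity
    have h3 := norm_evalAt_mul_kernel_le (α := α) (x := x) hC hz
      (w := (((‖z‖ ^ 2) ^ (-σ₂) : ℝ) : ℂ)) (σ := σ₂) (M := 1)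
      (by rw [Complex.norm_real, Real.norm_of_nonneg hp2, one_mul])
    simp only [norm_mul, Complex.norm_real, Real.norm_of_nonneg hp1, mul_one] at h2
    simp only [norm_mul, Complex.norm_real, Real.norm_of_nonneg hp2, mul_one] at h3
    simp only [Function.uncurry, hΦ, hk, norm_mul, Complex.norm_real, Pi.add_apply]
    rw [mul_comm]
    refine mul_le_mul_of_nonneg_right ?_ (norm_nonneg _)
    calc _ ≤ ‖evalAt V z‖ * ((‖z‖ ^ 2) ^ (-σ₁) + (‖z‖ ^ 2) ^ (-σ₂)) * ‖‖x - z‖ ^ (α - d)‖ := by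
          gcongr
      _ ≤ _ := by linarith
  have hfib : ∀ z, ∫ t in Set.Ioc u v, Φ z t =
      evalAt V z * (∫ t in u..v, h t * ((‖z‖ ^ 2 : ℝ) : ℂ) ^ (-γ t)) * k z := by
    intro z
    rw [intervalIntegral.integral_of_le huv, ← integral_const_mul, ← integral_mul_const]
    refine integral_congr_ae (ae_of_all _ fun t => ?_)
    simp only [hΦ]; ring
  have hfib' : ∀ t, ((1 / rieszGamma d α : ℝ) : ℂ) * ∫ z, Φ z t =
      (2 : ℂ) ^ (-α : ℂ) * evalAt V x *
        (h t * (rieszRatio d l α (γ t) * ((‖x‖ ^ 2 : ℝ) : ℂ) ^ (α / 2 - γ t))) := by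
    intro t
    have := (RieszPair.cpow hα hαd hV hx (s := γ t) (by linarith [hγ₁ t]) (by linarith [hγ₂ t])).2
    simp only [hΦ, hk, integral_const_mul]
    rw [mul_left_comm, this]
    ring
  refine ⟨(hΦi.integral_prod_left).congr (ae_of_all _ hfib), ?_⟩
  have hcongr : ∫ z, evalAt V z * (∫ t in u..v, h t * ((‖z‖ ^ 2 : ℝ) : ℂ) ^ (-γ t)) * k z =
      ∫ z, ∫ t in Set.Ioc u v, Φ z t := integral_congr_ae (ae_of_all _ fun z => (hfib z).symm)
  change ((1 / rieszGamma d α : ℝ) : ℂ) *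
    ∫ z, evalAt V z * (∫ t in u..v, h t * ((‖z‖ ^ 2 : ℝ) : ℂ) ^ (-γ t)) * k z = _
  rw [hcongr, integral_integral_swap hΦi, ← integral_const_mul]
  simp only [hfib']
  rw [integral_const_mul, intervalIntegral.integral_of_le huv]

/-- Dominated convergence for Riesz potentials, with a majorant singular on the unit sphere. -/
theorem RieszPair.of_tendsto (hα : 0 < α) (hV : IsSolidHarmonic l V) (hx : x ≠ 0)
    {φ : ℝ → ℝ → ℂ} {ψ : ℝ → ℂ} {A : ℝ → ℂ} {c θ M : ℝ} (h1 : α + l < 2 * c) (h2 : 2 * c < d + l)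
    (hθ : 0 ≤ θ) (hθ1 : θ < 1) (hθx : ‖x‖ = 1 → θ < α)
    (hbd : ∀ r : ℝ, 0 < r → r ≠ 1 → ∀ T, 0 ≤ T →
      ‖φ T r‖ ≤ M * r ^ (-c) * ((1 + r) / |1 - r|) ^ θ)
    (hlim : ∀ r : ℝ, 0 < r → r ≠ 1 → Tendsto (fun T => φ T r) atTop (𝓝 (ψ r)))
    (hpair : ∀ T, 0 ≤ T → RieszPair α V x (φ T) (A T)) :
    (evalAt V x = 0 ∨ ∃ L, Tendsto A atTop (𝓝 L)) ∧
      ∀ L, (evalAt V x = 0 ∨ Tendsto A atTop (𝓝 L)) → RieszPair α V x ψ L := by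
  have hd : Nontrivial (EuclideanSpace ℝ (Fin d)) := ⟨x, 0, hx⟩
  obtain ⟨C, hC0, hC⟩ := norm_evalAt_le hV.1
  set f : ℝ → EuclideanSpace ℝ (Fin d) → ℂ := fun T z =>
    evalAt V z * φ T (‖z‖ ^ 2) * ((‖x - z‖ ^ (α - d) : ℝ) : ℂ) with hf
  set g : EuclideanSpace ℝ (Fin d) → ℂ := fun z =>
    evalAt V z * ψ (‖z‖ ^ 2) * ((‖x - z‖ ^ (α - d) : ℝ) : ℂ) with hg
  have hgood := ae_ne_zero_and_norm_sq_ne_one hd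
  have hdom := (integrable_sphere_weight hx (A := 2 * c - l) (B := d - α) (θ := θ) (by linarith)
    (by linarith) (by linarith) hθ hθ1 fun h => by linarith [hθx h]).const_mul (C * M)
  have hfb : ∀ T, 0 ≤ T → ∀ᵐ z, ‖f T z‖ ≤ C * M * (‖z‖ ^ (-(2 * c - l)) *
      ((1 + ‖z‖ ^ 2) / |1 - ‖z‖ ^ 2|) ^ θ * ‖x - z‖ ^ (-(d - α))) := by
    intro T hT
    filter_upwards [hgood] with z hz
    have hz0 : 0 < ‖z‖ := norm_pos_iff.2 hz.1
    refine (norm_evalAt_mul_kernel_le hC hz.1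
      (M := M * ((1 + ‖z‖ ^ 2) / |1 - ‖z‖ ^ 2|) ^ θ) (σ := c)
      ((hbd _ (by positivity) hz.2 T hT).trans_eq (by ring))).trans_eq (by ring)
  have hfl : ∀ᵐ z, Tendsto (fun T => f T z) atTop (𝓝 (g z)) := by
    filter_upwards [hgood] with z hz
    have hz0 : 0 < ‖z‖ := norm_pos_iff.2 hz.1
    exact ((hlim _ (by positivity) hz.2).const_mul _).mul_const _
  have hT0 : ∀ᶠ T : ℝ in atTop, 0 ≤ T := eventually_ge_atTop 0
  have hconv := tendsto_integral_filter_of_dominated_convergence _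
    (hT0.mono fun T hT => (hpair T hT).1.aestronglyMeasurable) (hT0.mono fun T hT => hfb T hT) hdom hfl
  have hseq : Tendsto (fun N : ℕ => (N : ℝ)) atTop atTop := tendsto_natCast_atTop_atTop
  have hgm : AEStronglyMeasurable g volume :=
    aestronglyMeasurable_of_tendsto_ae atTop
      (fun N : ℕ => (hpair N (Nat.cast_nonneg N)).1.aestronglyMeasurable)
      (hfl.mono fun z hz => hz.comp hseq)
  have hgi : Integrable g := by
    refine hdom.mono' hgm ?_
    have hall : ∀ᵐ z, ∀ N : ℕ, ‖f N z‖ ≤ C * M * (‖z‖ ^ (-(2 * c - l)) *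
      ((1 + ‖z‖ ^ 2) / |1 - ‖z‖ ^ 2|) ^ θ * ‖x - z‖ ^ (-(d - α))) :=
      ae_all_iff.2 fun N => hfb N (Nat.cast_nonneg N)
    filter_upwards [hall, hfl] with z h3 h4
    exact le_of_tendsto (h4.comp hseq).norm (Eventually.of_forall h3)
  -- Dominated convergence on the untransformed side forces the transformed truncations `A T` to
  -- converge wherever `V(x) ≠ 0`. No separate estimate of them at `‖x‖²` is needed, in particular
  -- not on the unit sphere.
  have hconv2 : Tendsto (fun T => (2 : ℂ) ^ (-α : ℂ) * evalAt V x * A T) atTop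
      (𝓝 (((1 / rieszGamma d α : ℝ) : ℂ) * ∫ z, g z)) := by
    refine (hconv.const_mul ((1 / rieszGamma d α : ℝ) : ℂ)).congr' ?_
    filter_upwards [hT0] with T hT
    exact (hpair T hT).2
  have h20 : (2 : ℂ) ^ (-α : ℂ) ≠ 0 := by
    rw [Ne, Complex.cpow_eq_zero_iff]; simp
  refine ⟨?_, fun L hL => ⟨hgi, tendsto_nhds_unique hconv2 ?_⟩⟩
  · by_cases hVx : evalAt V x = 0
    · exact Or.inl hVx
    · refine Or.inr ⟨_, (hconv2.const_mul ((2 : ℂ) ^ (-α : ℂ) * evalAt V x)⁻¹).congr fun T => ?_⟩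
      rw [inv_mul_cancel_left₀ (mul_ne_zero h20 hVx)]
  · rcases hL with hL | hL
    · simp [hL]
    · exact hL.const_mul _

end Kernel

/-! ### The parameters of the transformed function -/

section ShiftExtend

variable {k : ℕ} (x₀ : ℂ) (v : Fin k → ℂ) (c x₁ : ℂ)

@[simp] theorem shiftExtend_zero : shiftExtend x₀ v c x₁ 0 = x₀ := rfl

@[simp] theorem shiftExtend_succ_castSucc (j : Fin k) :
    shiftExtend x₀ v c x₁ j.castSucc.succ = v j + c := by
  simp [shiftExtend]

@[simp] theorem shiftExtend_last : shiftExtend x₀ v c x₁ (Fin.last (k + 1)) = x₁ := by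
  rw [← Fin.succ_last]
  simp only [shiftExtend, Fin.cons_succ, Fin.snoc_last]

theorem sum_re_shiftExtend :
    ∑ j, (shiftExtend x₀ v c x₁ j).re = x₀.re + ∑ j, (v j).re + k * c.re + x₁.re := by
  rw [Fin.sum_univ_succ, Fin.sum_univ_castSucc]
  simp [Finset.sum_add_distrib]
  ring

variable {x₀ v c x₁}

/-- The bound `i ≤ k` keeps `x₁` out of the leading group, so the first entry contributes to the
numerator and the last one to the denominator. -/
theorem exists_shiftExtend_lt_iff {i : ℕ} (hi : i ≤ k) {P : ℂ → Prop} :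
    (∃ j : Fin (k + 2), (j : ℕ) < i + 1 ∧ P (shiftExtend x₀ v c x₁ j)) ↔
      P x₀ ∨ ∃ j : Fin k, (j : ℕ) < i ∧ P (v j + c) := by
  constructor
  · rintro ⟨j, hj, h⟩
    induction j using Fin.cases with
    | zero => exact Or.inl h
    | succ j =>
      induction j using Fin.lastCases with
      | last => simp at hj; omega
      | cast j =>
        rw [shiftExtend_succ_castSucc] at h
        exact Or.inr ⟨j, by simpa using hj, h⟩
  · rintro (h | ⟨j, hj, h⟩)
    · exact ⟨0, by simp, h⟩
    · exact ⟨j.castSucc.succ, by simpa using hj, by rwa [shiftExtend_succ_castSucc]⟩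

theorem prod_shiftExtend_lt {i : ℕ} (hi : i ≤ k) (f : ℂ → ℂ) :
    ∏ j ∈ Finset.univ.filter (fun j : Fin (k + 2) => (j : ℕ) < i + 1),
        f (shiftExtend x₀ v c x₁ j) =
      f x₀ * ∏ j ∈ Finset.univ.filter (fun j : Fin k => (j : ℕ) < i), f (v j + c) := by
  rw [Finset.prod_filter, Finset.prod_filter, Fin.prod_univ_succ, Fin.prod_univ_castSucc]
  simp [hi]

theorem prod_shiftExtend_le {i : ℕ} (hi : i ≤ k) (f : ℂ → ℂ) :
    ∏ j ∈ Finset.univ.filter (fun j : Fin (k + 2) => i + 1 ≤ (j : ℕ)),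
        f (shiftExtend x₀ v c x₁ j) =
      (∏ j ∈ Finset.univ.filter (fun j : Fin k => i ≤ (j : ℕ)), f (v j + c)) * f x₁ := by
  rw [Finset.prod_filter, Finset.prod_filter, Fin.prod_univ_succ, Fin.prod_univ_castSucc]
  simp [hi]

end ShiftExtend

theorem mem_lowerPoles_shiftExtend {m q : ℕ} (hm : m ≤ q) {b : Fin q → ℂ} {x₀ c x₁ z : ℂ} :
    z ∈ lowerPoles (m + 1) (shiftExtend x₀ b c x₁) ↔
      (∃ k : ℕ, z = -x₀ - k) ∨ z + c ∈ lowerPoles m b := by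
  have := exists_shiftExtend_lt_iff (x₀ := x₀) (v := b) (c := c) (x₁ := x₁) hm
    (P := fun w => ∃ k : ℕ, z = -w - k)
  refine this.trans (or_congr Iff.rfl (exists_congr fun j => and_congr Iff.rfl
    (exists_congr fun k => ⟨fun h => ?_, fun h => ?_⟩)))
  · linear_combination h
  · linear_combination h

theorem mem_upperPoles_shiftExtend {n p : ℕ} (hn : n ≤ p) {a : Fin p → ℂ} {x₀ c x₁ z : ℂ} :
    z ∈ upperPoles (n + 1) (shiftExtend x₀ a c x₁) ↔
      (∃ k : ℕ, z = 1 - x₀ + k) ∨ z + c ∈ upperPoles n a := by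
  have := exists_shiftExtend_lt_iff (x₀ := x₀) (v := a) (c := c) (x₁ := x₁) hn
    (P := fun w => ∃ k : ℕ, z = 1 - w + k)
  refine this.trans (or_congr Iff.rfl (exists_congr fun j => and_congr Iff.rfl
    (exists_congr fun k => ⟨fun h => ?_, fun h => ?_⟩)))
  · linear_combination h
  · linear_combination h

/-- The upper parameters of the Riesz potential. -/
def rieszUpper (d l : ℕ) (α : ℝ) {p : ℕ} (a : Fin p → ℂ) : Fin (p + 2) → ℂ :=
  shiftExtend (1 - ((d : ℂ) + 2 * l - α) / 2) a (α / 2) (α / 2)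

/-- The lower parameters of the Riesz potential. -/
def rieszLower (d l : ℕ) (α : ℝ) {q : ℕ} (b : Fin q → ℂ) : Fin (q + 2) → ℂ :=
  shiftExtend 0 b (α / 2) (1 - ((d : ℂ) + 2 * l) / 2)

section Riesz

variable {d l m n p q : ℕ} {α : ℝ} {a : Fin p → ℂ} {b : Fin q → ℂ}

/-- Together with the shift of the abscissa to `c - α/2`, the decay exponent `ν + (p-q)(c-1/2)`
grows by exactly `α`, so admissibility and positivity are preserved. -/
theorem meijerNu_riesz :
    meijerNu (rieszUpper d l α a) (rieszLower d l α b)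
      = meijerNu a b + α + ((p : ℝ) - q) * (α / 2) := by
  simp only [meijerNu, rieszUpper, rieszLower, sum_re_shiftExtend]
  have e1 : ((α : ℂ) / 2).re = α / 2 := by
    rw [show (α : ℂ) / 2 = ((α / 2 : ℝ) : ℂ) by push_cast; ring, Complex.ofReal_re]
  have e2 : (1 - ((d : ℂ) + 2 * l - α) / 2).re = 1 - ((d : ℝ) + 2 * l - α) / 2 := by
    rw [show (1 - ((d : ℂ) + 2 * l - α) / 2) = ((1 - ((d : ℝ) + 2 * l - α) / 2 : ℝ) : ℂ) by
      push_cast; ring, Complex.ofReal_re]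
  have e3 : (1 - ((d : ℂ) + 2 * l) / 2).re = 1 - ((d : ℝ) + 2 * l) / 2 := by
    rw [show (1 - ((d : ℂ) + 2 * l) / 2) = ((1 - ((d : ℝ) + 2 * l) / 2 : ℝ) : ℂ) by
      push_cast; ring, Complex.ofReal_re]
  rw [e1, e2, e3, Complex.zero_re]
  ring

/-- The shift by `α/2` of the old parameters cancels the translation of `s`. The four added
parameters give the four gamma functions of `rieszRatio`, two in the numerator and two in the
denominator. -/
theorem meijerMellin_riesz (hm : m ≤ q) (hn : n ≤ p) (s : ℂ) :
    meijerMellin (m + 1) (n + 1) (rieszUpper d l α a) (rieszLower d l α b) (s - α / 2)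
      = rieszRatio d l α s * meijerMellin m n a b s := by
  unfold meijerMellin rieszUpper rieszLower rieszRatio
  rw [prod_shiftExtend_lt hm (fun w => Complex.Gamma (w + (s - α / 2))),
    prod_shiftExtend_lt hn (fun w => Complex.Gamma (1 - w - (s - α / 2))),
    prod_shiftExtend_le hm (fun w => Complex.Gamma (1 - w - (s - α / 2))),
    prod_shiftExtend_le hn (fun w => Complex.Gamma (w + (s - α / 2)))]
  have e1 : ∀ w : ℂ, w + α / 2 + (s - α / 2) = w + s := fun w => by ring
  have e2 : ∀ w : ℂ, 1 - (w + α / 2) - (s - α / 2) = 1 - w - s := fun w => by ring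
  have e3 : (1 : ℂ) - (1 - ((d : ℂ) + 2 * l - α) / 2) - (s - α / 2) = (d : ℂ) / 2 + l - s := by ring
  have e4 : (1 : ℂ) - (1 - ((d : ℂ) + 2 * l) / 2) - (s - α / 2) = α / 2 + ((d : ℂ) / 2 + l - s) := by
    ring
  have e5 : (α : ℂ) / 2 + (s - α / 2) = s := by ring
  simp only [e1, e2, e3, e4, e5, zero_add]
  rw [div_mul_div_comm]
  congr 1 <;> ring

theorem meijerIntegrand_riesz (hm : m ≤ q) (hn : n ≤ p) (r : ℝ) (s : ℂ) :
    meijerIntegrand (m + 1) (n + 1) (rieszUpper d l α a) (rieszLower d l α b) r (s - α / 2)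
      = meijerMellin m n a b s * (rieszRatio d l α s * (r : ℂ) ^ (α / 2 - s)) := by
  rw [meijerIntegrand, meijerMellin_riesz hm hn, neg_sub]
  ring

/-- The added parameter 0 creates poles only at `α/2 - k` in the original variable, to the left of
the region considered. -/
theorem mem_lowerPoles_riesz (hm : m ≤ q) {z : ℂ} (hz : α < 2 * z.re) :
    z - α / 2 ∈ lowerPoles (m + 1) (rieszLower d l α b) ↔ z ∈ lowerPoles m b := by
  rw [rieszLower, mem_lowerPoles_shiftExtend hm, sub_add_cancel, or_iff_right]
  rintro ⟨k, hk⟩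
  have h1 : z = ((α / 2 - k : ℝ) : ℂ) := by push_cast; linear_combination hk
  rw [h1, Complex.ofReal_re] at hz
  have : (0 : ℝ) ≤ k := Nat.cast_nonneg k
  linarith

theorem mem_upperPoles_riesz (hn : n ≤ p) {z : ℂ} (hz : 2 * z.re < d + 2 * l) :
    z - α / 2 ∈ upperPoles (n + 1) (rieszUpper d l α a) ↔ z ∈ upperPoles n a := by
  rw [rieszUpper, mem_upperPoles_shiftExtend hn, sub_add_cancel, or_iff_right]
  rintro ⟨k, hk⟩
  have h1 : z = (((d + 2 * l) / 2 + k : ℝ) : ℂ) := by push_cast; linear_combination hk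
  rw [h1, Complex.ofReal_re] at hz
  have : (0 : ℝ) ≤ k := Nat.cast_nonneg k
  linarith

/-- There are four kinds of pairs. Two new parameters are excluded by `α < d`, a new one against an
old one by the bound on the old one, and two old ones by the original assumption since their shifts
cancel. -/
theorem MeijerParams.riesz (hαd : α < d) (hab : MeijerParams m n a b)
    (hb : ∀ j : Fin q, (j : ℕ) < m → -2 * (b j).re < d + l)
    (ha : ∀ j : Fin p, (j : ℕ) < n → α + l < 2 * (1 - (a j).re)) :
    MeijerParams (m + 1) (n + 1) (rieszUpper d l α a) (rieszLower d l α b) := by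
  have hl : (0 : ℝ) ≤ l := Nat.cast_nonneg l
  refine ⟨by have := hab.m_le; omega, by have := hab.n_le; omega, fun i hi j hj k hk => ?_⟩
  have hk0 : (0 : ℝ) ≤ k := Nat.cast_nonneg k
  have hi' := (exists_shiftExtend_lt_iff (x₀ := 0) (v := b) (c := α / 2)
    (x₁ := 1 - ((d : ℂ) + 2 * l) / 2) hab.m_le
    (P := fun w => rieszLower d l α b i = w)).1 ⟨i, hi, rfl⟩
  have hj' := (exists_shiftExtend_lt_iff (x₀ := 1 - ((d : ℂ) + 2 * l - α) / 2) (v := a) (c := α / 2)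
    (x₁ := α / 2) hab.n_le (P := fun w => rieszUpper d l α a j = w)).1 ⟨j, hj, rfl⟩
  rcases hi' with hi' | ⟨i', hi'm, hi'⟩ <;> rcases hj' with hj' | ⟨j', hj'n, hj'⟩ <;>
    rw [hi', hj'] at hk
  · have : ((-(d + 2 * l - α) / 2 : ℝ) : ℂ) = ((k : ℝ) : ℂ) := by
      push_cast; linear_combination hk
    have := Complex.ofReal_injective this
    linarith
  · have h1 : a j' = ((k + 1 - α / 2 : ℝ) : ℂ) := by push_cast; linear_combination hk
    have := ha j' hj'n
    rw [h1, Complex.ofReal_re] at this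
    linarith
  · have h1 : b i' = ((-(d + 2 * l) / 2 - k : ℝ) : ℂ) := by push_cast; linear_combination -hk
    have := hb i' hi'm
    rw [h1, Complex.ofReal_re] at this
    linarith
  · exact hab.no_common_pole i' hi'm j' hj'n k (by linear_combination hk)

theorem lowerPoles_riesz_inter (hm : m ≤ q) {c : ℝ} (hc : α < 2 * c) :
    {z ∈ lowerPoles (m + 1) (rieszLower d l α b) | c - α / 2 < z.re}
      = (fun z : ℂ => z - α / 2) '' {z ∈ lowerPoles m b | c < z.re} := by
  have hre : ∀ z : ℂ, (z - α / 2).re = z.re - α / 2 := fun z => by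
    rw [show (α : ℂ) / 2 = ((α / 2 : ℝ) : ℂ) by push_cast; ring, Complex.sub_re, Complex.ofReal_re]
  ext z
  constructor
  · rintro ⟨h1, h2⟩
    have h3 := hre (z + α / 2)
    rw [add_sub_cancel_right] at h3
    refine ⟨z + α / 2, ⟨?_, by linarith⟩, by simp⟩
    rwa [← mem_lowerPoles_riesz (d := d) (l := l) (α := α) hm (by linarith), add_sub_cancel_right]
  · rintro ⟨w, ⟨h1, h2⟩, rfl⟩
    exact ⟨(mem_lowerPoles_riesz hm (by linarith)).2 h1, by simp only [hre]; linarith⟩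

theorem upperPoles_riesz_inter (hn : n ≤ p) {c : ℝ} (hc : 2 * c < d + 2 * l) :
    {z ∈ upperPoles (n + 1) (rieszUpper d l α a) | z.re < c - α / 2}
      = (fun z : ℂ => z - α / 2) '' {z ∈ upperPoles n a | z.re < c} := by
  have hre : ∀ z : ℂ, (z - α / 2).re = z.re - α / 2 := fun z => by
    rw [show (α : ℂ) / 2 = ((α / 2 : ℝ) : ℂ) by push_cast; ring, Complex.sub_re, Complex.ofReal_re]
  ext z
  constructor
  · rintro ⟨h1, h2⟩
    have h3 := hre (z + α / 2)
    rw [add_sub_cancel_right] at h3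
    refine ⟨z + α / 2, ⟨?_, by linarith⟩, by simp⟩
    rwa [← mem_upperPoles_riesz (d := d) (l := l) (α := α) hn (by linarith), add_sub_cancel_right]
  · rintro ⟨w, ⟨h1, h2⟩, rfl⟩
    exact ⟨(mem_upperPoles_riesz hn (by linarith)).2 h1, by simp only [hre]; linarith⟩

theorem meijerResidues_riesz (hm : m ≤ q) (hn : n ≤ p) {c : ℝ} (hc : α < 2 * c)
    (hc' : 2 * c < d + 2 * l) (r : ℝ) :
    meijerResidues (m + 1) (n + 1) (rieszUpper d l α a) (rieszLower d l α b) r (c - α / 2)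
      = ∑ᶠ z ∈ {z ∈ lowerPoles m b | c < z.re}, residueAt (meijerIntegrand (m + 1) (n + 1)
          (rieszUpper d l α a) (rieszLower d l α b) r) (z - α / 2)
        - ∑ᶠ z ∈ {z ∈ upperPoles n a | z.re < c}, residueAt (meijerIntegrand (m + 1) (n + 1)
          (rieszUpper d l α a) (rieszLower d l α b) r) (z - α / 2) := by
  have hinj : Function.Injective fun z : ℂ => z - α / 2 := sub_left_injective
  rw [meijerResidues, lowerPoles_riesz_inter hm hc, upperPoles_riesz_inter hn hc',
    finsum_mem_image hinj.injOn, finsum_mem_image hinj.injOn]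

theorem IsAbscissa.riesz (hα : 0 < α) (hm : m ≤ q) (hn : n ≤ p) {c : ℝ}
    (hc : α < 2 * c) (hc' : 2 * c < d + 2 * l) (h : IsAbscissa m n a b c) :
    IsAbscissa (m + 1) (n + 1) (rieszUpper d l α a) (rieszLower d l α b) (c - α / 2) := by
  have hre : ∀ z : ℂ, (z + α / 2).re = z.re + α / 2 := fun z => by
    rw [show (α : ℂ) / 2 = ((α / 2 : ℝ) : ℂ) by push_cast; ring, Complex.add_re, Complex.ofReal_re]
  refine ⟨fun z hz hzc => ?_, fun z hz hzc => ?_, fun hCD => ?_⟩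
  · have h1 := hre z
    rw [← add_sub_cancel_right z ((α : ℂ) / 2), mem_lowerPoles_riesz hm (by linarith)] at hz
    exact h.1 _ hz (by linarith)
  · have h1 := hre z
    rw [← add_sub_cancel_right z ((α : ℂ) / 2), mem_upperPoles_riesz hn (by linarith)] at hz
    exact h.2.1 _ hz (by linarith)
  · have := h.2.2 (by unfold ConditionC ConditionD at *; omega)
    rw [meijerNu_riesz]
    push_cast
    linarith

end Riesz

/-! ### Riesz potentials of lines and residues -/

section RieszMeijer

variable {d l m n p q : ℕ} {α : ℝ} {a : Fin p → ℂ} {b : Fin q → ℂ}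
  {V : MvPolynomial (Fin d) ℂ} {x : EuclideanSpace ℝ (Fin d)}

theorem rieszPair_meijerLine (hα : 0 < α) (hαd : α < d) (hV : IsSolidHarmonic l V) (hx : x ≠ 0)
    (hm : m ≤ q) (hn : n ≤ p) {c : ℝ} (h1 : α + l < 2 * c) (h2 : 2 * c < d + l)
    (hl : ∀ z ∈ lowerPoles m b, z.re ≠ c) (hu : ∀ z ∈ upperPoles n a, z.re ≠ c)
    {T : ℝ} (hT : 0 ≤ T) :
    RieszPair α V x (fun r => meijerLine m n a b r c T)
      (meijerLine (m + 1) (n + 1) (rieszUpper d l α a) (rieszLower d l α b) (‖x‖ ^ 2)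
        (c - α / 2) T) := by
  have key := RieszPair.integral_path hα hαd hV hx (σ₁ := c) (σ₂ := c)
    (h := fun t => (2 * Real.pi : ℂ)⁻¹ * meijerMellin m n a b (c + t * Complex.I))
    (γ := fun t => c + t * Complex.I)
    (continuous_const.mul (continuous_meijerMellin_vertical hl hu)) (by fun_prop) h1 h2
    (by simp) (by simp) (by linarith : -T ≤ T)
  have e1 : (∫ t in (-T)..T, (2 * Real.pi : ℂ)⁻¹ * meijerMellin m n a b (c + t * Complex.I) *
      (rieszRatio d l α (c + t * Complex.I) *
        ((‖x‖ ^ 2 : ℝ) : ℂ) ^ (α / 2 - (c + t * Complex.I)))) =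
      meijerLine (m + 1) (n + 1) (rieszUpper d l α a) (rieszLower d l α b) (‖x‖ ^ 2)
        (c - α / 2) T := by
    rw [meijerLine, ← intervalIntegral.integral_const_mul]
    refine intervalIntegral.integral_congr fun t _ => ?_
    have e2 : ((c - α / 2 : ℝ) : ℂ) + t * Complex.I = c + t * Complex.I - α / 2 := by
      push_cast; ring
    simp only [e2, meijerIntegrand_riesz hm hn]
    ring
  rw [e1] at key
  refine key.congr hx fun r _ _ => ?_
  rw [meijerLine, ← intervalIntegral.integral_const_mul]
  refine intervalIntegral.integral_congr fun t _ => ?_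
  simp only [meijerIntegrand]
  ring

theorem exists_closedBall_forall_notMem_poles (m n : ℕ) (a : Fin p → ℂ) (b : Fin q → ℂ)
    {u v : ℝ} {z : ℂ} (hu : u < z.re) (hv : z.re < v) :
    ∃ ρ > 0, ∃ σ₁ σ₂ : ℝ, u < σ₁ ∧ σ₂ < v ∧ ∀ w ∈ Metric.closedBall z ρ, σ₁ ≤ w.re ∧ w.re ≤ σ₂ ∧
      (w ≠ z → w ∉ lowerPoles m b ∧ w ∉ upperPoles n a) := by
  set Q : Set ℂ := ({w ∈ lowerPoles m b | u < w.re} ∪ {w ∈ upperPoles n a | w.re < v}) \ {z}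
  have hQ : Q.Finite := ((finite_lowerPoles_lt m b u).union (finite_upperPoles_lt n a v)).sdiff
  have hz : Qᶜ ∈ 𝓝 z := hQ.isClosed.isOpen_compl.mem_nhds fun h => h.2 rfl
  obtain ⟨ε, hε, hball⟩ := Metric.nhds_basis_closedBall.mem_iff.1 hz
  set ρ := min ε (min ((z.re - u) / 2) ((v - z.re) / 2)) with hρ
  have r1 : ρ ≤ ε := min_le_left _ _
  have r2 : ρ ≤ (z.re - u) / 2 := (min_le_right _ _).trans (min_le_left _ _)
  have r3 : ρ ≤ (v - z.re) / 2 := (min_le_right _ _).trans (min_le_right _ _)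
  have hρ0 : 0 < ρ := lt_min hε (lt_min (by linarith) (by linarith))
  refine ⟨ρ, hρ0, z.re - ρ, z.re + ρ, by linarith, by linarith, fun w hw => ?_⟩
  have hre := (Complex.abs_re_le_norm (w - z)).trans (mem_closedBall_iff_norm.1 hw)
  rw [Complex.sub_re, abs_le] at hre
  refine ⟨by linarith, by linarith, fun hwz => ⟨fun h => ?_, fun h => ?_⟩⟩
  · exact hball (Metric.closedBall_subset_closedBall r1 hw)
      ⟨Or.inl ⟨h, by linarith⟩, hwz⟩
  · exact hball (Metric.closedBall_subset_closedBall r1 hw)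
      ⟨Or.inr ⟨h, by linarith⟩, hwz⟩

/-- The residue is an integral over a small circle inside the strip, to which the Fubini lemma for
compact paths applies. The circle translated by `-α/2` computes the residue of the transformed
integrand, whose new poles it does not meet. -/
theorem rieszPair_residueAt (hα : 0 < α) (hαd : α < d) (hV : IsSolidHarmonic l V) (hx : x ≠ 0)
    (hm : m ≤ q) (hn : n ≤ p) {z : ℂ} (h1 : α + l < 2 * z.re) (h2 : 2 * z.re < d + l) :
    RieszPair α V x (fun r => residueAt (meijerIntegrand m n a b r) z)
      (residueAt (meijerIntegrand (m + 1) (n + 1) (rieszUpper d l α a) (rieszLower d l α b)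
        (‖x‖ ^ 2)) (z - α / 2)) := by
  have hl0 : (0 : ℝ) ≤ l := Nat.cast_nonneg l
  obtain ⟨ρ, hρ, σ₁, σ₂, hσ₁, hσ₂, hball⟩ := exists_closedBall_forall_notMem_poles m n a b
    (u := (α + l) / 2) (v := (d + l) / 2) (z := z) (by linarith) (by linarith)
  have hcirc : ∀ t, circleMap z ρ t ∈ Metric.closedBall z ρ := fun t =>
    circleMap_mem_closedBall z hρ.le t
  have hne : ∀ t, circleMap z ρ t ≠ z := fun t => circleMap_ne_center hρ.ne'
  have hcont : Continuous fun t => meijerMellin m n a b (circleMap z ρ t) :=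
    continuous_iff_continuousAt.2 fun t => by
      have h3 := (hball _ (hcirc t)).2.2 (hne t)
      exact (differentiableAt_meijerMellin h3.1 h3.2).continuousAt.comp
        (continuous_circleMap z ρ).continuousAt
  have key := RieszPair.integral_path hα hαd hV hx (σ₁ := σ₁) (σ₂ := σ₂)
    (h := fun t => (2 * Real.pi * Complex.I)⁻¹ *
      (circleMap 0 ρ t * Complex.I * meijerMellin m n a b (circleMap z ρ t)))
    (γ := circleMap z ρ)
    (continuous_const.mul (((continuous_circleMap 0 ρ).mul continuous_const).mul hcont))
    (continuous_circleMap z ρ) (by linarith) (by linarith) (fun t => (hball _ (hcirc t)).1)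
    (fun t => (hball _ (hcirc t)).2.1) (by positivity : (0 : ℝ) ≤ 2 * Real.pi)
  have hres : ∀ r : ℝ, 0 < r → residueAt (meijerIntegrand m n a b r) z =
      ∫ t in (0 : ℝ)..(2 * Real.pi), (2 * Real.pi * Complex.I)⁻¹ *
        (circleMap 0 ρ t * Complex.I * meijerMellin m n a b (circleMap z ρ t)) *
        (r : ℂ) ^ (-circleMap z ρ t) := by
    intro r hr
    rw [residueAt_eq_circleIntegral hρ fun w hw hwz => differentiableAt_meijerIntegrand hr
      ((hball w hw).2.2 hwz).1 ((hball w hw).2.2 hwz).2, circleIntegral,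
      ← intervalIntegral.integral_const_mul]
    refine intervalIntegral.integral_congr fun t _ => ?_
    simp only [deriv_circleMap, meijerIntegrand, smul_eq_mul]
    ring
  have hx0 : 0 < ‖x‖ ^ 2 := by have := norm_pos_iff.2 hx; positivity
  have hres' : residueAt (meijerIntegrand (m + 1) (n + 1) (rieszUpper d l α a) (rieszLower d l α b)
        (‖x‖ ^ 2)) (z - α / 2) =
      ∫ t in (0 : ℝ)..(2 * Real.pi), (2 * Real.pi * Complex.I)⁻¹ *
        (circleMap 0 ρ t * Complex.I * meijerMellin m n a b (circleMap z ρ t)) *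
        (rieszRatio d l α (circleMap z ρ t) * ((‖x‖ ^ 2 : ℝ) : ℂ) ^ (α / 2 - circleMap z ρ t)) := by
    rw [residueAt_eq_circleIntegral hρ fun w hw hwz => ?_, circleIntegral,
      ← intervalIntegral.integral_const_mul]
    · refine intervalIntegral.integral_congr fun t _ => ?_
      have e1 : circleMap (z - α / 2) ρ t = circleMap z ρ t - α / 2 := by
        simp only [circleMap]; ring
      simp only [deriv_circleMap, e1, meijerIntegrand_riesz hm hn, smul_eq_mul]
      ring
    · have hw' : w + α / 2 ∈ Metric.closedBall z ρ := by
        rw [mem_closedBall_iff_norm] at hw ⊢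
        rwa [show w + (α : ℂ) / 2 - z = w - (z - α / 2) by ring]
      obtain ⟨h3, h4, h5⟩ := hball _ hw'
      have h6 := h5 fun h => hwz (by rw [← h]; ring)
      have h7 : w = w + α / 2 - α / 2 := by ring
      refine differentiableAt_meijerIntegrand hx0 ?_ ?_
      · rw [h7, mem_lowerPoles_riesz hm (by linarith)]
        exact h6.1
      · rw [h7, mem_upperPoles_riesz hn (by linarith)]
        exact h6.2
  rw [hres']
  exact key.congr hx fun r hr _ => (hres r hr).symm

/-- A pole on the wrong side of the line is bounded on one side by `c` and on the other by the
parameter hypothesis, hence lies in the strip. -/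
theorem rieszPair_meijerResidues (hα : 0 < α) (hαd : α < d) (hV : IsSolidHarmonic l V) (hx : x ≠ 0)
    (hm : m ≤ q) (hn : n ≤ p) {c : ℝ} (h1 : α + l < 2 * c) (h2 : 2 * c < d + l)
    (hb : ∀ z ∈ lowerPoles m b, 2 * z.re < d + l)
    (ha : ∀ z ∈ upperPoles n a, α + l < 2 * z.re) :
    RieszPair α V x (fun r => meijerResidues m n a b r c)
      (meijerResidues (m + 1) (n + 1) (rieszUpper d l α a) (rieszLower d l α b) (‖x‖ ^ 2)
        (c - α / 2)) := by
  have hl0 : (0 : ℝ) ≤ l := Nat.cast_nonneg l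
  rw [meijerResidues_riesz hm hn (by linarith) (by linarith)]
  simp only [meijerResidues]
  simp only [finsum_mem_eq_finite_toFinset_sum _ (finite_lowerPoles_lt m b c),
    finsum_mem_eq_finite_toFinset_sum _ (finite_upperPoles_lt n a c)]
  refine RieszPair.sub (RieszPair.sum _ fun z hz => ?_) (RieszPair.sum _ fun z hz => ?_) <;>
    rw [Set.Finite.mem_toFinset] at hz
  · exact rieszPair_residueAt hα hαd hV hx hm hn (by linarith [hz.2]) (hb z hz.1)
  · exact rieszPair_residueAt hα hαd hV hx hm hn (ha z hz.1) (by linarith [hz.2])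

theorem rieszPair_meijerG (hα : 0 < α) (hαd : α < d) (hV : IsSolidHarmonic l V) (hx : x ≠ 0)
    (hab : MeijerParams m n a b)
    (hb : ∀ j : Fin q, (j : ℕ) < m → -2 * (b j).re < d + l)
    (ha : ∀ j : Fin p, (j : ℕ) < n → α + l < 2 * (1 - (a j).re))
    {c : ℝ} (hc : IsAbscissa m n a b c) (h1 : α + l < 2 * c) (h2 : 2 * c < d + l)
    (hcond : ConditionA m n p q ∨ (ConditionB m n p q ∧ 0 < meijerNu a b) ∨
      ConditionC m n p q ∨ ConditionD m n p q)
    {θ : ℝ} (hθ : 0 ≤ θ) (hθ1 : θ < 1) (hθx : ‖x‖ = 1 → θ < α)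
    (hest : MeijerLineEstimate m n a b c θ) :
    RieszPair α V x (meijerG m n a b)
      (meijerG (m + 1) (n + 1) (rieszUpper d l α a) (rieszLower d l α b) (‖x‖ ^ 2)) := by
  have hl0 : (0 : ℝ) ≤ l := Nat.cast_nonneg l
  have hm := hab.m_le
  have hn := hab.n_le
  have hx0 : 0 < ‖x‖ ^ 2 := by have := norm_pos_iff.2 hx; positivity
  obtain ⟨⟨M, -, hM⟩, hlim⟩ := hest
  choose! A hA using hlim
  have hG : ∀ r : ℝ, 0 < r → r ≠ 1 → A r + meijerResidues m n a b r c = meijerG m n a b r :=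
    fun r hr hr1 => (meijerG_eq_of_tendsto hab hc hcond hr (hA r hr hr1)).symm
  have hcond' : ConditionA (m + 1) (n + 1) (p + 2) (q + 2) ∨
      (ConditionB (m + 1) (n + 1) (p + 2) (q + 2) ∧
        0 < meijerNu (rieszUpper d l α a) (rieszLower d l α b)) ∨
      ConditionC (m + 1) (n + 1) (p + 2) (q + 2) ∨ ConditionD (m + 1) (n + 1) (p + 2) (q + 2) := by
    rcases hcond with h | ⟨h, hν⟩ | h | h
    · left; unfold ConditionA at *; omega
    · right; left
      refine ⟨by unfold ConditionB at *; omega, ?_⟩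
      have hpq : (p : ℝ) - q = 0 := sub_eq_zero.2 (by exact_mod_cast h.2)
      rw [meijerNu_riesz, hpq]
      linarith
    · right; right; left; unfold ConditionC at *; omega
    · right; right; right; unfold ConditionD at *; omega
  have hres := rieszPair_meijerResidues (a := a) (b := b) hα hαd hV hx hm hn h1 h2
    (by
      rintro z ⟨j, hj, k, rfl⟩
      have := hb j hj
      have hk : (0 : ℝ) ≤ k := Nat.cast_nonneg k
      simp only [Complex.sub_re, Complex.neg_re, Complex.natCast_re]
      linarith)
    (by
      rintro z ⟨j, hj, k, rfl⟩
      have := ha j hj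
      have hk : (0 : ℝ) ≤ k := Nat.cast_nonneg k
      simp only [Complex.add_re, Complex.sub_re, Complex.one_re, Complex.natCast_re]
      linarith)
  obtain ⟨hex, hval⟩ := RieszPair.of_tendsto hα hV hx h1 h2 hθ hθ1 hθx
    (φ := fun T r => meijerLine m n a b r c T) hM hA
    (fun T hT => rieszPair_meijerLine hα hαd hV hx hm hn h1 h2 hc.1 hc.2.1 hT)
  rcases hex with hVx | ⟨L, hL⟩
  · exact (((hval 0 (Or.inl hVx)).add hres).congr hx hG).congr_value (Or.inr hVx)
  · rw [meijerG_eq_of_tendsto (hab.riesz hαd hb ha)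
      (hc.riesz hα hm hn (by linarith) (by linarith)) hcond' hx0 hL]
    exact ((hval L (Or.inr hL)).add hres).congr hx hG

end RieszMeijer

/-! ### From the indices in the extended reals to abscissae -/

section Indices

variable {l m n p q : ℕ} {a : Fin p → ℂ} {b : Fin q → ℂ}

theorem EReal.two_mul_le_two_mul {u v : EReal} (h : u ≤ v) : 2 * u ≤ 2 * v :=
  mul_le_mul_of_nonneg_left h (by norm_num)

theorem lt_of_coe_lt_two_mul {y t : ℝ} {u : EReal} (h : (y : EReal) < 2 * u) (hu : u ≤ (t : EReal)) :
    y < 2 * t := by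
  have h1 : (y : EReal) < ((2 * t : ℝ) : EReal) :=
    (h.trans_le (EReal.two_mul_le_two_mul hu)).trans_eq (by push_cast; rfl)
  exact EReal.coe_lt_coe_iff.1 h1

theorem lt_of_two_mul_lt_coe {y t : ℝ} {u : EReal} (h : 2 * u < (y : EReal)) (hu : (t : EReal) ≤ u) :
    2 * t < y := by
  have h1 : ((2 * t : ℝ) : EReal) < (y : EReal) :=
    lt_of_le_of_lt ((by push_cast; rfl : ((2 * t : ℝ) : EReal) = 2 * (t : EReal)).trans_le
      (EReal.two_mul_le_two_mul hu)) h
  exact EReal.coe_lt_coe_iff.1 h1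

theorem one_sub_aUpper_le {j : Fin p} (hj : (j : ℕ) < n) :
    1 - aUpper n a ≤ ((1 - (a j).re : ℝ) : EReal) := by
  have h : ((a j).re : EReal) ≤ aUpper n a :=
    le_iSup (fun j : {j : Fin p // (j : ℕ) < n} => ((a j).re : EReal)) ⟨j, hj⟩
  rw [EReal.coe_sub, EReal.coe_one]
  exact EReal.sub_le_sub le_rfl h

theorem le_neg_bLower {j : Fin q} (hj : (j : ℕ) < m) :
    ((-(b j).re : ℝ) : EReal) ≤ -bLower m b := by
  have h : bLower m b ≤ ((b j).re : EReal) :=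
    iInf_le (fun j : {j : Fin q // (j : ℕ) < m} => ((b j).re : EReal)) ⟨j, hj⟩
  rw [EReal.coe_neg]
  exact EReal.neg_le_neg_iff.2 h

theorem lambdaUpper_le : lambdaUpper m n a b ≤ 1 - aUpper n a := by
  unfold lambdaUpper
  split_ifs
  · exact min_le_left _ _
  · exact le_rfl

theorem neg_bLower_le : -bLower m b ≤ lambdaLower m n a b := by
  unfold lambdaLower
  split_ifs
  · exact le_max_left _ _
  · exact le_rfl

/-- An admissible abscissa with absolute integrability in the strip `u < Re s < v`. -/
theorem exists_isAbscissa {u v : ℝ} (huv : u < v)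
    (hC : ConditionC m n p q → u < 1 / 2 + (meijerNu a b - 1) / ((q : ℝ) - p))
    (hD : ConditionD m n p q → 1 / 2 - (meijerNu a b - 1) / ((p : ℝ) - q) < v) :
    ∃ c, u < c ∧ c < v ∧ IsAbscissa m n a b c := by
  by_cases h : ConditionC m n p q
  · have hpq : (0 : ℝ) < (q : ℝ) - p := sub_pos.2 (by exact_mod_cast h.2)
    obtain ⟨c, ⟨h1, h2⟩, h3, h4⟩ := exists_mem_Ioo_forall_poles_re_ne m n a b (lt_min huv (hC h))
    refine ⟨c, h1, h2.trans_le (min_le_left _ _), h3, h4, fun _ => ?_⟩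
    have h5 := h2.trans_le (min_le_right _ _)
    have h6 : c - 1 / 2 < (meijerNu a b - 1) / ((q : ℝ) - p) := by linarith
    rw [lt_div_iff₀ hpq] at h6
    linarith
  by_cases h' : ConditionD m n p q
  · have hpq : (0 : ℝ) < (p : ℝ) - q := sub_pos.2 (by exact_mod_cast h'.2)
    obtain ⟨c, ⟨h1, h2⟩, h3, h4⟩ := exists_mem_Ioo_forall_poles_re_ne m n a b (max_lt huv (hD h'))
    refine ⟨c, (le_max_left _ _).trans_lt h1, h2, h3, h4, fun _ => ?_⟩
    have h5 := (le_max_right _ _).trans_lt h1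
    have h6 : 1 / 2 - c < (meijerNu a b - 1) / ((p : ℝ) - q) := by linarith
    rw [lt_div_iff₀ hpq] at h6
    linarith
  · obtain ⟨c, ⟨h1, h2⟩, h3, h4⟩ := exists_mem_Ioo_forall_poles_re_ne m n a b huv
    exact ⟨c, h1, h2, h3, h4, fun h5 => (h5.elim h h').elim⟩

/-- `P` will be `‖x‖ = 1`, the case in which the weight exponent must also stay below `α`. -/
theorem exists_meijerLineEstimate (hab : MeijerParams m n a b) {c α : ℝ} {P : Prop} (hα : 0 < α)
    (hc : IsAbscissa m n a b c)
    (hcond : ConditionA m n p q ∨ (ConditionB m n p q ∧ 0 < meijerNu a b) ∨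
      ConditionC m n p q ∨ ConditionD m n p q)
    (hP : ConditionB m n p q → P → 1 < meijerNu a b + α) :
    ∃ θ : ℝ, 0 ≤ θ ∧ θ < 1 ∧ (P → θ < α) ∧ MeijerLineEstimate m n a b c θ := by
  have habs : ∀ κ : ℝ, 1 < κ → MeijerDecay m n a b κ c c →
      ∃ θ : ℝ, 0 ≤ θ ∧ θ < 1 ∧ (P → θ < α) ∧ MeijerLineEstimate m n a b c θ := fun κ hκ h =>
    ⟨0, le_rfl, one_pos, fun _ => hα,
      meijerLineEstimate_zero hab.m_le hab.n_le hc.1 hc.2.1 hκ h⟩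
  rcases hcond with h | ⟨h, hν⟩ | h
  · exact habs 2 one_lt_two (Or.inl h)
  · obtain ⟨e, he0, he1, heν, heP⟩ : ∃ e : ℝ, 0 < e ∧ e < 1 ∧ e ≤ meijerNu a b ∧
        (P → 1 - e < α) := by
      by_cases hP' : P
      · have := hP h hP'
        -- With `θ = 1 - e`, the constraint `θ < α` reads `e > 1 - α`; the interval is nonempty
        -- precisely because `ν + α > 1`, `ν > 0` and `α > 0`.
        obtain ⟨e, h1, h2⟩ := exists_between
          (max_lt (lt_min one_pos hν) (lt_min (by linarith) (by linarith)) :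
            max 0 (1 - α) < min 1 (meijerNu a b))
        have h3 := le_max_left 0 (1 - α)
        have h4 := le_max_right 0 (1 - α)
        have h5 := min_le_left 1 (meijerNu a b)
        have h6 := min_le_right 1 (meijerNu a b)
        exact ⟨e, by linarith, by linarith, by linarith, fun _ => by linarith⟩
      · obtain ⟨e, h1, h2⟩ := exists_between (lt_min one_pos hν : 0 < min 1 (meijerNu a b))
        have h5 := min_le_left 1 (meijerNu a b)
        have h6 := min_le_right 1 (meijerNu a b)
        exact ⟨e, h1, by linarith, by linarith, fun h => absurd h hP'⟩
    exact ⟨1 - e, by linarith, by linarith, heP,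
      meijerLineEstimate_of_conditionB h hab.m_le hab.n_le hc.1 hc.2.1 he0 he1 heν⟩
  · refine habs _ (hc.2.2 h) (Or.inr ⟨?_, le_rfl, le_rfl⟩)
    rcases h with h | h <;> exact h.1

end Indices

/-! ### Return to the Riesz potential and the main theorem. -/

theorem rieszIntegrand_eq {d : ℕ} {α : ℝ} (f : EuclideanSpace ℝ (Fin d) → ℂ)
    (x y : EuclideanSpace ℝ (Fin d)) :
    rieszIntegrand α f x y = f (x - y) * ((‖x - (x - y)‖ ^ (α - d) : ℝ) : ℂ) := by
  rw [rieszIntegrand, sub_sub_cancel, div_eq_mul_inv, ← Complex.ofReal_inv,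
    ← Real.rpow_neg (norm_nonneg _), neg_sub]

theorem RieszPair.integrable_rieszIntegrand {d : ℕ} {α : ℝ} {V : MvPolynomial (Fin d) ℂ}
    {x : EuclideanSpace ℝ (Fin d)} {φ : ℝ → ℂ} {A : ℂ} (h : RieszPair α V x φ A) :
    Integrable (rieszIntegrand α (fun y => evalAt V y * φ (‖y‖ ^ 2)) x) :=
  (h.1.comp_sub_left x).congr (ae_of_all _ fun y =>
    (rieszIntegrand_eq (fun y => evalAt V y * φ (‖y‖ ^ 2)) x y).symm)

theorem RieszPair.rieszPotential_eq {d : ℕ} {α : ℝ} {V : MvPolynomial (Fin d) ℂ}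
    {x : EuclideanSpace ℝ (Fin d)} {φ : ℝ → ℂ} {A : ℂ} (h : RieszPair α V x φ A) :
    rieszPotential α (fun y => evalAt V y * φ (‖y‖ ^ 2)) x =
      (2 : ℂ) ^ (-α : ℂ) * evalAt V x * A := by
  rw [rieszPotential, ← h.2, ← integral_sub_left_eq_self (fun z =>
    evalAt V z * φ (‖z‖ ^ 2) * ((‖x - z‖ ^ (α - d) : ℝ) : ℂ)) volume x]
  simp only [rieszIntegrand_eq]

end

theorem mainTheorem2 {d l m n p q : ℕ} {α : ℝ} (hα : 0 < α) (hαd : α < d)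
    (V : MvPolynomial (Fin d) ℂ) (hV : IsSolidHarmonic l V)
    (a : Fin p → ℂ) (b : Fin q → ℂ) (hab : MeijerParams m n a b)
    (x : EuclideanSpace ℝ (Fin d)) (hx : x ≠ 0)
    (hcond :
      (ConditionA m n p q ∧
        ((α + l : ℝ) : EReal) < 2 * (1 - aUpper n a) ∧
        -2 * bLower m b < ((d + l : ℝ) : EReal)) ∨
      ((ConditionB m n p q ∨ ConditionC m n p q ∨ ConditionD m n p q) ∧
        ((α + l : ℝ) : EReal) < 2 * lambdaUpper m n a b ∧
        2 * lambdaLower m n a b < ((d + l : ℝ) : EReal) ∧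
        (ConditionB m n p q →
          0 < meijerNu a b ∧ (‖x‖ ≠ 1 ∨ 1 < meijerNu a b + α)))) :
    MeijerParams (m + 1) (n + 1)
        (shiftExtend (1 - ((d : ℂ) + 2 * l - α) / 2) a (α / 2) (α / 2))
        (shiftExtend 0 b (α / 2) (1 - ((d : ℂ) + 2 * l) / 2)) ∧
      Integrable
        (rieszIntegrand α (fun y => evalAt V y * meijerG m n a b (‖y‖ ^ 2)) x) ∧
      rieszPotential α (fun y => evalAt V y * meijerG m n a b (‖y‖ ^ 2)) x =
        (2 : ℂ) ^ (-α : ℂ) * evalAt V x *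
          meijerG (m + 1) (n + 1)
            (shiftExtend (1 - ((d : ℂ) + 2 * l - α) / 2) a (α / 2) (α / 2))
            (shiftExtend 0 b (α / 2) (1 - ((d : ℂ) + 2 * l) / 2))
            (‖x‖ ^ 2) := by
  -- The conditions on the extended-real indices are unpacked into real inequalities for each
  -- parameter and, under C and D, for the bound that makes the integrand absolutely integrable.
  have hreal : (∀ j : Fin q, (j : ℕ) < m → -2 * (b j).re < d + l) ∧
      (∀ j : Fin p, (j : ℕ) < n → α + l < 2 * (1 - (a j).re)) ∧
      (ConditionC m n p q → (α + l) / 2 < 1 / 2 + (meijerNu a b - 1) / ((q : ℝ) - p)) ∧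
      (ConditionD m n p q → 1 / 2 - (meijerNu a b - 1) / ((p : ℝ) - q) < (d + l) / 2) := by
    rcases hcond with ⟨hA, h1, h2⟩ | ⟨-, h1, h2, -⟩
    · rw [EReal.neg_mul, mul_comm, ← EReal.neg_mul, mul_comm] at h2
      refine ⟨fun j hj => ?_, fun j hj => lt_of_coe_lt_two_mul h1 (one_sub_aUpper_le hj),
        fun h => ?_, fun h => ?_⟩
      · have := lt_of_two_mul_lt_coe h2 (le_neg_bLower hj)
        linarith
      · unfold ConditionA ConditionC at *; omega
      · unfold ConditionA ConditionD at *; omega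
    · refine ⟨fun j hj => ?_, fun j hj =>
        lt_of_coe_lt_two_mul h1 (lambdaUpper_le.trans (one_sub_aUpper_le hj)),
        fun h => ?_, fun h => ?_⟩
      · have := lt_of_two_mul_lt_coe h2 ((le_neg_bLower hj).trans neg_bLower_le)
        linarith
      · have := lt_of_coe_lt_two_mul (u := lambdaUpper m n a b) h1
          (by rw [lambdaUpper, if_pos h]; exact min_le_right _ _)
        linarith
      · have := lt_of_two_mul_lt_coe (u := lambdaLower m n a b) h2
          (by rw [lambdaLower, if_pos h]; exact le_max_right _ _)
        linarith
  obtain ⟨hb, ha, hC, hD⟩ := hreal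
  have hcond' : ConditionA m n p q ∨ (ConditionB m n p q ∧ 0 < meijerNu a b) ∨
      ConditionC m n p q ∨ ConditionD m n p q := by
    rcases hcond with ⟨h, -⟩ | ⟨h | h, -, -, hB⟩
    · exact Or.inl h
    · exact Or.inr (Or.inl ⟨h, (hB h).1⟩)
    · exact Or.inr (Or.inr h)
  have hP : ConditionB m n p q → ‖x‖ = 1 → 1 < meijerNu a b + α := by
    intro h hx1
    rcases hcond with ⟨hA, -⟩ | ⟨-, -, -, hB⟩
    · unfold ConditionA ConditionB at *; omega
    · exact (hB h).2.resolve_left fun h => h hx1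
  -- The strip is nonempty because `α < d`. Poles need not be separated by the line, since its
  -- wrong-side residues are carried along.
  obtain ⟨c, h1, h2, hc⟩ := exists_isAbscissa (by linarith : (α + l) / 2 < (d + l) / 2) hC hD
  obtain ⟨θ, hθ, hθ1, hθx, hest⟩ := exists_meijerLineEstimate hab hα hc hcond' hP
  have hpair := rieszPair_meijerG hα hαd hV hx hab hb ha hc (by linarith) (by linarith) hcond'
    hθ hθ1 hθx hest
  exact ⟨hab.riesz hαd hb ha, hpair.integrable_rieszIntegrand, hpair.rieszPotential_eq⟩
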